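/- Let $n\in\mathbb N$, $V=\mathbb C^n$, $\gamma\in\mathbb C$, $\lambda\in\mathbb C^n$, $\lambda_{ij}=\lambda_i-\lambda_j$, and let $e_{ij}$ be the matrix units. Products over $k\ne i$ etc. run over indices in $\{1,\dots,n\}$, and empty products equal $1$. Subscripts $1,2,3$ denote tensor legs, $M_{21}$ is $M_{12}$ with the factors exchanged, and $f(h_a)$ means $\sum_k f(\lambda+\gamma\epsilon_k)\,(e_{kk})_a$, with $\epsilon_k$ the $k$-th unit vector. Call $\lambda$ *regular* if $\lambda_{ij}\neq0$ and $\lambda_{ij}+\gamma\ne 0$ for all $i\ne j$. For a spectral parameter $s\neq 0$ define $$D_{12}(s)=1\otimes 1+\sum_{i\ne j}\frac{\gamma}{\lambda_{ij}}(e_{ij}\otimes e_{ji}-e_{ii}\otimes e_{jj})+\frac{\gamma}{s}\sum_{i,j}e_{ij}\otimes e_{ji},$$ $$\hat B_{12}=\sum_i e_{ii}\otimes p_i,\quad p_i=\prod_{k\ne i}\frac{\lambda_{ik}}{\lambda_{ik}+\gamma}\,e_{ii}+\sum_{j\ne i}\Big(e_{jj}-\frac{\gamma}{\lambda_{ji}-\gamma}\prod_{k\ne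 i,j}\frac{\lambda_{ik}}{\lambda_{jk}}\,e_{ij}\Big),\quad \hat C_{12}=\hat B_{21},$$ $$\hat A_{12}(s)=\sum_i\Big(1+\frac\gamma s\Big)e_{ii}\otimes e_{ii}+\sum_{i\neq j}\Big[\Big(1-\frac{\gamma}{\lambda_{ij}}\Big)e_{ii}\otimes e_{jj}+\Big(\frac\gamma s+\frac\gamma{\lambda_{ij}}\Big)e_{ij}\otimes e_{ji}\Big]+\sum_{i\ne j}\gamma\,\frac{\prod_{k\ne i,j}\lambda_{ik}}{\prod_{l\ne j}\lambda_{jl}}\,(e_{ii}\otimes e_{ij}-e_{ij}\otimes e_{ii}),$$ $$\hat b_{ij}=\frac{\sum_{\alpha\subset\{1,\dots,n\}\setminus\{j\},\,|\alpha|=n-i}\ \prod_{l\in\alpha}\lambda_l}{\prod_{k\ne j}\lambda_{jk}},$$ $$\hat R_{12}(s)=\sum_i\Big(1+\frac\gamma s\Big)e_{ii}\otimes e_{ii}+\sum_{i\ne j}\Big(e_{ii}\otimes e_{jj}+\frac\gamma s e_{ij}\otimes e_{ji}\Big)+\gamma\sum_{i=1}^n\sum_{k=1}^{i-1}\sum_{j=1}^{i-k}(e_{i-k,i}\otimes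 e_{j+k-1,j}-e_{j+k-1,j}\otimes e_{i-k,i}).$$ On the trigonometric side let $${}^{trig}D_{12}(s)=\sum_i\frac{\sinh(s+\gamma)}{\sinh s}e_{ii}\otimes e_{ii}+\sum_{i\ne j}\Big[\frac{\sinh\gamma\,\sinh(s+\lambda_{ij})}{\sinh s\,\sinh\lambda_{ij}}e_{ij}\otimes e_{ji}+\frac{\sinh(\lambda_{ij}-\gamma)}{\sinh\lambda_{ij}}e_{ii}\otimes e_{jj}\Big],$$ $$S_{12}(s)=\sum_i\frac{\sinh(s+\gamma)}{\sinh s}e_{ii}\otimes e_{ii}+\sum_{i\neq j}\Big[\frac{\sinh\gamma}{\sinh s}e^{s(2(i-j)-n\,\mathrm{sign}(i-j))/n}e_{ij}\otimes e_{ji}+e^{-\gamma\,\mathrm{sign}(i-j)}e_{ii}\otimes e_{jj}\Big]+2\sinh\gamma\Big[\sum_{i<i'<j}-\sum_{i>i'>j}\Big]e^{-2s(i'-i)/n}e_{ii'}\otimes e_{jj'},$$ where $j'=i+j-i'$ in the last two sums, $\tilde c(u;\lambda)_{jk}=e^{2j(u+n\lambda_k)/n}$, $c=(\tilde c^{-1})^T$,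 and, with $c_1=c_1(u)$, $c_2=c_2(v)$, set ${}^{trig}B_{12}=c_2^{-1}c_2(h_1)$, ${}^{trig}A_{12}=c_1^{-1}c_2^{-1}S^T_{12}(u-v)\,c_1c_2$. Then: 1. (Trigonometric decomposition.) If $\sinh(u-v)\ne0$ and $\sinh\lambda_{ij}\neq0$, $\sinh(\lambda_{ij}+\gamma)\ne0$ for all $i\neq j$, then $\tilde c$ is invertible, $S_{12}\tilde c_1\tilde c_2(\lambda-\gamma h_1)=\tilde c_2\tilde c_1(\lambda-\gamma h_2)\,{}^{trig}D_{12}^T$ and $S^T_{12}c_1c_2(h_1)=c_2c_1(h_2)\,{}^{trig}D_{12}$, where $S$ and ${}^{trig}D$ are taken at $u-v$. Moreover $S^T$ satisfies the Yang–Baxter equation $R_{12}(u_1-u_2)R_{13}(u_1-u_3)R_{23}(u_2-u_3)=R_{23}(u_2-u_3)R_{13}(u_1-u_3)R_{12}(u_1-u_2)$ whenever $\sinh(u_i-u_j)\ne 0$ for all $i<j$. 2. (Rational limit.) If $u\ne v$ and $\lambda$ is regular, then replacing $(\gamma,u,v,\lambda)$ by $(\varepsilon\gamma,\varepsilon u,\varepsilon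 v,\varepsilon\lambda)$ and letting $\varepsilon\to0$, $\varepsilon\in\mathbb C\setminus\{0\}$, one has ${}^{trig}B\to\hat B$, ${}^{trig}A\to\hat A(u-v)$, ${}^{trig}D(u-v)\to D(u-v)$. 3. (Zero weight and invertibility.) For regular $\lambda$ and $s\neq0$, $[e_{ii}\otimes1,\hat B]=[1\otimes e_{ii},\hat C]=[e_{ii}\otimes1+1\otimes e_{ii},D(s)]=0$ for all $i$. The matrix $\hat b$ is invertible when the $\lambda_i$ are distinct; $\hat B,\hat C$ are invertible for regular $\lambda$; if moreover $s\ne0,\pm\gamma$, then $\hat A(s)$, $D(s)$, $\hat R(s)$ are invertible. 4. (Consistency equations, $g=1$.) Let $\lambda$ be regular and $u_1,u_2,u_3$ distinct, and let $\hat A_{ij}$, $D_{ij}$ be taken at $u_i-u_j$. Then (a) $\hat A_{12}\hat A_{13}\hat A_{23}=\hat A_{23}\hat A_{13}\hat A_{12}$; (b) $\hat A_{12}\hat C_{13}\hat C_{23}=\hat C_{23}\hat C_{13}\hat A_{12}(h_3)$; (c) $D_{12}\hat B_{13}\hat B_{23}(h_1)=\hat B_{23}\hat B_{13}(h_2)D_{12}$,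 provided each $\lambda+\gamma\epsilon_k$ is also regular; (d) $D_{12}(h_3)D_{13}D_{23}(h_1)=D_{23}D_{13}(h_2)D_{12}$. 5. (Parametrization.) For regular $\lambda$ and $s\ne0$, $$\hat B_{12}=\hat b_2^{-1}\hat b_2(h_1),\qquad \hat A_{12}(s)=\hat b_1^{-1}\hat b_2^{-1}\hat R_{12}(s)\hat b_1\hat b_2,\qquad D_{12}(s)=\hat b_1(h_2)^{-1}\hat b_2^{-1}\hat R_{12}(s)\hat b_1\hat b_2(h_1).$$ 6. The non-dynamical, difference-dependent matrix $\hat R(s)$ satisfies the Yang–Baxter equation for distinct $u_1,u_2,u_3$, and $\hat R(s)\to (R^\infty)^T$ as $|s|\to\infty$, where $R^\infty=\sum_{i,j}e_{ii}\otimes e_{jj}+\gamma\sum_{i=1}^n\sum_{k=1}^{i-1}\sum_{j=1}^{i-k}(e_{i,i-k}\otimes e_{j,j+k-1}-e_{j,j+k-1}\otimes e_{i,i-k})$ is the constant rational Cremmer–Gervais-type matrix. -/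

import Mathlib

open scoped Kronecker Topology
open Filter Matrix

namespace SDRE

noncomputable section

/-- Endomorphisms of `V = ℂⁿ`. -/
abbrev End1 (n : ℕ) := Matrix (Fin n) (Fin n) ℂ

/-- Endomorphisms of `V ⊗ V`. -/
abbrev End2 (n : ℕ) := Matrix (Fin n × Fin n) (Fin n × Fin n) ℂ

/-- Endomorphisms of `V ⊗ V ⊗ V`. -/
abbrev End3 (n : ℕ) := Matrix (Fin n × Fin n × Fin n) (Fin n × Fin n × Fin n) ℂ

/-- The matrix unit `e_{ij}`. -/
def e {n : ℕ} (i j : Fin n) : End1 n := Matrix.single i j 1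

/-- The matrix unit `e_{pq}` with natural-number labels `p, q` running from `1` to `n`. -/
def eN (n : ℕ) (p q : ℕ) : End1 n :=
  Matrix.of fun a b => if (a : ℕ) + 1 = p ∧ (b : ℕ) + 1 = q then 1 else 0

/-- The dynamical variable `l` with its `k`-th coordinate shifted by `γ`. -/
def shift {n : ℕ} (γ : ℂ) (k : Fin n) (l : Fin n → ℂ) : Fin n → ℂ := l + Pi.single k γ

/-! Leg notation: `M₁`, `M₂` on `V ⊗ V`, and `M₁₂`, `M₁₃`, `M₂₃` on `V ⊗ V ⊗ V`. -/

def leg1 {n : ℕ} (M : End1 n) : End2 n := M ⊗ₖ (1 : End1 n)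

def leg2 {n : ℕ} (M : End1 n) : End2 n := (1 : End1 n) ⊗ₖ M

def leg12 {n : ℕ} (M : End2 n) : End3 n :=
  Matrix.of fun a b => if a.2.2 = b.2.2 then M (a.1, a.2.1) (b.1, b.2.1) else 0

def leg13 {n : ℕ} (M : End2 n) : End3 n :=
  Matrix.of fun a b => if a.2.1 = b.2.1 then M (a.1, a.2.2) (b.1, b.2.2) else 0

def leg23 {n : ℕ} (M : End2 n) : End3 n :=
  Matrix.of fun a b => if a.1 = b.1 then M (a.2.1, a.2.2) (b.2.1, b.2.2) else 0

/-- Exchange of the two tensor factors, `M₁₂ ↦ M₂₁`. -/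
def swap12 {n : ℕ} (M : End2 n) : End2 n := M.submatrix Prod.swap Prod.swap

/-! Dynamical legs: `f(h_a) = ∑ₖ f(λ + γ eᵏ) (e_{kk})_a`, where `a` labels a factor on which
`f` acts trivially. -/

/-- `f₁(h₂)`. -/
def leg1h2 {n : ℕ} (γ : ℂ) (f : (Fin n → ℂ) → End1 n) (l : Fin n → ℂ) : End2 n :=
  ∑ k, f (shift γ k l) ⊗ₖ e k k

/-- `f₂(h₁)`. -/
def leg2h1 {n : ℕ} (γ : ℂ) (f : (Fin n → ℂ) → End1 n) (l : Fin n → ℂ) : End2 n :=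
  ∑ k, e k k ⊗ₖ f (shift γ k l)

/-- `f₁₂(h₃)`. -/
def leg12h3 {n : ℕ} (γ : ℂ) (f : (Fin n → ℂ) → End2 n) (l : Fin n → ℂ) : End3 n :=
  Matrix.of fun a b =>
    if a.2.2 = b.2.2 then f (shift γ a.2.2 l) (a.1, a.2.1) (b.1, b.2.1) else 0

/-- `f₁₃(h₂)`. -/
def leg13h2 {n : ℕ} (γ : ℂ) (f : (Fin n → ℂ) → End2 n) (l : Fin n → ℂ) : End3 n :=
  Matrix.of fun a b =>
    if a.2.1 = b.2.1 then f (shift γ a.2.1 l) (a.1, a.2.2) (b.1, b.2.2) else 0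

/-- `f₂₃(h₁)`. -/
def leg23h1 {n : ℕ} (γ : ℂ) (f : (Fin n → ℂ) → End2 n) (l : Fin n → ℂ) : End3 n :=
  Matrix.of fun a b =>
    if a.1 = b.1 then f (shift γ a.1 l) (a.2.1, a.2.2) (b.2.1, b.2.2) else 0

/-- The ordinary Yang–Baxter equation for a difference-dependent `R(s)`, at `u₁, u₂, u₃`. -/
def YBE {n : ℕ} (R : ℂ → End2 n) (u₁ u₂ u₃ : ℂ) : Prop :=
  leg12 (R (u₁ - u₂)) * leg13 (R (u₁ - u₃)) * leg23 (R (u₂ - u₃))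
    = leg23 (R (u₂ - u₃)) * leg13 (R (u₁ - u₃)) * leg12 (R (u₁ - u₂))

/-! ### The rational matrices -/

/-- `l` avoids the poles `λᵢⱼ = 0` and `λᵢⱼ + γ = 0`, where `λᵢⱼ = λᵢ - λⱼ`, `i ≠ j`. -/
def Regular {n : ℕ} (γ : ℂ) (l : Fin n → ℂ) : Prop :=
  ∀ i j, i ≠ j → l i - l j ≠ 0 ∧ l i - l j + γ ≠ 0

/-- The constant rational Arutyunov–Chekhov–Frolov matrix `D^∞`. -/
def DInf (n : ℕ) (γ : ℂ) (l : Fin n → ℂ) : End2 n :=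
  (1 : End1 n) ⊗ₖ (1 : End1 n)
    + ∑ i, ∑ j ∈ Finset.univ.erase i,
        (γ / (l i - l j)) • (e i j ⊗ₖ e j i - e i i ⊗ₖ e j j)

/-- The rational Arutyunov–Chekhov–Frolov matrix `D₁₂(s; λ)`. -/
def DACF (n : ℕ) (γ s : ℂ) (l : Fin n → ℂ) : End2 n :=
  DInf n γ l + (γ / s) • ∑ i, ∑ j, e i j ⊗ₖ e j i

/-- The blocks `pᵢ` of `B̂`. -/
def pBlock (n : ℕ) (γ : ℂ) (l : Fin n → ℂ) (i : Fin n) : End1 n :=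
  (∏ k ∈ Finset.univ.erase i, (l i - l k) / (l i - l k + γ)) • e i i
    + ∑ j ∈ Finset.univ.erase i,
        (e j j
          - ((γ / (l j - l i - γ))
              * ∏ k ∈ (Finset.univ.erase i).erase j, (l i - l k) / (l j - l k)) • e i j)

/-- `B̂₁₂(λ)`. -/
def Bhat (n : ℕ) (γ : ℂ) (l : Fin n → ℂ) : End2 n :=
  ∑ i, e i i ⊗ₖ pBlock n γ l i

/-- `Ĉ₁₂ = B̂₂₁`. -/
def Chat (n : ℕ) (γ : ℂ) (l : Fin n → ℂ) : End2 n := swap12 (Bhat n γ l)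

/-- `Â₁₂(s; λ)`, `s = u - v`. -/
def Ahat (n : ℕ) (γ s : ℂ) (l : Fin n → ℂ) : End2 n :=
  (∑ i, (1 + γ / s) • (e i i ⊗ₖ e i i))
    + (∑ i, ∑ j ∈ Finset.univ.erase i,
        ((1 - γ / (l i - l j)) • (e i i ⊗ₖ e j j)
          + (γ / s + γ / (l i - l j)) • (e i j ⊗ₖ e j i)))
    + ∑ i, ∑ j ∈ Finset.univ.erase i,
        (γ * (∏ k ∈ (Finset.univ.erase i).erase j, (l i - l k))
            / ∏ m ∈ Finset.univ.erase j, (l j - l m))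
          • (e i i ⊗ₖ e i j - e i j ⊗ₖ e i i)

/-- The twist `b̂(λ)`. Its `(i, j)` entry (labels from `1`) has as numerator the elementary symmetric
polynomial of degree `n - i` in the `λₗ`, `l ≠ j`. -/
def bhat (n : ℕ) (l : Fin n → ℂ) : End1 n :=
  Matrix.of fun i j =>
    (∑ α ∈ (Finset.univ.erase j).powersetCard (n - ((i : ℕ) + 1)), ∏ m ∈ α, l m)
      / ∏ k ∈ Finset.univ.erase j, (l j - l k)

/-- `R̂₁₂(s)`. -/
def Rhat (n : ℕ) (γ s : ℂ) : End2 n :=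
  (∑ i, (1 + γ / s) • (e i i ⊗ₖ e i i))
    + (∑ i, ∑ j ∈ Finset.univ.erase i, (e i i ⊗ₖ e j j + (γ / s) • (e i j ⊗ₖ e j i)))
    + γ • ∑ i ∈ Finset.Icc 1 n, ∑ k ∈ Finset.Icc 1 (i - 1), ∑ j ∈ Finset.Icc 1 (i - k),
        (eN n (i - k) i ⊗ₖ eN n (j + k - 1) j - eN n (j + k - 1) j ⊗ₖ eN n (i - k) i)

/-- The constant rational Cremmer–Gervais-type matrix `R^∞`. -/
def RInf (n : ℕ) (γ : ℂ) : End2 n :=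
  (∑ i, ∑ j, e i i ⊗ₖ e j j)
    + γ • ∑ i ∈ Finset.Icc 1 n, ∑ k ∈ Finset.Icc 1 (i - 1), ∑ j ∈ Finset.Icc 1 (i - k),
        (eN n i (i - k) ⊗ₖ eN n j (j + k - 1) - eN n j (j + k - 1) ⊗ₖ eN n i (i - k))

/-! ### The trigonometric matrices -/

/-- `l` avoids the zeros of `sinh λᵢⱼ` and `sinh (λᵢⱼ + γ)`, `i ≠ j`. -/
def TrigRegular {n : ℕ} (γ : ℂ) (l : Fin n → ℂ) : Prop :=
  ∀ i j, i ≠ j → Complex.sinh (l i - l j) ≠ 0 ∧ Complex.sinh (l i - l j + γ) ≠ 0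

/-- The trigonometric dynamical `D`-matrix. -/
def trigD (n : ℕ) (γ s : ℂ) (l : Fin n → ℂ) : End2 n :=
  (∑ i, (Complex.sinh (s + γ) / Complex.sinh s) • (e i i ⊗ₖ e i i))
    + ∑ i, ∑ j ∈ Finset.univ.erase i,
        ((Complex.sinh γ * Complex.sinh (s + (l i - l j))
              / (Complex.sinh s * Complex.sinh (l i - l j))) • (e i j ⊗ₖ e j i)
          + (Complex.sinh (l i - l j - γ) / Complex.sinh (l i - l j)) • (e i i ⊗ₖ e j j))

/-- The sign of `i - j`. -/
def sgn {n : ℕ} (i j : Fin n) : ℂ := ((Int.sign ((i : ℤ) - (j : ℤ)) : ℤ) : ℂ)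

/-- The non-dynamical matrix `S₁₂(s)` of the trigonometric decomposition. -/
def trigS (n : ℕ) (γ s : ℂ) : End2 n :=
  (∑ i, (Complex.sinh (s + γ) / Complex.sinh s) • (e i i ⊗ₖ e i i))
    + (∑ i : Fin n, ∑ j ∈ Finset.univ.erase i,
        ((Complex.sinh γ / Complex.sinh s
              * Complex.exp (s * (2 * ((i : ℂ) - (j : ℂ)) - n * sgn i j) / n))
            • (e i j ⊗ₖ e j i)
          + Complex.exp (-γ * sgn i j) • (e i i ⊗ₖ e j j)))
    + (2 * Complex.sinh γ) • ∑ i : Fin n, ∑ i' : Fin n, ∑ j : Fin n, ∑ j' : Fin n,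
        if (i : ℕ) + (j : ℕ) = (i' : ℕ) + (j' : ℕ) then
          (if i < i' ∧ i' < j then
              Complex.exp (-2 * s * ((i' : ℂ) - (i : ℂ)) / n) • (e i i' ⊗ₖ e j j') else 0)
            - (if i' < i ∧ j < i' then
              Complex.exp (-2 * s * ((i' : ℂ) - (i : ℂ)) / n) • (e i i' ⊗ₖ e j j') else 0)
        else 0

/-- `c̃(u; λ)`, with `(j, k)` entry `exp (2 j (u + n λₖ) / n)` for labels from `1`. -/
def cTilde (n : ℕ) (u : ℂ) (l : Fin n → ℂ) : End1 n :=
  Matrix.of fun j k => Complex.exp (2 * ((j : ℂ) + 1) * (u + n * l k) / n)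

/-- `c = (c̃⁻¹)ᵀ`. -/
def cMat (n : ℕ) (u : ℂ) (l : Fin n → ℂ) : End1 n := ((cTilde n u l)⁻¹)ᵀ

/-- The trigonometric `B`-matrix `c₂⁻¹ c₂(h₁)`. -/
def trigB (n : ℕ) (γ v : ℂ) (l : Fin n → ℂ) : End2 n :=
  (leg2 (cMat n v l))⁻¹ * leg2h1 γ (cMat n v) l

/-- The trigonometric `A`-matrix `c₁⁻¹ c₂⁻¹ Sᵀ₁₂ c₁ c₂`. -/
def trigA (n : ℕ) (γ u v : ℂ) (l : Fin n → ℂ) : End2 n :=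
  (leg1 (cMat n u l))⁻¹ * (leg2 (cMat n v l))⁻¹ * (trigS n γ (u - v))ᵀ
    * leg1 (cMat n u l) * leg2 (cMat n v l)

end

end SDRE

/-!
The trigonometric and the rational matrices are two instances of one structure. Let `f` be `sinh`
or the identity and let `w u z` be a moment curve in `V`: up to constant factors its coordinates
are consecutive powers of `exp (2 z)`, respectively of `z`. Let `R` be `S`, respectively the
transpose of `R̂`. The basic fact is the intertwining relation
`R (u - v) (w u x ⊗ w v y) = α w u x ⊗ w v y + β w u y ⊗ w v x`, with
`α = f (x - y - γ) / f (x - y)` and `β = f γ f (u - v + x - y) / (f (u - v) f (x - y))`: the terms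
of `R` of Cremmer–Gervais type produce a geometric sum, which is a divided difference
(`trigS_intertwine`, `Rhat_intertwine`). The other ingredient is Lagrange interpolation on the
curve, `w u z = ∑ a, lagrange l a z • w u (l a)`. Together they form `VertexFace`, and everything
about the twist `c = (W⁻¹)ᵀ`, where `W` has the columns `w u (λ k)`, follows from them.

* The coefficients `α` and `β` at `x = λ i`, `y = λ j` are the entries of `D`. Hence the
  decomposition of `D` by `c̃` is a column by column statement (`VertexFace.vector_decomposition`).
  The one by `c` follows by pairing with `w u x ⊗ w v y` at generic points, where it reduces to a
  three-term identity (`VertexFace.covector_decomposition`).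
* `c₂⁻¹ c₂(h₁)` has interpolation coefficients as entries (`VertexFace.dynB_eq`). For
  `c₁⁻¹ c₂⁻¹ Rᵀ c₁ c₂` one needs `R` on a tensor square `w u x ⊗ w v x`, where the intertwining
  relation degenerates; its value is found by interpolating the second factor at a generic
  point (`VertexFace.mulVec_tensor_self`, `VertexFace.dynA_eq`).
* The Yang–Baxter equation for `R` is checked on a basis of tensors `w u₁ x ⊗ w u₂ y ⊗ w u₃ z` with
  distinct points; there it becomes the addition formula of `coth`, respectively of `1 / x`
  (`VertexFace.yang_baxter`).

In the rational case the twist is `b̂` by Vieta's formulas (`dualMatrix_ratCurve`), and `D`, `Â`,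
`B̂` have the entries found above (`DACF_eq_dynD`, `Ahat_eq_dynA`, `Bhat_eq_dynB`). So the
parametrization holds, and the rational limit is the entrywise limit
`sinh (ε x) / sinh (ε y) → x / y`. By the parametrization, `Â` is conjugate to `R̂` by `b̂ ⊗ b̂`, and
`b̂(λ) pₖ = b̂(λ + γ εₖ)` for the blocks of `B̂`; the consistency equations involving `Â` or `B̂`
follow. The one for `D` alone is a scalar identity for each triple of indices
(`dynamical_yang_baxter_apply`). Invertibility comes from `D₁₂(s) D₂₁(-s) = 1 - γ² / s²`.
-/

namespace SDRE

/-! ### Functions with an addition formula -/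

/-- A function `f` with companion `c` obeying the addition formulas of `sinh`, `cosh` (`κ = 1`) or
of `x`, `1` (`κ = 0`). -/
structure AddFormula (f c : ℂ → ℂ) (κ : ℂ) : Prop where
  add : ∀ x y, f (x + y) = f x * c y + c x * f y
  cadd : ∀ x y, c (x + y) = c x * c y + κ * (f x * f y)
  neg : ∀ x, f (-x) = -f x
  cneg : ∀ x, c (-x) = c x
  sq : ∀ x, c x * c x = 1 + κ * (f x * f x)

namespace AddFormula

variable {f c : ℂ → ℂ} {κ : ℂ}

lemma zero (h : AddFormula f c κ) : f 0 = 0 := by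
  have := h.neg 0
  rw [neg_zero] at this
  linear_combination (1 / 2) * this

lemma sub (h : AddFormula f c κ) (x y : ℂ) : f (x - y) = f x * c y - c x * f y := by
  rw [sub_eq_add_neg, h.add, h.neg, h.cneg]; ring

lemma csub (h : AddFormula f c κ) (x y : ℂ) : c (x - y) = c x * c y - κ * (f x * f y) := by
  rw [sub_eq_add_neg, h.cadd, h.neg, h.cneg]; ring

lemma sub_comm (h : AddFormula f c κ) (x y : ℂ) : f (x - y) = -f (y - x) := by
  rw [← h.neg, neg_sub]

lemma weight_sum (h : AddFormula f c κ) (γ s t : ℂ) :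
    f (t - γ) * f s + f γ * f (s + t) = f (s + γ) * f t := by
  rw [h.sub, h.add, h.add]; ring

lemma weight_sub (h : AddFormula f c κ) (γ p q : ℂ) :
    f (p - γ) * f q - f (q - γ) * f p = f γ * f (p - q) := by
  rw [h.sub, h.sub, h.sub]; ring

/-- The three-term identity behind the covector decomposition. -/
lemma three_term (h : AddFormula f c κ) (γ s p q r : ℂ) :
    f r * (f s * f (p - q - γ) * (f (p - r) * f (q - γ)) +
      f γ * f (s + (p - q)) * (f (q - r) * f (p - γ))) =
    f (p - q) * (f s * f (r - γ) * (f (p - r - γ) * f q) +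
      f γ * f (s + r) * (f (p - γ) * f (q - r))) := by
  have hp := h.sq p
  have hq := h.sq q
  have hr := h.sq r
  have hg := h.sq γ
  simp only [h.sub, h.add, h.csub]
  grind

lemma cot_add (h : AddFormula f c κ) {x y : ℂ} (hx : f x ≠ 0) (hy : f y ≠ 0)
    (hxy : f (x + y) ≠ 0) :
    c (x + y) / f (x + y) * (c x / f x + c y / f y) = c x / f x * (c y / f y) + κ := by
  field_simp
  rw [h.cadd, h.add]; ring

end AddFormula

/-! ### Vertex–face data and the matrices with dynamical weights -/

/-- The product tensor `a ⊗ b`. -/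
def tensor {n : ℕ} (a b : Fin n → ℂ) : Fin n × Fin n → ℂ := fun p => a p.1 * b p.2

/-- The matrix with columns `w (l k)`. -/
def nodeMatrix {n : ℕ} (w : ℂ → Fin n → ℂ) (l : Fin n → ℂ) : End1 n :=
  Matrix.of fun i k => w (l k) i

/-- The nodes `l` are pairwise separated by `f`. -/
def Separated {n : ℕ} (f : ℂ → ℂ) (l : Fin n → ℂ) : Prop := ∀ i j, i ≠ j → f (l i - l j) ≠ 0

/-- The interpolation coefficient of the node `l a` at the point `z`. -/
noncomputable def lagrange {n : ℕ} (f g : ℂ → ℂ) (l : Fin n → ℂ) (a : Fin n) (z : ℂ) : ℂ :=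
  g (z - l a) * ∏ k ∈ Finset.univ.erase a, f (z - l k) / f (l a - l k)

/-- The diagonal coefficient of the dynamical `D`-matrix at `λᵢⱼ = t`. -/
noncomputable def wAlpha (f : ℂ → ℂ) (γ t : ℂ) : ℂ := f (t - γ) / f t

/-- The exchange coefficient of the dynamical `D`-matrix at `λᵢⱼ = t`. -/
noncomputable def wBeta (f : ℂ → ℂ) (γ s t : ℂ) : ℂ := f γ * f (s + t) / (f s * f t)

/-- A matrix `R` and a family `w t` of curves in `ℂⁿ`, indexed by the spectral parameter `t`, which
intertwine `R` with the weights `wAlpha` and `wBeta`. The functions `f` and `c` play the roles of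
`sinh` and `cosh`, and `g` is the exponential factor in the interpolation formula of the curves. -/
structure VertexFace (n : ℕ) (f c g : ℂ → ℂ) (κ γ : ℂ) (w : ℂ → ℂ → Fin n → ℂ)
    (R : ℂ → End2 n) : Prop where
  formula : AddFormula f c κ
  /-- All zeros of `f` are imaginary. This provides points at which no denominator vanishes. -/
  ne_zero : ∀ x : ℂ, x.re ≠ 0 → f x ≠ 0
  g_add : ∀ x y, g (x + y) = g x * g y
  g_zero : g 0 = 1
  isUnit : ∀ t (l : Fin n → ℂ), Separated f l → IsUnit (nodeMatrix (w t) l)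
  interp : ∀ t (l : Fin n → ℂ), Separated f l →
    ∀ z i, w t z i = ∑ a, lagrange f g l a z * w t (l a) i
  intertwine : ∀ u v x y, f (u - v) ≠ 0 → f (x - y) ≠ 0 →
    R (u - v) *ᵥ tensor (w u x) (w v y)
      = wAlpha f γ (x - y) • tensor (w u x) (w v y)
        + wBeta f γ (u - v) (x - y) • tensor (w u y) (w v x)

/-- The matrix with `α i j` at `e_{ii} ⊗ e_{jj}` and `β i j` at `e_{ij} ⊗ e_{ji}`. -/
def zeroWeight {n : ℕ} (α β : Fin n → Fin n → ℂ) : End2 n :=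
  Matrix.of fun p q =>
    (if q = p then α p.1 p.2 else 0) + (if q = p.swap then β p.1 p.2 else 0)

/-- The coefficients of `e_{ii} ⊗ e_{jj}` in the dynamical `D`-matrix. -/
noncomputable def dynAlpha {n : ℕ} (f : ℂ → ℂ) (γ s : ℂ) (l : Fin n → ℂ) (i j : Fin n) : ℂ :=
  if i = j then f (s + γ) / f s else wAlpha f γ (l i - l j)

/-- The coefficients of `e_{ij} ⊗ e_{ji}`, `i ≠ j`, in the dynamical `D`-matrix. -/
noncomputable def dynBeta {n : ℕ} (f : ℂ → ℂ) (γ s : ℂ) (l : Fin n → ℂ) (i j : Fin n) : ℂ :=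
  if i = j then 0 else wBeta f γ s (l i - l j)

/-- The dynamical `D`-matrix with weights built from `f`. -/
noncomputable def dynD (n : ℕ) (f : ℂ → ℂ) (γ s : ℂ) (l : Fin n → ℂ) : End2 n :=
  zeroWeight (dynAlpha f γ s l) (dynBeta f γ s l)

/-- The coefficients of the weight-breaking part of the `A`-matrix. -/
noncomputable def dynCoef {n : ℕ} (f g : ℂ → ℂ) (γ : ℂ) (l : Fin n → ℂ) (i j : Fin n) : ℂ :=
  g (l i - l j) * (f γ / f (l j - l i)) *
    ∏ k ∈ (Finset.univ.erase i).erase j, f (l i - l k) / f (l j - l k)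

/-- The `A`-matrix with weights built from `f` and `g`. The two terms with `q = (i, i)` cancel, so
that the value of `dynCoef` on the diagonal is irrelevant. -/
noncomputable def dynA (n : ℕ) (f g : ℂ → ℂ) (γ s : ℂ) (l : Fin n → ℂ) : End2 n :=
  dynD n f γ s l + Matrix.of fun p q =>
    if p.1 = p.2 then
      (if q.1 = p.1 then dynCoef f g γ l p.1 q.2 else 0)
        - (if q.2 = p.1 then dynCoef f g γ l p.1 q.1 else 0)
    else 0

/-- The `B`-matrix with weights built from `f` and `g`. -/
noncomputable def dynB (n : ℕ) (f g : ℂ → ℂ) (γ : ℂ) (l : Fin n → ℂ) : End2 n :=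
  Matrix.of fun p q =>
    if p.1 = q.1 then
      if p.2 = q.2 then
        if p.2 = p.1 then
          g (-γ) * ∏ k ∈ Finset.univ.erase p.1, f (l p.1 - l k) / f (l p.1 - l k + γ)
        else 1
      else if p.2 = p.1 then
        g (l p.1 - l q.2) * (f (-γ) / f (l q.2 - l p.1 - γ)) *
          ∏ k ∈ (Finset.univ.erase p.1).erase q.2, f (l p.1 - l k) / f (l q.2 - l k)
      else 0
    else 0

section Algebra

variable {n : ℕ}

lemma mul_zeroWeight_apply (M : End2 n) (α β : Fin n → Fin n → ℂ) (r : Fin n × Fin n)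
    (a b : Fin n) :
    (M * zeroWeight α β) r (a, b) = M r (a, b) * α a b + M r (b, a) * β b a := by
  have h : ∀ x : Fin n × Fin n, (a, b) = x.swap ↔ (b, a) = x := by
    rintro ⟨x, y⟩; simp [and_comm]
  simp [Matrix.mul_apply, zeroWeight, mul_add, Finset.sum_add_distrib, h]

lemma mul_zeroWeight_transpose_apply (M : End2 n) (α β : Fin n → Fin n → ℂ) (r : Fin n × Fin n)
    (a b : Fin n) :
    (M * (zeroWeight α β)ᵀ) r (a, b) = M r (a, b) * α a b + M r (b, a) * β a b := by
  simp [Matrix.mul_apply, zeroWeight, mul_add, Finset.sum_add_distrib]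

lemma zeroWeight_mulVec (α β : Fin n → Fin n → ℂ) (F : Fin n × Fin n → ℂ) (a b : Fin n) :
    (zeroWeight α β *ᵥ F) (a, b) = α a b * F (a, b) + β a b * F (b, a) := by
  simp [Matrix.mulVec, dotProduct, zeroWeight, add_mul, Finset.sum_add_distrib]

lemma leg1_mul_leg2 (M N : End1 n) : leg1 M * leg2 N = M ⊗ₖ N := by
  simp [leg1, leg2, ← Matrix.mul_kronecker_mul]

lemma leg2_mul_leg1 (M N : End1 n) : leg2 N * leg1 M = M ⊗ₖ N := by
  simp [leg1, leg2, ← Matrix.mul_kronecker_mul]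

lemma leg2h1_apply (γ : ℂ) (F : (Fin n → ℂ) → End1 n) (l : Fin n → ℂ) (p q : Fin n × Fin n) :
    leg2h1 γ F l p q = if p.1 = q.1 then F (shift γ p.1 l) p.2 q.2 else 0 := by
  rw [leg2h1, Matrix.sum_apply, Finset.sum_eq_single p.1]
  · simp [e, Matrix.single_apply]
  · intro b _ hb
    simp [e, hb]
  · simp

lemma leg1h2_apply (γ : ℂ) (F : (Fin n → ℂ) → End1 n) (l : Fin n → ℂ) (p q : Fin n × Fin n) :
    leg1h2 γ F l p q = if p.2 = q.2 then F (shift γ p.2 l) p.1 q.1 else 0 := by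
  rw [leg1h2, Matrix.sum_apply, Finset.sum_eq_single p.2]
  · simp [e, Matrix.single_apply]
  · intro b _ hb
    simp [e, hb]
  · simp

lemma leg1_mul_leg2h1_apply (M : End1 n) (γ : ℂ) (F : (Fin n → ℂ) → End1 n) (l : Fin n → ℂ)
    (p : Fin n × Fin n) (a b : Fin n) :
    (leg1 M * leg2h1 γ F l) p (a, b) = M p.1 a * F (shift γ a l) p.2 b := by
  simp [Matrix.mul_apply, leg1, leg2h1_apply, Fintype.sum_prod_type, Matrix.kroneckerMap_apply,
    Matrix.one_apply]

lemma leg2_mul_leg1h2_apply (M : End1 n) (γ : ℂ) (F : (Fin n → ℂ) → End1 n) (l : Fin n → ℂ)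
    (p : Fin n × Fin n) (a b : Fin n) :
    (leg2 M * leg1h2 γ F l) p (a, b) = F (shift γ b l) p.1 a * M p.2 b := by
  simp [Matrix.mul_apply, leg2, leg1h2_apply, Fintype.sum_prod_type, Matrix.kroneckerMap_apply,
    Matrix.one_apply, mul_comm]

lemma shift_apply_self (γ : ℂ) (k : Fin n) (l : Fin n → ℂ) : shift γ k l k = l k + γ := by
  simp [shift]

lemma shift_apply_of_ne (γ : ℂ) {k i : Fin n} (h : i ≠ k) (l : Fin n → ℂ) :
    shift γ k l i = l i := by
  simp [shift, h]

lemma Separated.shift {f : ℂ → ℂ} {γ : ℂ} {l : Fin n → ℂ} (hf : ∀ x, f (-x) = -f x)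
    (hl : Separated f l) (hg : ∀ i j, i ≠ j → f (l i - l j + γ) ≠ 0) (k : Fin n) :
    Separated f (SDRE.shift γ k l) := by
  intro i j hij
  by_cases hi : i = k
  · subst hi
    rw [shift_apply_self, shift_apply_of_ne γ hij.symm, add_sub_right_comm]
    exact hg i j hij
  by_cases hj : j = k
  · subst hj
    rw [shift_apply_self, shift_apply_of_ne γ hi, ← neg_sub, hf, add_sub_right_comm]
    exact neg_ne_zero.mpr (hg j i (Ne.symm hij))
  rw [shift_apply_of_ne γ hi, shift_apply_of_ne γ hj]
  exact hl i j hij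

end Algebra

/-! ### Interpolation and the shifted twist -/

/-- The inverse transpose of the matrix with columns `w (l k)`. -/
noncomputable def dualMatrix {n : ℕ} (w : ℂ → Fin n → ℂ) (l : Fin n → ℂ) : End1 n :=
  ((nodeMatrix w l)⁻¹)ᵀ

lemma inv_leg2 {n : ℕ} (M : End1 n) : (leg2 M)⁻¹ = leg2 M⁻¹ := by
  rw [leg2, leg2, Matrix.inv_kronecker, inv_one]

lemma inv_leg1 {n : ℕ} (M : End1 n) : (leg1 M)⁻¹ = leg1 M⁻¹ := by
  rw [leg1, leg1, Matrix.inv_kronecker, inv_one]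

namespace VertexFace

variable {n : ℕ} {f c g : ℂ → ℂ} {κ γ : ℂ} {w : ℂ → ℂ → Fin n → ℂ} {R : ℂ → End2 n}

lemma g_ne_zero (V : VertexFace n f c g κ γ w R) (x : ℂ) : g x ≠ 0 := by
  intro h
  have := V.g_add x (-x)
  rw [add_neg_cancel, V.g_zero, h, zero_mul] at this
  exact one_ne_zero this

lemma wAlpha_add_wBeta (V : VertexFace n f c g κ γ w R) {s t : ℂ} (hs : f s ≠ 0) (ht : f t ≠ 0) :
    wAlpha f γ t + wBeta f γ s t = f (s + γ) / f s := by
  rw [wAlpha, wBeta]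
  field_simp
  linear_combination V.formula.weight_sum γ s t

lemma nodeMatrix_eq_mul (V : VertexFace n f c g κ γ w R) (t : ℂ) {l : Fin n → ℂ}
    (hl : Separated f l) (l' : Fin n → ℂ) :
    nodeMatrix (w t) l' = nodeMatrix (w t) l * Matrix.of fun a k => lagrange f g l a (l' k) := by
  ext i k
  simp [nodeMatrix, Matrix.mul_apply, V.interp t l hl (l' k) i, mul_comm]

lemma inv_mul_nodeMatrix (V : VertexFace n f c g κ γ w R) (t : ℂ) {l : Fin n → ℂ}
    (hl : Separated f l) (l' : Fin n → ℂ) :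
    (nodeMatrix (w t) l)⁻¹ * nodeMatrix (w t) l'
      = Matrix.of fun a k => lagrange f g l a (l' k) := by
  rw [V.nodeMatrix_eq_mul t hl l', ← Matrix.mul_assoc, Matrix.nonsing_inv_mul, Matrix.one_mul]
  exact (Matrix.isUnit_iff_isUnit_det _).mp (V.isUnit t l hl)

/-- Pairing the dual basis with a point of the curve gives the interpolation coefficients. -/
lemma sum_mul_dualMatrix (V : VertexFace n f c g κ γ w R) (t : ℂ) {l : Fin n → ℂ}
    (hl : Separated f l) (z : ℂ) (a : Fin n) :
    ∑ i, w t z i * dualMatrix (w t) l i a = lagrange f g l a z := by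
  have := congrFun (congrFun (V.inv_mul_nodeMatrix t hl (fun _ => z)) a) a
  simpa [Matrix.mul_apply, nodeMatrix, dualMatrix, mul_comm] using this

lemma lagrange_self (V : VertexFace n f c g κ γ w R) {l : Fin n → ℂ}
    (hl : Separated f l) (a b : Fin n) :
    lagrange f g l a (l b) = if a = b then 1 else 0 := by
  rw [lagrange]
  split_ifs with h
  · subst h
    rw [sub_self, V.g_zero, one_mul, Finset.prod_eq_one]
    intro k hk
    exact div_self (hl _ _ (Finset.ne_of_mem_erase hk).symm)
  · rw [Finset.prod_eq_zero (i := b) (by simp [Ne.symm h]), mul_zero]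
    rw [sub_self, V.formula.zero, zero_div]

/-- The part of `lagrange l a z` that does not involve the node `l b`. -/
noncomputable def lagrangePart (f g : ℂ → ℂ) (l : Fin n → ℂ) (a b : Fin n) (z : ℂ) : ℂ :=
  g (z - l a) * ∏ k ∈ (Finset.univ.erase a).erase b, f (z - l k) / f (l a - l k)

lemma lagrange_eq_part (l : Fin n → ℂ) {a b : Fin n} (h : a ≠ b) (z : ℂ) :
    lagrange f g l a z = lagrangePart f g l a b z * (f (z - l b) / f (l a - l b)) := by
  rw [lagrange, lagrangePart, ← Finset.mul_prod_erase _ _ (a := b) (by simp [h.symm])]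
  ring

lemma lagrange_shift_of_ne (l : Fin n → ℂ) {a b : Fin n} (h : a ≠ b) (z : ℂ) :
    lagrange f g (shift γ b l) a z
      = lagrangePart f g l a b z * (f (z - l b - γ) / f (l a - l b - γ)) := by
  rw [lagrange_eq_part _ h, shift_apply_self, shift_apply_of_ne _ h, sub_add_eq_sub_sub,
    sub_add_eq_sub_sub]
  congr 1
  rw [lagrangePart, lagrangePart, shift_apply_of_ne _ h]
  congr 1
  refine Finset.prod_congr rfl fun k hk => ?_
  rw [shift_apply_of_ne _ (Finset.ne_of_mem_erase hk)]

lemma lagrange_shift_self (V : VertexFace n f c g κ γ w R) {l : Fin n → ℂ} (hl : Separated f l)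
    (a : Fin n) (z : ℂ) :
    lagrange f g (shift γ a l) a z
      = lagrange f g l a z *
        (g (-γ) * ∏ k ∈ Finset.univ.erase a, f (l a - l k) / f (l a - l k + γ)) := by
  rw [lagrange, lagrange, shift_apply_self, sub_add_eq_sub_sub, sub_eq_add_neg _ γ, V.g_add]
  have : ∏ k ∈ Finset.univ.erase a, f (z - shift γ a l k) / f (l a + γ - shift γ a l k)
      = (∏ k ∈ Finset.univ.erase a, f (z - l k) / f (l a - l k)) *
        ∏ k ∈ Finset.univ.erase a, f (l a - l k) / f (l a - l k + γ) := by
    rw [← Finset.prod_mul_distrib]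
    refine Finset.prod_congr rfl fun k hk => ?_
    have hk' := Finset.ne_of_mem_erase hk
    rw [shift_apply_of_ne _ hk', add_sub_right_comm, div_mul_div_cancel₀]
    exact hl _ _ hk'.symm
  rw [this]; ring

lemma lagrangePart_swap (V : VertexFace n f c g κ γ w R) (l : Fin n → ℂ) (a b : Fin n) (y z : ℂ) :
    lagrangePart f g l a b y * lagrangePart f g l b a z
      = lagrangePart f g l a b z * lagrangePart f g l b a y := by
  have h : g (y - l a) * g (z - l b) = g (z - l a) * g (y - l b) := by
    rw [← V.g_add, ← V.g_add]; ring_nf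
  simp only [lagrangePart, Finset.prod_div_distrib, Finset.erase_right_comm (a := b) (b := a)]
  linear_combination (∏ k ∈ (Finset.univ.erase a).erase b, f (y - l k)) /
    (∏ k ∈ (Finset.univ.erase a).erase b, f (l a - l k)) *
    ((∏ k ∈ (Finset.univ.erase a).erase b, f (z - l k)) /
    (∏ k ∈ (Finset.univ.erase a).erase b, f (l b - l k))) * h

lemma dualMatrix_eq_inv (V : VertexFace n f c g κ γ w R) (t : ℂ) {l : Fin n → ℂ}
    (hl : Separated f l) : IsUnit (dualMatrix (w t) l) ∧
      (dualMatrix (w t) l)⁻¹ = (nodeMatrix (w t) l)ᵀ := by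
  have hu := (Matrix.isUnit_iff_isUnit_det _).mp (V.isUnit t l hl)
  constructor
  · rw [Matrix.isUnit_iff_isUnit_det, dualMatrix, Matrix.det_transpose]
    exact Matrix.isUnit_nonsing_inv_det _ hu
  · rw [dualMatrix, ← Matrix.transpose_nonsing_inv, Matrix.nonsing_inv_nonsing_inv _ hu]

/-- The entries of `c₂⁻¹ c₂(h₁)` are the interpolation coefficients of the shifted nodes at the
unshifted ones. -/
theorem dynB_eq (V : VertexFace n f c g κ γ w R) (t : ℂ) {l : Fin n → ℂ} (hl : Separated f l)
    (hγ : ∀ i j, i ≠ j → f (l i - l j + γ) ≠ 0) :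
    (leg2 (dualMatrix (w t) l))⁻¹ * leg2h1 γ (dualMatrix (w t)) l = dynB n f g γ l := by
  rw [inv_leg2, (V.dualMatrix_eq_inv t hl).2]
  ext ⟨a, b⟩ ⟨a', b'⟩
  have h2 : (leg2 (nodeMatrix (w t) l)ᵀ * leg2h1 γ (dualMatrix (w t)) l) (a, b) (a', b')
      = if a = a' then lagrange f g (shift γ a l) b' (l b) else 0 := by
    have h3 := V.sum_mul_dualMatrix t (hl.shift V.formula.neg hγ a) (l b) b'
    rw [← h3]
    by_cases h : a = a'
    · subst h
      simp [Matrix.mul_apply, leg2, leg2h1_apply, Fintype.sum_prod_type,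
        Matrix.kroneckerMap_apply, Matrix.one_apply, nodeMatrix]
    · simp [Matrix.mul_apply, leg2, leg2h1_apply, Fintype.sum_prod_type,
        Matrix.kroneckerMap_apply, Matrix.one_apply, nodeMatrix, h]
  rw [h2, dynB]
  simp only [Matrix.of_apply]
  refine if_congr Iff.rfl ?_ rfl
  by_cases hba : b = a
  · subst hba
    by_cases hbb : b = b'
    · subst hbb
      simp [V.lagrange_shift_self hl, V.lagrange_self hl]
    · rw [if_neg hbb, if_pos rfl, lagrange_shift_of_ne l (Ne.symm hbb), lagrangePart, sub_self,
        zero_sub, Finset.erase_right_comm]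
      ring
  · have : l b = shift γ a l b := (shift_apply_of_ne γ hba l).symm
    rw [this, V.lagrange_self (hl.shift V.formula.neg hγ a)]
    simp [hba, eq_comm]

/-! ### The action of `R` on products of points of the curve -/

lemma exists_generic (V : VertexFace n f c g κ γ w R) (l : Fin n → ℂ) :
    ∃ z, ∀ k, f (z - l k) ≠ 0 := by
  obtain ⟨r, hr⟩ := (Set.finite_range fun k => (l k).re).exists_notMem
  refine ⟨r, fun k => V.ne_zero _ ?_⟩
  rw [Complex.sub_re, Complex.ofReal_re]
  exact sub_ne_zero.mpr fun h => hr ⟨k, h.symm⟩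

lemma wAlpha_sub_wAlpha (V : VertexFace n f c g κ γ w R) {p q : ℂ} (hp : f p ≠ 0) (hq : f q ≠ 0) :
    wAlpha f γ p - wAlpha f γ q = f γ * f (p - q) / (f p * f q) := by
  rw [wAlpha, wAlpha]
  field_simp
  linear_combination V.formula.weight_sub γ p q

/-- The source of the coefficients `dynCoef`: they do not depend on the auxiliary point `z`. -/
lemma lagrange_mul_wAlpha_sub (V : VertexFace n f c g κ γ w R) {l : Fin n → ℂ}
    (hl : Separated f l) {z : ℂ} (hz : ∀ k, f (z - l k) ≠ 0) {a m : Fin n} (h : a ≠ m) :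
    lagrange f g l m z * (wAlpha f γ (l a - z) - wAlpha f γ (l a - l m))
      = lagrange f g l a z * dynCoef f g γ l a m := by
  have haz : f (l a - z) ≠ 0 := by
    rw [V.formula.sub_comm]; exact neg_ne_zero.mpr (hz a)
  have hg : g (z - l m) = g (z - l a) * g (l a - l m) := by rw [← V.g_add]; ring_nf
  rw [V.wAlpha_sub_wAlpha haz (hl _ _ h), lagrange_eq_part l h, lagrange_eq_part l h.symm,
    lagrangePart, lagrangePart, dynCoef, hg, sub_sub_sub_cancel_left,
    V.formula.sub_comm (l m) z, V.formula.sub_comm (l a) z, V.formula.sub_comm (l a) (l m),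
    Finset.erase_right_comm (a := m) (b := a)]
  simp only [Finset.prod_div_distrib]
  have h1 : ∏ k ∈ (Finset.univ.erase a).erase m, f (l a - l k) ≠ 0 :=
    Finset.prod_ne_zero_iff.mpr fun k hk => hl _ _ fun h => by simp [h] at hk
  have h2 : ∏ k ∈ (Finset.univ.erase a).erase m, f (l m - l k) ≠ 0 :=
    Finset.prod_ne_zero_iff.mpr fun k hk => hl _ _ fun h => by simp [h] at hk
  have h3 := hz a
  have h4 := hz m
  have h5 := hl _ _ h.symm
  field_simp

/-- The action of `R` on a tensor square. Applying `R` to `w u (l a) ⊗ w v z`, for a generic `z`,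
before and after expanding both sides at the nodes `l` determines the term with `z = l a`. -/
lemma mulVec_tensor_self (V : VertexFace n f c g κ γ w R) {u v : ℂ} (huv : f (u - v) ≠ 0)
    {l : Fin n → ℂ} (hl : Separated f l) (a : Fin n) (p : Fin n × Fin n) :
    (R (u - v) *ᵥ tensor (w u (l a)) (w v (l a))) p
      = f (u - v + γ) / f (u - v) * tensor (w u (l a)) (w v (l a)) p
        + ∑ m, dynCoef f g γ l a m *
          (tensor (w u (l a)) (w v (l m)) p - tensor (w u (l m)) (w v (l a)) p) := by
  obtain ⟨z, hz⟩ := V.exists_generic l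
  have haz : f (l a - z) ≠ 0 := by
    rw [V.formula.sub_comm]; exact neg_ne_zero.mpr (hz a)
  have hla : lagrange f g l a z ≠ 0 :=
    mul_ne_zero (V.g_ne_zero _) (Finset.prod_ne_zero_iff.mpr fun k hk =>
      div_ne_zero (hz k) (hl _ _ (Finset.ne_of_mem_erase hk).symm))
  have e1 : tensor (w u (l a)) (w v z)
      = ∑ m, lagrange f g l m z • tensor (w u (l a)) (w v (l m)) := by
    ext q
    simp only [tensor, Finset.sum_apply, Pi.smul_apply, smul_eq_mul]
    rw [V.interp v l hl z, Finset.mul_sum]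
    exact Finset.sum_congr rfl fun _ _ => by ring
  have e2 : tensor (w u z) (w v (l a))
      = ∑ m, lagrange f g l m z • tensor (w u (l m)) (w v (l a)) := by
    ext q
    simp only [tensor, Finset.sum_apply, Pi.smul_apply, smul_eq_mul]
    rw [V.interp u l hl z, Finset.sum_mul]
    exact Finset.sum_congr rfl fun _ _ => by ring
  have e3 := congrFun (V.intertwine u v (l a) z huv haz) p
  rw [e1, e2, Matrix.mulVec_sum] at e3
  simp only [Matrix.mulVec_smul, Finset.sum_apply, Pi.add_apply, Pi.smul_apply, smul_eq_mul,
    Finset.mul_sum] at e3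
  rw [← Finset.sum_add_distrib, ← sub_eq_zero, ← Finset.sum_sub_distrib,
    ← Finset.add_sum_erase _ _ (Finset.mem_univ a)] at e3
  have e4 : ∀ m ∈ Finset.univ.erase a,
      lagrange f g l m z * (R (u - v) *ᵥ tensor (w u (l a)) (w v (l m))) p
        - (wAlpha f γ (l a - z) * (lagrange f g l m z * tensor (w u (l a)) (w v (l m)) p)
          + wBeta f γ (u - v) (l a - z)
            * (lagrange f g l m z * tensor (w u (l m)) (w v (l a)) p))
        = -(lagrange f g l a z * (dynCoef f g γ l a m *
          (tensor (w u (l a)) (w v (l m)) p - tensor (w u (l m)) (w v (l a)) p))) := by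
    intro m hm
    have ham : a ≠ m := (Finset.ne_of_mem_erase hm).symm
    have h1 := congrFun (V.intertwine u v (l a) (l m) huv (hl _ _ ham)) p
    simp only [Pi.add_apply, Pi.smul_apply, smul_eq_mul] at h1
    have h2 := V.lagrange_mul_wAlpha_sub hl hz ham
    have h3 := V.wAlpha_add_wBeta huv haz
    have h4 := V.wAlpha_add_wBeta huv (hl _ _ ham)
    rw [h1]
    linear_combination (tensor (w u (l m)) (w v (l a)) p - tensor (w u (l a)) (w v (l m)) p) * h2
      + lagrange f g l m z * tensor (w u (l m)) (w v (l a)) p * (h4 - h3)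
  rw [Finset.sum_congr rfl e4, Finset.sum_neg_distrib, ← Finset.mul_sum] at e3
  rw [← Finset.add_sum_erase _ _ (Finset.mem_univ a), sub_self, mul_zero, zero_add]
  apply mul_left_cancel₀ hla
  linear_combination e3 + lagrange f g l a z * tensor (w u (l a)) (w v (l a)) p
    * V.wAlpha_add_wBeta huv haz

/-- In the basis of product tensors `w (l a) ⊗ w (l b)` the matrix `R` is the transpose of the
`A`-matrix. -/
theorem mul_kronecker_nodeMatrix (V : VertexFace n f c g κ γ w R) {u v : ℂ} (huv : f (u - v) ≠ 0)
    {l : Fin n → ℂ} (hl : Separated f l) :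
    R (u - v) * (nodeMatrix (w u) l ⊗ₖ nodeMatrix (w v) l)
      = (nodeMatrix (w u) l ⊗ₖ nodeMatrix (w v) l) * (dynA n f g γ (u - v) l)ᵀ := by
  ext p ⟨a, b⟩
  have hL : (R (u - v) * (nodeMatrix (w u) l ⊗ₖ nodeMatrix (w v) l)) p (a, b)
      = (R (u - v) *ᵥ tensor (w u (l a)) (w v (l b))) p := rfl
  rw [hL, dynA, Matrix.transpose_add, Matrix.mul_add, dynD, Matrix.add_apply,
    mul_zeroWeight_transpose_apply]
  have hk : ∀ i j, (nodeMatrix (w u) l ⊗ₖ nodeMatrix (w v) l) p (i, j)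
      = tensor (w u (l i)) (w v (l j)) p := fun i j => rfl
  by_cases hab : a = b
  · subst hab
    rw [V.mulVec_tensor_self huv hl]
    simp only [hk, Matrix.mul_apply, Fintype.sum_prod_type, dynAlpha, dynBeta, if_true,
      Matrix.transpose_apply, Matrix.of_apply, mul_sub, Finset.sum_sub_distrib]
    simp [mul_comm]
  · rw [V.intertwine u v _ _ huv (hl _ _ hab)]
    simp [Matrix.mul_apply, dynAlpha, dynBeta, hab, mul_comm, tensor, nodeMatrix]

theorem dynA_eq (V : VertexFace n f c g κ γ w R) {u v : ℂ} (huv : f (u - v) ≠ 0)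
    {l : Fin n → ℂ} (hl : Separated f l) :
    (leg1 (dualMatrix (w u) l))⁻¹ * (leg2 (dualMatrix (w v) l))⁻¹ * (R (u - v))ᵀ
      * leg1 (dualMatrix (w u) l) * leg2 (dualMatrix (w v) l) = dynA n f g γ (u - v) l := by
  have h := congrArg Matrix.transpose (V.mul_kronecker_nodeMatrix huv hl)
  obtain ⟨hu, hu'⟩ := V.dualMatrix_eq_inv u hl
  obtain ⟨hv, hv'⟩ := V.dualMatrix_eq_inv v hl
  rw [Matrix.transpose_mul, Matrix.transpose_mul, Matrix.transpose_transpose,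
    ← Matrix.kroneckerMap_transpose, ← hu', ← hv'] at h
  rw [inv_leg1, inv_leg2, leg1_mul_leg2, Matrix.mul_assoc _ (leg1 _) (leg2 _), leg1_mul_leg2, h,
    Matrix.mul_assoc, ← Matrix.mul_kronecker_mul, Matrix.nonsing_inv_mul,
    Matrix.nonsing_inv_mul, Matrix.one_kronecker_one, Matrix.mul_one]
  · exact (Matrix.isUnit_iff_isUnit_det _).mp hv
  · exact (Matrix.isUnit_iff_isUnit_det _).mp hu

/-- The vector form of the decomposition of the dynamical `D`-matrix. -/
theorem vector_decomposition (V : VertexFace n f c g κ γ w R) {u v : ℂ} (huv : f (u - v) ≠ 0)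
    {l : Fin n → ℂ} (hl : Separated f l) :
    R (u - v) * leg1 (nodeMatrix (w u) l) * leg2h1 (-γ) (nodeMatrix (w v)) l
      = leg2 (nodeMatrix (w v) l) * leg1h2 (-γ) (nodeMatrix (w u)) l
        * (dynD n f γ (u - v) l)ᵀ := by
  ext p ⟨a, b⟩
  have hL : (R (u - v) * leg1 (nodeMatrix (w u) l) * leg2h1 (-γ) (nodeMatrix (w v)) l) p (a, b)
      = (R (u - v) *ᵥ tensor (w u (l a)) (w v (shift (-γ) a l b))) p := by
    rw [Matrix.mul_assoc, Matrix.mul_apply, Matrix.mulVec, dotProduct]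
    exact Finset.sum_congr rfl fun q _ => by rw [leg1_mul_leg2h1_apply]; rfl
  rw [hL, dynD, mul_zeroWeight_transpose_apply, leg2_mul_leg1h2_apply, leg2_mul_leg1h2_apply]
  simp only [nodeMatrix, Matrix.of_apply]
  by_cases hab : a = b
  · subst hab
    rw [shift_apply_self]
    simp only [dynAlpha, dynBeta, if_true, mul_zero, add_zero]
    by_cases hγ : f γ = 0
    · -- Here `l a - γ` is a zero of `f (· - l a)`, so its point is proportional to that of `l a`.
      have h0 : ∀ t i, w t (l a + -γ) i = lagrange f g l a (l a + -γ) * w t (l a) i := by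
        intro t i
        rw [V.interp t l hl (l a + -γ) i]
        refine Finset.sum_eq_single a (fun m _ hm => ?_) (by simp)
        rw [lagrange_eq_part l hm, add_sub_cancel_left, V.formula.neg, hγ]
        simp
      have h1 : tensor (w u (l a)) (w v (l a + -γ))
          = lagrange f g l a (l a + -γ) • tensor (w u (l a)) (w v (l a)) := by
        ext q
        simp only [tensor, Pi.smul_apply, smul_eq_mul, h0]; ring
      rw [h1, Matrix.mulVec_smul, Pi.smul_apply, V.mulVec_tensor_self huv hl, h0]
      simp only [dynCoef, hγ, zero_div, mul_zero, zero_mul, Finset.sum_const_zero, add_zero,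
        tensor, smul_eq_mul]
      ring
    · have h1 : l a - (l a + -γ) = γ := by ring
      rw [V.intertwine u v _ _ huv (by rwa [h1]), h1]
      simp only [wAlpha, wBeta, sub_self, V.formula.zero, zero_div, zero_smul, zero_add,
        Pi.smul_apply, tensor, smul_eq_mul]
      field_simp
  · rw [shift_apply_of_ne _ (Ne.symm hab), shift_apply_of_ne _ hab,
      V.intertwine u v _ _ huv (hl _ _ hab)]
    simp only [dynAlpha, dynBeta, hab, if_false, Pi.add_apply, Pi.smul_apply, tensor, smul_eq_mul]
    ring

end VertexFace

/-! ### The covector decomposition and the Yang–Baxter equation -/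

/-- The product tensor `a ⊗ b ⊗ c`. -/
def tensor3 {n : ℕ} (a b c : Fin n → ℂ) : Fin n × Fin n × Fin n → ℂ :=
  fun p => a p.1 * (b p.2.1 * c p.2.2)

section Algebra

variable {n : ℕ}

lemma isUnit_kronecker {m : Type*} [Fintype m] [DecidableEq m] {A : End1 n} {B : Matrix m m ℂ}
    (hA : IsUnit A) (hB : IsUnit B) : IsUnit (A ⊗ₖ B) := by
  rw [Matrix.isUnit_iff_isUnit_det] at *
  rw [Matrix.det_kronecker]
  exact (hA.pow _).mul (hB.pow _)

lemma sum_tensor_mul (a b c d : Fin n → ℂ) :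
    ∑ p, tensor a b p * (c p.1 * d p.2) = (∑ i, a i * c i) * ∑ j, b j * d j := by
  rw [Fintype.sum_prod_type, Finset.sum_mul_sum]
  exact Finset.sum_congr rfl fun i _ => Finset.sum_congr rfl fun j _ => by
    simp only [tensor]; ring

lemma leg12_mulVec_tensor3 (M : End2 n) (a b c : Fin n → ℂ) (p : Fin n × Fin n × Fin n) :
    (leg12 M *ᵥ tensor3 a b c) p = (M *ᵥ tensor a b) (p.1, p.2.1) * c p.2.2 := by
  simp [Matrix.mulVec, dotProduct, leg12, tensor, tensor3, Fintype.sum_prod_type,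
    Finset.sum_mul, mul_assoc]

lemma leg13_mulVec_tensor3 (M : End2 n) (a b c : Fin n → ℂ) (p : Fin n × Fin n × Fin n) :
    (leg13 M *ᵥ tensor3 a b c) p = (M *ᵥ tensor a c) (p.1, p.2.2) * b p.2.1 := by
  simp only [Matrix.mulVec, dotProduct, leg13, tensor, tensor3, Fintype.sum_prod_type,
    Finset.sum_mul, Matrix.of_apply, ite_mul, zero_mul]
  refine Finset.sum_congr rfl fun i _ => ?_
  rw [Finset.sum_comm]
  refine Finset.sum_congr rfl fun j _ => ?_
  simp
  ring

lemma leg23_mulVec_tensor3 (M : End2 n) (a b c : Fin n → ℂ) (p : Fin n × Fin n × Fin n) :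
    (leg23 M *ᵥ tensor3 a b c) p = (M *ᵥ tensor b c) (p.2.1, p.2.2) * a p.1 := by
  simp [Matrix.mulVec, dotProduct, leg23, tensor, tensor3, Fintype.sum_prod_type,
    Finset.mul_sum, mul_comm, mul_assoc]

lemma leg12_transpose (M : End2 n) : leg12 Mᵀ = (leg12 M)ᵀ := by
  ext p q; simp [leg12, eq_comm]

lemma leg13_transpose (M : End2 n) : leg13 Mᵀ = (leg13 M)ᵀ := by
  ext p q; simp [leg13, eq_comm]

lemma leg23_transpose (M : End2 n) : leg23 Mᵀ = (leg23 M)ᵀ := by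
  ext p q; simp [leg23, eq_comm]

end Algebra

/-- In terms of `k = c / f` the weights are `α = c γ - f γ k(t)` and `β = f γ (k(s) + k(t))`, and
the addition formula of `k` makes the coefficients of the six permutations of `x ⊗ y ⊗ z` on the
two sides of the Yang–Baxter equation agree. -/
lemma yang_baxter_weights {E : Type*} [AddCommGroup E] [Module ℂ E] (A F κ h₁ h₂ h₃ p q r : ℂ)
    (hh : h₃ * (h₁ + h₂) = h₁ * h₂ + κ)
    (hp : r * (p + q) = p * q + κ) (xyz xzy yxz yzx zxy zyx : E) :
    (A - F * q) • ((A - F * r) • ((A - F * p) • xyz + (F * (h₁ + p)) • yxz)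
        + (F * (h₃ + r)) • ((A + F * q) • zyx + (F * (h₁ - q)) • yzx))
      + (F * (h₂ + q)) • ((A - F * p) • ((A - F * r) • xzy + (F * (h₁ + r)) • zxy)
        + (F * (h₃ + p)) • ((A - F * q) • yzx + (F * (h₁ + q)) • zyx))
    = (A - F * p) • ((A - F * r) • ((A - F * q) • xyz + (F * (h₂ + q)) • xzy)
        + (F * (h₃ + r)) • ((A + F * p) • zyx + (F * (h₂ - p)) • zxy))
      + (F * (h₁ + p)) • ((A - F * q) • ((A - F * r) • yxz + (F * (h₂ + r)) • yzx)
        + (F * (h₃ + q)) • ((A - F * p) • zxy + (F * (h₂ + p)) • zyx)) := by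
  match_scalars <;> grind

namespace VertexFace

variable {n : ℕ} {f c g : ℂ → ℂ} {κ γ : ℂ} {w : ℂ → ℂ → Fin n → ℂ} {R : ℂ → End2 n}

lemma three_term_points (V : VertexFace n f c g κ γ w R) (s x y a b : ℂ) :
    f (b - a) * (f s * f (x - y - γ) * (f (x - b) * f (y - a - γ)) +
      f γ * f (s + (x - y)) * (f (y - b) * f (x - a - γ))) =
    f (x - y) * (f s * f (b - a - γ) * (f (x - b - γ) * f (y - a)) +
      f γ * f (s + (b - a)) * (f (x - a - γ) * f (y - b))) := by
  have := V.formula.three_term γ s (x - a) (y - a) (b - a)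
  simpa only [sub_sub_sub_cancel_right] using this

/-- The covector decomposition paired with `w u x ⊗ w v y`. -/
lemma covector_weights (V : VertexFace n f c g κ γ w R) {l : Fin n → ℂ} (hl : Separated f l)
    (hγ : ∀ i j, i ≠ j → f (l i - l j + γ) ≠ 0) {s x y : ℂ} (hs : f s ≠ 0) (hxy : f (x - y) ≠ 0)
    (a b : Fin n) :
    wAlpha f γ (x - y) * (lagrange f g l a x * lagrange f g (shift γ a l) b y)
      + wBeta f γ s (x - y) * (lagrange f g l a y * lagrange f g (shift γ a l) b x)
    = lagrange f g (shift γ b l) a x * lagrange f g l b y * dynAlpha f γ s l a b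
      + lagrange f g (shift γ a l) b x * lagrange f g l a y * dynBeta f γ s l b a := by
  by_cases hab : a = b
  · subst hab
    simp only [dynAlpha, dynBeta, if_true, mul_zero, add_zero]
    rw [V.lagrange_shift_self hl, V.lagrange_shift_self hl, ← V.wAlpha_add_wBeta hs hxy]
    ring
  · have hba : b ≠ a := Ne.symm hab
    have h0 := V.three_term_points s x y (l a) (l b)
    have h1 : ∀ i j : Fin n, i ≠ j → f (l i - l j - γ) ≠ 0 := by
      intro i j hij
      rw [show l i - l j - γ = -(l j - l i + γ) by ring, V.formula.neg]
      exact neg_ne_zero.mpr (hγ j i hij.symm)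
    have h2 := h1 a b hab
    have h3 := h1 b a hba
    have h4 := hl b a hba
    have h5 : f (l a - l b) = -f (l b - l a) := V.formula.sub_comm _ _
    have hP := V.lagrangePart_swap l a b x y
    simp only [dynAlpha, dynBeta, hab, hba, if_false]
    rw [lagrange_eq_part l hab, lagrange_eq_part l hba, lagrange_eq_part l hab,
      lagrange_shift_of_ne l hba, lagrange_shift_of_ne l hba, lagrange_shift_of_ne l hab,
      wAlpha, wBeta, wAlpha, wBeta, h5]
    generalize lagrangePart f g l a b x = P1 at *
    generalize lagrangePart f g l b a y = P2 at *
    generalize lagrangePart f g l a b y = P3 at *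
    generalize lagrangePart f g l b a x = P4 at *
    have K : f (x - y - γ) / f (x - y) * (f (x - l b) / -f (l b - l a)
          * (f (y - l a - γ) / f (l b - l a - γ)))
        + f γ * f (s + (x - y)) / (f s * f (x - y)) * (f (y - l b) / -f (l b - l a)
          * (f (x - l a - γ) / f (l b - l a - γ)))
        = f (x - l b - γ) / f (l a - l b - γ) * (f (y - l a) / f (l b - l a))
          * (f (l a - l b - γ) / -f (l b - l a))
        + f (x - l a - γ) / f (l b - l a - γ) * (f (y - l b) / -f (l b - l a))
          * (f γ * f (s + (l b - l a)) / (f s * f (l b - l a))) := by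
      field_simp
      linear_combination -h0
    linear_combination P1 * P2 * K + hP * (f (x - l a - γ) / f (l b - l a - γ)
          * (f (y - l b) / -f (l b - l a)) * (f γ * f (s + (l b - l a)) / (f s * f (l b - l a)))
        - f γ * f (s + (x - y)) / (f s * f (x - y)) * (f (y - l b) / -f (l b - l a)
          * (f (x - l a - γ) / f (l b - l a - γ))))

/-- The covector form of the decomposition of the dynamical `D`-matrix, obtained by pairing with
product tensors at generic points. -/
theorem covector_decomposition (V : VertexFace n f c g κ γ w R) {u v : ℂ} (huv : f (u - v) ≠ 0)
    {l : Fin n → ℂ} (hl : Separated f l) (hγ : ∀ i j, i ≠ j → f (l i - l j + γ) ≠ 0) :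
    (R (u - v))ᵀ * leg1 (dualMatrix (w u) l) * leg2h1 γ (dualMatrix (w v)) l
      = leg2 (dualMatrix (w v) l) * leg1h2 γ (dualMatrix (w u)) l * dynD n f γ (u - v) l := by
  -- generic points: two disjoint sets of `n` integers
  set X : Fin n → ℂ := fun i => (i : ℂ)
  set Y : Fin n → ℂ := fun i => (n : ℂ) + (i : ℂ)
  have hre : ∀ i j : Fin n, i ≠ j → ((i : ℂ) - (j : ℂ)).re ≠ 0 := by
    intro i j hij
    simp only [Complex.sub_re, Complex.natCast_re, sub_ne_zero]
    exact_mod_cast fun h => hij (Fin.ext h)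
  have hX : Separated f X := fun i j hij => V.ne_zero _ (hre i j hij)
  have hY : Separated f Y := fun i j hij => V.ne_zero _ (by
    simpa only [Y, add_sub_add_left_eq_sub] using hre i j hij)
  have hXY : ∀ i j, f (X i - Y j) ≠ 0 := fun i j => V.ne_zero _ (by
    simp only [X, Y, Complex.sub_re, Complex.natCast_re, Complex.add_re]
    have : (i : ℝ) < n := by exact_mod_cast i.2
    have : (0 : ℝ) ≤ (j : ℕ) := by positivity
    intro h
    linarith)
  have hs := fun k => hl.shift V.formula.neg hγ k
  have hZ : IsUnit (nodeMatrix (w u) X ⊗ₖ nodeMatrix (w v) Y)ᵀ :=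
    (Matrix.isUnit_transpose _).mpr (isUnit_kronecker (V.isUnit u X hX) (V.isUnit v Y hY))
  apply hZ.mul_left_cancel
  rw [Matrix.mul_assoc _ (leg1 _), ← Matrix.mul_assoc, ← Matrix.transpose_mul,
    ← Matrix.mul_assoc _ (leg2 _ * _)]
  ext ⟨i, j⟩ ⟨a, b⟩
  have hpair : ∀ (a b : Fin n) (x y : ℂ) (l₁ l₂ : Fin n → ℂ), Separated f l₁ → Separated f l₂ →
      ∑ p, tensor (w u x) (w v y) p * (dualMatrix (w u) l₁ p.1 a * dualMatrix (w v) l₂ p.2 b)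
        = lagrange f g l₁ a x * lagrange f g l₂ b y := by
    intro a b x y l₁ l₂ h₁ h₂
    rw [sum_tensor_mul (w u x) (w v y) (fun i => dualMatrix (w u) l₁ i a)
      (fun j => dualMatrix (w v) l₂ j b), V.sum_mul_dualMatrix u h₁, V.sum_mul_dualMatrix v h₂]
  have hR : ∀ a b, ((nodeMatrix (w u) X ⊗ₖ nodeMatrix (w v) Y)ᵀ * (leg2 (dualMatrix (w v) l)
      * leg1h2 γ (dualMatrix (w u)) l)) (i, j) (a, b)
      = lagrange f g (shift γ b l) a (X i) * lagrange f g l b (Y j) := by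
    intro a b
    rw [← hpair _ _ _ _ _ _ (hs b) hl, Matrix.mul_apply]
    exact Finset.sum_congr rfl fun p _ => by rw [leg2_mul_leg1h2_apply]; rfl
  rw [dynD, mul_zeroWeight_apply, hR, hR, ← V.covector_weights hl hγ huv (hXY i j),
    ← hpair a b (X i) (Y j) _ _ hl (hs a), ← hpair a b (Y j) (X i) _ _ hl (hs a),
    Finset.mul_sum, Finset.mul_sum, ← Finset.sum_add_distrib, Matrix.mul_apply]
  refine Finset.sum_congr rfl fun p _ => ?_
  rw [leg1_mul_leg2h1_apply]
  have := congrFun (V.intertwine u v _ _ huv (hXY i j)) p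
  simp only [Pi.add_apply, Pi.smul_apply, smul_eq_mul] at this
  refine (congrArg (· * (dualMatrix (w u) l p.1 a * dualMatrix (w v) (shift γ a l) p.2 b))
    this).trans ?_
  ring

/-- The Yang–Baxter equation for `R`, tested on product tensors at distinct points. -/
theorem yang_baxter (V : VertexFace n f c g κ γ w R) {u₁ u₂ u₃ : ℂ} (h₁₂ : f (u₁ - u₂) ≠ 0)
    (h₁₃ : f (u₁ - u₃) ≠ 0) (h₂₃ : f (u₂ - u₃) ≠ 0) : YBE R u₁ u₂ u₃ := by
  -- generic points: three disjoint sets of `n` integers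
  set X : ℕ → Fin n → ℂ := fun m i => (m * n : ℂ) + (i : ℂ) with hXdef
  have hre : ∀ m m' (i j : Fin n), m ≠ m' ∨ i ≠ j → f (X m i - X m' j) ≠ 0 := by
    intro m m' i j hij
    apply V.ne_zero
    have : (X m i - X m' j).re = ((m * n + i : ℕ) : ℝ) - ((m' * n + j : ℕ) : ℝ) := by
      simp [hXdef]
    rw [this, sub_ne_zero]
    intro h
    have h' : m * n + i = m' * n + j := by exact_mod_cast h
    have hm : m = m' := by
      have h1 := congrArg (· / n) h'
      have hn : 0 < n := i.pos
      simpa [Nat.mul_comm _ n, Nat.mul_add_div hn, Nat.div_eq_of_lt] using h1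
    subst hm
    rcases hij with hij | hij
    · exact hij rfl
    · exact hij (Fin.ext (by omega))
  have hX : ∀ m, Separated f (X m) := fun m i j hij => hre m m i j (Or.inr hij)
  have hZ := isUnit_kronecker (V.isUnit u₁ _ (hX 0))
    (isUnit_kronecker (V.isUnit u₂ _ (hX 1)) (V.isUnit u₃ _ (hX 2)))
  apply hZ.mul_right_cancel
  ext p ⟨i, j, k⟩
  have hxy := hre 0 1 i j (by simp)
  have hxz := hre 0 2 i k (by simp)
  have hyz := hre 1 2 j k (by simp)
  have hcol : ∀ M : End3 n, (M * (nodeMatrix (w u₁) (X 0) ⊗ₖ (nodeMatrix (w u₂) (X 1) ⊗ₖ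
      nodeMatrix (w u₃) (X 2)))) p (i, j, k)
      = (M *ᵥ tensor3 (w u₁ (X 0 i)) (w u₂ (X 1 j)) (w u₃ (X 2 k))) p := fun M => rfl
  rw [hcol, hcol]
  generalize X 0 i = x at *
  generalize X 1 j = y at *
  generalize X 2 k = z at *
  refine congrFun ?_ p
  have hyx := (V.formula.sub_comm y x).trans_ne (neg_ne_zero.mpr hxy)
  have hzy := (V.formula.sub_comm z y).trans_ne (neg_ne_zero.mpr hyz)
  have hα : ∀ t, f t ≠ 0 → wAlpha f γ t = c γ - f γ * (c t / f t) := by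
    intro t ht
    rw [wAlpha, V.formula.sub]; field_simp
  have hβ : ∀ s t, f s ≠ 0 → f t ≠ 0 → wBeta f γ s t = f γ * (c s / f s + c t / f t) := by
    intro s t hs ht
    rw [wBeta, V.formula.add]; field_simp; ring
  have e12 : ∀ x y z, f (x - y) ≠ 0 → leg12 (R (u₁ - u₂)) *ᵥ tensor3 (w u₁ x) (w u₂ y) (w u₃ z)
      = (c γ - f γ * (c (x - y) / f (x - y))) • tensor3 (w u₁ x) (w u₂ y) (w u₃ z)
        + (f γ * (c (u₁ - u₂) / f (u₁ - u₂) + c (x - y) / f (x - y)))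
          • tensor3 (w u₁ y) (w u₂ x) (w u₃ z) := by
    intro x y z h
    ext p
    rw [leg12_mulVec_tensor3, V.intertwine _ _ _ _ h₁₂ h, hα _ h, hβ _ _ h₁₂ h]
    simp only [Pi.add_apply, Pi.smul_apply, smul_eq_mul, tensor, tensor3]; ring
  have e13 : ∀ x y z, f (x - z) ≠ 0 → leg13 (R (u₁ - u₃)) *ᵥ tensor3 (w u₁ x) (w u₂ y) (w u₃ z)
      = (c γ - f γ * (c (x - z) / f (x - z))) • tensor3 (w u₁ x) (w u₂ y) (w u₃ z)
        + (f γ * (c (u₁ - u₃) / f (u₁ - u₃) + c (x - z) / f (x - z)))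
          • tensor3 (w u₁ z) (w u₂ y) (w u₃ x) := by
    intro x y z h
    ext p
    rw [leg13_mulVec_tensor3, V.intertwine _ _ _ _ h₁₃ h, hα _ h, hβ _ _ h₁₃ h]
    simp only [Pi.add_apply, Pi.smul_apply, smul_eq_mul, tensor, tensor3]; ring
  have e23 : ∀ x y z, f (y - z) ≠ 0 → leg23 (R (u₂ - u₃)) *ᵥ tensor3 (w u₁ x) (w u₂ y) (w u₃ z)
      = (c γ - f γ * (c (y - z) / f (y - z))) • tensor3 (w u₁ x) (w u₂ y) (w u₃ z)
        + (f γ * (c (u₂ - u₃) / f (u₂ - u₃) + c (y - z) / f (y - z)))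
          • tensor3 (w u₁ x) (w u₂ z) (w u₃ y) := by
    intro x y z h
    ext p
    rw [leg23_mulVec_tensor3, V.intertwine _ _ _ _ h₂₃ h, hα _ h, hβ _ _ h₂₃ h]
    simp only [Pi.add_apply, Pi.smul_apply, smul_eq_mul, tensor, tensor3]; ring
  simp only [← Matrix.mulVec_mulVec, Matrix.mulVec_add, Matrix.mulVec_smul, e12, e13, e23, hxy,
    hyx, hxz, hyz, hzy, ne_eq, not_false_eq_true]
  have hodd : ∀ a b, c (a - b) / f (a - b) = -(c (b - a) / f (b - a)) := by
    intro a b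
    rw [← neg_sub b a, V.formula.neg, V.formula.cneg, div_neg]
  rw [hodd z y, hodd y x]
  have hh := V.formula.cot_add h₁₂ h₂₃ (by rwa [sub_add_sub_cancel])
  have hp := V.formula.cot_add hxy hyz (by rwa [sub_add_sub_cancel])
  rw [sub_add_sub_cancel] at hh hp
  have := yang_baxter_weights (c γ) (f γ) κ _ _ _ _ _ _ hh hp
    (tensor3 (w u₁ x) (w u₂ y) (w u₃ z)) (tensor3 (w u₁ x) (w u₂ z) (w u₃ y))
    (tensor3 (w u₁ y) (w u₂ x) (w u₃ z)) (tensor3 (w u₁ y) (w u₂ z) (w u₃ x))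
    (tensor3 (w u₁ z) (w u₂ x) (w u₃ y)) (tensor3 (w u₁ z) (w u₂ y) (w u₃ x))
  simpa only [mul_neg, sub_neg_eq_add, ← sub_eq_add_neg] using this

theorem yang_baxter_transpose (V : VertexFace n f c g κ γ w R) {u₁ u₂ u₃ : ℂ}
    (h₁₂ : f (u₁ - u₂) ≠ 0) (h₁₃ : f (u₁ - u₃) ≠ 0) (h₂₃ : f (u₂ - u₃) ≠ 0) :
    YBE (fun s => (R s)ᵀ) u₁ u₂ u₃ := by
  have h := V.yang_baxter h₁₂ h₁₃ h₂₃
  rw [YBE] at h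
  replace h := congrArg Matrix.transpose h
  simp only [Matrix.transpose_mul] at h
  simp only [YBE, leg12_transpose, leg13_transpose, leg23_transpose]
  rw [Matrix.mul_assoc, Matrix.mul_assoc]
  exact h.symm

end VertexFace

/-! ### Sums of matrix units and polynomial interpolation -/

section Units

variable {n : ℕ}

lemma kronecker_e_apply (i j k m : Fin n) (p q : Fin n × Fin n) :
    (e i j ⊗ₖ e k m) p q = if p = (i, k) ∧ q = (j, m) then 1 else 0 := by
  obtain ⟨p1, p2⟩ := p
  obtain ⟨q1, q2⟩ := q
  simp only [e, Matrix.kroneckerMap_apply, Matrix.single_apply, Prod.mk.injEq, mul_ite, mul_one,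
    mul_zero, ← ite_and]
  exact if_congr (by constructor <;> (rintro ⟨⟨rfl, rfl⟩, rfl, rfl⟩; simp)) rfl rfl

lemma sum_diag_units (a : Fin n → ℂ) :
    ∑ i, a i • (e i i ⊗ₖ e i i) = zeroWeight (fun i j => if i = j then a i else 0) 0 := by
  ext ⟨p1, p2⟩ q
  simp only [Matrix.sum_apply, Matrix.smul_apply, kronecker_e_apply, smul_eq_mul, mul_ite, mul_one,
    mul_zero, zeroWeight, Matrix.of_apply, Prod.mk.injEq, Pi.zero_apply, ite_self, add_zero]
  rw [Finset.sum_eq_single p1 (fun i _ hi => if_neg (by simp [hi.symm])) (by simp)]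
  by_cases h : p1 = p2
  · subst h; simp
  · simp [h, Ne.symm h]

lemma sum_offdiag (F : Fin n → Fin n → ℂ) :
    ∑ i, ∑ j ∈ Finset.univ.erase i, F i j = ∑ i, ∑ j, if i = j then 0 else F i j := by
  refine Finset.sum_congr rfl fun i _ => ?_
  rw [← Finset.sum_erase (s := Finset.univ) (a := i) (h := by simp)]
  exact Finset.sum_congr rfl fun j hj => (if_neg (Finset.ne_of_mem_erase hj).symm).symm

lemma sum_offdiag_units_apply (a : Fin n → Fin n → ℂ) (M : Fin n → Fin n → End2 n)
    (p q : Fin n × Fin n) :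
    (∑ i, ∑ j ∈ Finset.univ.erase i, a i j • M i j) p q
      = ∑ i, ∑ j, if i = j then 0 else a i j * M i j p q := by
  rw [← sum_offdiag]
  simp only [Matrix.sum_apply, Matrix.smul_apply, smul_eq_mul]

lemma sum_sum_single {F : Fin n → Fin n → ℂ} (i j : Fin n)
    (h : ∀ i' j', (i', j') ≠ (i, j) → F i' j' = 0) : ∑ i', ∑ j', F i' j' = F i j := by
  rw [← Fintype.sum_prod_type']
  exact Finset.sum_eq_single (i, j) (fun x _ hx => h x.1 x.2 hx) (by simp)

lemma sum_offdiag_swap_units (a : Fin n → Fin n → ℂ) :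
    ∑ i, ∑ j ∈ Finset.univ.erase i, a i j • (e i j ⊗ₖ e j i)
      = zeroWeight 0 (fun i j => if i = j then 0 else a i j) := by
  ext ⟨p1, p2⟩ q
  rw [sum_offdiag_units_apply, sum_sum_single p1 p2]
  · by_cases h : p1 = p2 <;> simp [-Matrix.kroneckerMap_apply, zeroWeight, kronecker_e_apply, h]
  · intro i j hij
    have : ¬ (p1 = i ∧ p2 = j) := fun h => hij (by rw [h.1, h.2])
    simp [-Matrix.kroneckerMap_apply, kronecker_e_apply, this]

lemma sum_offdiag_diag_units (a : Fin n → Fin n → ℂ) :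
    ∑ i, ∑ j ∈ Finset.univ.erase i, a i j • (e i i ⊗ₖ e j j)
      = zeroWeight (fun i j => if i = j then 0 else a i j) 0 := by
  ext ⟨p1, p2⟩ q
  rw [sum_offdiag_units_apply, sum_sum_single p1 p2]
  · by_cases h : p1 = p2 <;> simp [-Matrix.kroneckerMap_apply, zeroWeight, kronecker_e_apply, h]
  · intro i j hij
    have : ¬ (p1 = i ∧ p2 = j) := fun h => hij (by rw [h.1, h.2])
    simp [-Matrix.kroneckerMap_apply, kronecker_e_apply, this]

lemma zeroWeight_add (α β α' β' : Fin n → Fin n → ℂ) :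
    zeroWeight α β + zeroWeight α' β' = zeroWeight (α + α') (β + β') := by
  ext p q
  simp only [zeroWeight, Matrix.add_apply, Matrix.of_apply, Pi.add_apply]
  split_ifs <;> ring

lemma sum_units (a : Fin n → Fin n → Fin n → Fin n → ℂ) :
    ∑ i, ∑ i', ∑ j, ∑ j', a i i' j j' • (e i i' ⊗ₖ e j j')
      = Matrix.of fun p q : Fin n × Fin n => a p.1 q.1 p.2 q.2 := by
  ext ⟨p1, p2⟩ ⟨q1, q2⟩
  simp only [Matrix.sum_apply, Matrix.smul_apply, smul_eq_mul, Matrix.of_apply]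
  rw [sum_sum_single p1 q1, sum_sum_single p2 q2]
  · rw [kronecker_e_apply, if_pos ⟨rfl, rfl⟩, mul_one]
  · intro i j h
    have : ¬ (p2 = i ∧ q2 = j) := fun h' => h (by rw [h'.1, h'.2])
    rw [kronecker_e_apply, if_neg, mul_zero]
    simpa using this
  · intro i j h
    have : ¬ (p1 = i ∧ q1 = j) := fun h' => h (by rw [h'.1, h'.2])
    refine Finset.sum_eq_zero fun k _ => Finset.sum_eq_zero fun m _ => ?_
    rw [kronecker_e_apply, if_neg, mul_zero]
    rintro ⟨h1, h2⟩
    exact this ⟨(Prod.mk.inj h1).1, (Prod.mk.inj h2).1⟩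

end Units

section Interpolation

variable {n : ℕ}

lemma pow_eq_sum_lagrange {X : Fin n → ℂ} (hX : Function.Injective X) (z : ℂ) (i : Fin n) :
    z ^ (i : ℕ) = ∑ a, (∏ k ∈ Finset.univ.erase a, (z - X k) / (X a - X k)) * X a ^ (i : ℕ) := by
  have h := Lagrange.eq_interpolate (s := Finset.univ) (v := X) (f := Polynomial.X ^ (i : ℕ))
    hX.injOn (by simp)
  have h2 := congrArg (Polynomial.eval z) h
  rw [Lagrange.interpolate_apply, Polynomial.eval_finsetSum] at h2
  rw [← Polynomial.eval_X_pow (R := ℂ) (x := z), h2]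
  refine Finset.sum_congr rfl fun a _ => ?_
  rw [Polynomial.eval_mul, Polynomial.eval_C, Lagrange.basis, Polynomial.eval_prod, mul_comm]
  congr 1
  · refine Finset.prod_congr rfl fun k _ => ?_
    simp [Lagrange.basisDivisor, div_eq_mul_inv, mul_comm]
  · simp

end Interpolation

/-! ### The trigonometric case -/

lemma addFormula_sinh : AddFormula Complex.sinh Complex.cosh 1 where
  add := Complex.sinh_add
  cadd x y := by rw [Complex.cosh_add, one_mul]
  neg := Complex.sinh_neg
  cneg := Complex.cosh_neg
  sq x := by
    have := Complex.cosh_sq x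
    linear_combination this

lemma sinh_ne_zero_of_re {x : ℂ} (hx : x.re ≠ 0) : Complex.sinh x ≠ 0 := by
  intro h
  rw [Complex.sinh, div_eq_zero_iff, sub_eq_zero] at h
  have h1 := congrArg (‖·‖) (h.resolve_right two_ne_zero)
  simp only [Complex.norm_exp, Complex.neg_re, Real.exp_eq_exp] at h1
  exact hx (by linarith)

/-- The moment curve `z ↦ exp (2 j (t + n z) / n)` of the trigonometric twist, `j` counted
from `1`. -/
noncomputable def trigCurve (n : ℕ) (t z : ℂ) (j : Fin n) : ℂ :=
  Complex.exp (2 * ((j : ℂ) + 1) * (t + n * z) / n)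

lemma trigCurve_eq {n : ℕ} (t z : ℂ) (j : Fin n) :
    trigCurve n t z j
      = Complex.exp (2 * ((j : ℂ) + 1) * t / n) * Complex.exp (2 * z) ^ ((j : ℕ) + 1) := by
  have hn : (n : ℂ) ≠ 0 := Nat.cast_ne_zero.mpr (Nat.ne_of_gt j.pos)
  rw [trigCurve, ← Complex.exp_nat_mul, ← Complex.exp_add]
  congr 1
  push_cast
  field_simp

lemma sinh_sub_eq (x y : ℂ) :
    Complex.sinh (x - y)
      = (Complex.exp (2 * x) - Complex.exp (2 * y)) * (Complex.exp (-(x + y)) / 2) := by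
  rw [Complex.sinh, sub_mul, mul_div_assoc', mul_div_assoc', ← Complex.exp_add, ← Complex.exp_add]
  ring_nf

lemma exp_two_mul_ne {x y : ℂ} (h : Complex.sinh (x - y) ≠ 0) :
    Complex.exp (2 * x) - Complex.exp (2 * y) ≠ 0 := by
  rw [sinh_sub_eq] at h
  exact left_ne_zero_of_mul h

lemma Separated.injective_exp {n : ℕ} {l : Fin n → ℂ} (hl : Separated Complex.sinh l) :
    Function.Injective fun k => Complex.exp (2 * l k) := by
  intro i j hij
  by_contra h
  exact exp_two_mul_ne (hl i j h) (sub_eq_zero.mpr hij)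

/-- The trigonometric interpolation coefficients in the exponential variables. -/
lemma lagrange_sinh {n : ℕ} (l : Fin n → ℂ) (a : Fin n) (z : ℂ) :
    lagrange Complex.sinh (fun x => Complex.exp ((n + 1) * x)) l a z
      = Complex.exp (2 * (z - l a)) * ∏ k ∈ Finset.univ.erase a,
        (Complex.exp (2 * z) - Complex.exp (2 * l k))
          / (Complex.exp (2 * l a) - Complex.exp (2 * l k)) := by
  have h : ∀ k, Complex.sinh (z - l k) / Complex.sinh (l a - l k)
      = Complex.exp (l a - z) * ((Complex.exp (2 * z) - Complex.exp (2 * l k))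
          / (Complex.exp (2 * l a) - Complex.exp (2 * l k))) := by
    intro k
    rw [sinh_sub_eq, sinh_sub_eq, mul_div_mul_comm, mul_comm]
    congr 1
    rw [div_div_div_cancel_right₀ two_ne_zero, ← Complex.exp_sub]
    ring_nf
  rw [lagrange]
  simp only [h]
  rw [Finset.prod_mul_distrib, Finset.prod_const, ← mul_assoc, ← Complex.exp_nat_mul,
    ← Complex.exp_add, Finset.card_erase_of_mem (Finset.mem_univ a), Finset.card_univ,
    Fintype.card_fin, Nat.cast_sub a.pos]
  congr 2
  push_cast
  ring

lemma trigCurve_interp {n : ℕ} (t : ℂ) (l : Fin n → ℂ) (hl : Separated Complex.sinh l) (z : ℂ)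
    (i : Fin n) :
    trigCurve n t z i = ∑ a, lagrange Complex.sinh (fun x => Complex.exp ((n + 1) * x)) l a z
      * trigCurve n t (l a) i := by
  simp only [trigCurve_eq, lagrange_sinh]
  rw [pow_succ, pow_eq_sum_lagrange hl.injective_exp (Complex.exp (2 * z)) i, Finset.sum_mul,
    Finset.mul_sum]
  refine Finset.sum_congr rfl fun a _ => ?_
  have : Complex.exp (2 * z) = Complex.exp (2 * (z - l a)) * Complex.exp (2 * l a) := by
    rw [← Complex.exp_add]; ring_nf
  linear_combination (∏ k ∈ Finset.univ.erase a,
        (Complex.exp (2 * z) - Complex.exp (2 * l k))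
          / (Complex.exp (2 * l a) - Complex.exp (2 * l k))) * Complex.exp (2 * l a) ^ (i : ℕ)
    * Complex.exp (2 * ((i : ℂ) + 1) * t / n) * this

lemma isUnit_nodeMatrix_trigCurve {n : ℕ} (t : ℂ) (l : Fin n → ℂ)
    (hl : Separated Complex.sinh l) : IsUnit (nodeMatrix (trigCurve n t) l) := by
  have h : nodeMatrix (trigCurve n t) l
      = Matrix.diagonal (fun j : Fin n => Complex.exp (2 * ((j : ℂ) + 1) * t / n))
        * (Matrix.vandermonde fun k => Complex.exp (2 * l k))ᵀ
        * Matrix.diagonal fun k => Complex.exp (2 * l k) := by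
    ext j k
    simp [nodeMatrix, trigCurve_eq, pow_succ, mul_assoc]
  rw [h, Matrix.isUnit_iff_isUnit_det, Matrix.det_mul, Matrix.det_mul, Matrix.det_transpose,
    Matrix.det_diagonal, Matrix.det_diagonal, isUnit_iff_ne_zero]
  exact mul_ne_zero (mul_ne_zero (Finset.prod_ne_zero_iff.mpr fun _ _ => Complex.exp_ne_zero _)
    (Matrix.det_vandermonde_ne_zero_iff.mpr hl.injective_exp))
    (Finset.prod_ne_zero_iff.mpr fun _ _ => Complex.exp_ne_zero _)

/-- The geometric sum behind the trigonometric intertwining relation. -/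
lemma sub_mul_sum_Ioo (X Y : ℂ) {p q : ℕ} (h : p < q) :
    (Y - X) * ∑ m ∈ Finset.Ioo p q, X ^ m * Y ^ (p + q - m)
      = X ^ (p + 1) * Y ^ q - X ^ q * Y ^ (p + 1) := by
  obtain ⟨d, rfl⟩ := Nat.exists_eq_add_of_lt h
  have : Finset.Ioo p (p + d + 1) = (Finset.range d).image (fun m => p + 1 + m) := by
    ext m
    simp only [Finset.mem_Ioo, Finset.mem_image, Finset.mem_range]
    constructor
    · rintro ⟨h1, h2⟩; exact ⟨m - (p + 1), by omega, by omega⟩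
    · rintro ⟨k, hk, rfl⟩; omega
  rw [this, Finset.sum_image (by intro a _ b _ h; simpa using h)]
  have h2 : ∀ m ∈ Finset.range d, X ^ (p + 1 + m) * Y ^ (p + (p + d + 1) - (p + 1 + m))
      = X ^ (p + 1) * Y ^ (p + 1) * (X ^ m * Y ^ (d - 1 - m)) := by
    intro m hm
    have := Finset.mem_range.mp hm
    rw [show p + (p + d + 1) - (p + 1 + m) = p + 1 + (d - 1 - m) by omega]
    ring
  rw [Finset.sum_congr rfl h2, ← Finset.mul_sum]
  have h3 := (Commute.all X Y).geom_sum₂_mul d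
  linear_combination -(X ^ (p + 1) * Y ^ (p + 1)) * h3

/-- Sums over pairs of indices with given total, as sums over the first index. -/
lemma sum_sum_ite_add_eq {n : ℕ} (p q : Fin n) (P : ℕ → Prop) [DecidablePred P] (F : ℕ → ℕ → ℂ)
    (lo hi : ℕ) (hP : ∀ m, P m ↔ lo < m ∧ m < hi) (h : lo + hi = p + q) (hhi : hi < n) :
    ∑ i : Fin n, ∑ j : Fin n, (if (p : ℕ) + q = i + j then if P i then F i j else 0 else 0)
      = ∑ m ∈ Finset.Ioo lo hi, F m (lo + hi - m) := by
  have h1 : ∀ i : Fin n, ∑ j : Fin n,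
      (if (p : ℕ) + q = i + j then if P i then F i j else 0 else 0)
        = if lo < (i : ℕ) ∧ (i : ℕ) < hi then F i (lo + hi - i) else 0 := by
    intro i
    by_cases hi' : P i
    · have hb := (hP i).mp hi'
      rw [if_pos hb, Finset.sum_eq_single ⟨lo + hi - i, by omega⟩]
      · rw [if_pos (by simp; omega), if_pos hi']
      · intro j _ hj
        rw [if_neg]
        intro h2
        exact hj (Fin.ext (by simp; omega))
      · simp
    · rw [if_neg (fun hb => hi' ((hP i).mpr hb))]
      simp [hi']
  simp only [h1]
  rw [Fin.sum_univ_eq_sum_range (fun i => if lo < i ∧ i < hi then F i (lo + hi - i) else 0) n,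
    ← Finset.sum_filter]
  refine Finset.sum_congr ?_ fun _ _ => rfl
  ext m
  simp only [Finset.mem_filter, Finset.mem_range, Finset.mem_Ioo]
  omega

/-- The part of `S` that shifts the weights of both legs, without its factor `2 sinh γ`. -/
noncomputable def trigShift (n : ℕ) (s : ℂ) : End2 n :=
  Matrix.of fun p q =>
    if (p.1 : ℕ) + (p.2 : ℕ) = (q.1 : ℕ) + (q.2 : ℕ) then
      (if p.1 < q.1 ∧ q.1 < p.2 then
        Complex.exp (-2 * s * ((q.1 : ℂ) - (p.1 : ℂ)) / n) else 0)
      - (if q.1 < p.1 ∧ p.2 < q.1 then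
        Complex.exp (-2 * s * ((q.1 : ℂ) - (p.1 : ℂ)) / n) else 0)
    else 0

lemma trigS_eq (n : ℕ) (γ s : ℂ) :
    trigS n γ s
      = zeroWeight
          (fun i j => if i = j then Complex.sinh (s + γ) / Complex.sinh s
            else Complex.exp (-γ * sgn i j))
          (fun i j => if i = j then 0 else Complex.sinh γ / Complex.sinh s
              * Complex.exp (s * (2 * ((i : ℂ) - (j : ℂ)) - n * sgn i j) / n))
        + (2 * Complex.sinh γ) • trigShift n s := by
  have h : (∑ i : Fin n, ∑ i' : Fin n, ∑ j : Fin n, ∑ j' : Fin n,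
        if (i : ℕ) + (j : ℕ) = (i' : ℕ) + (j' : ℕ) then
          (if i < i' ∧ i' < j then
              Complex.exp (-2 * s * ((i' : ℂ) - (i : ℂ)) / n) • (e i i' ⊗ₖ e j j') else 0)
            - (if i' < i ∧ j < i' then
              Complex.exp (-2 * s * ((i' : ℂ) - (i : ℂ)) / n) • (e i i' ⊗ₖ e j j') else 0)
        else 0) = trigShift n s := by
    rw [trigShift, ← sum_units fun i i' j j' : Fin n =>
      (if (i : ℕ) + (j : ℕ) = (i' : ℕ) + (j' : ℕ) then
          (if i < i' ∧ i' < j then Complex.exp (-2 * s * ((i' : ℂ) - (i : ℂ)) / n) else 0)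
            - (if i' < i ∧ j < i' then Complex.exp (-2 * s * ((i' : ℂ) - (i : ℂ)) / n) else 0)
        else 0)]
    simp only [ite_smul, sub_smul, zero_smul]
  rw [trigS, h, sum_diag_units]
  simp only [Finset.sum_add_distrib]
  rw [sum_offdiag_swap_units, sum_offdiag_diag_units, zeroWeight_add, zeroWeight_add]
  congr 1
  · congr 1
    · ext i j; by_cases h : i = j <;> simp [h]
    · ext i j; by_cases h : i = j <;> simp [h]

lemma trigCurve_mul_exp {n : ℕ} (u v x y : ℂ) (p q i j : Fin n) (h : (p : ℕ) + q = i + j) :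
    Complex.exp (-2 * (u - v) * ((i : ℂ) - (p : ℂ)) / n) * tensor (trigCurve n u x)
        (trigCurve n v y) (i, j)
      = Complex.exp (2 * ((p : ℂ) + 1) * u / n) * Complex.exp (2 * ((q : ℂ) + 1) * v / n)
        * (Complex.exp (2 * x) ^ ((i : ℕ) + 1) * Complex.exp (2 * y) ^ ((j : ℕ) + 1)) := by
  have h' : (q : ℂ) = i + j - p := by
    have : (p : ℂ) + q = i + j := by exact_mod_cast h
    linear_combination this
  have e : Complex.exp (-2 * (u - v) * ((i : ℂ) - (p : ℂ)) / n)
      * (Complex.exp (2 * ((i : ℂ) + 1) * u / n) * Complex.exp (2 * ((j : ℂ) + 1) * v / n))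
      = Complex.exp (2 * ((p : ℂ) + 1) * u / n) * Complex.exp (2 * ((q : ℂ) + 1) * v / n) := by
    rw [← Complex.exp_add, ← Complex.exp_add, ← Complex.exp_add, h']
    congr 1
    ring
  rw [tensor, trigCurve_eq, trigCurve_eq, ← e]
  ring

lemma trigS_shift_part {n : ℕ} (u v x y : ℂ) (p q : Fin n) :
    (trigShift n (u - v) *ᵥ tensor (trigCurve n u x) (trigCurve n v y)) (p, q)
      = Complex.exp (2 * ((p : ℂ) + 1) * u / n) * Complex.exp (2 * ((q : ℂ) + 1) * v / n)
        * (Complex.exp (2 * x) * Complex.exp (2 * y))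
        * ((∑ m ∈ Finset.Ioo (p : ℕ) q, Complex.exp (2 * x) ^ m
              * Complex.exp (2 * y) ^ ((p : ℕ) + q - m))
          - ∑ m ∈ Finset.Ioo (q : ℕ) p, Complex.exp (2 * x) ^ m
              * Complex.exp (2 * y) ^ ((q : ℕ) + p - m)) := by
  rw [← sum_sum_ite_add_eq p q (fun m => (p : ℕ) < m ∧ m < q)
      (fun a b => Complex.exp (2 * x) ^ a * Complex.exp (2 * y) ^ b) p q (fun _ => Iff.rfl) rfl q.2,
    ← sum_sum_ite_add_eq p q (fun m => m < (p : ℕ) ∧ (q : ℕ) < m)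
      (fun a b => Complex.exp (2 * x) ^ a * Complex.exp (2 * y) ^ b) q p
      (fun _ => and_comm) (add_comm _ _) p.2, ← Finset.sum_sub_distrib, Finset.mul_sum]
  rw [Matrix.mulVec, dotProduct, Fintype.sum_prod_type]
  refine Finset.sum_congr rfl fun i _ => ?_
  rw [← Finset.sum_sub_distrib, Finset.mul_sum]
  refine Finset.sum_congr rfl fun j _ => ?_
  by_cases h : (p : ℕ) + q = i + j
  · have := trigCurve_mul_exp u v x y p q i j h
    simp only [trigShift, Matrix.of_apply, if_pos h, Fin.lt_def]
    split_ifs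
    · ring
    · linear_combination this
    · linear_combination -this
    · ring
  · simp [trigShift, h]

lemma coth_sub (x y : ℂ) :
    Complex.cosh (x - y) * (Complex.exp (2 * x) - Complex.exp (2 * y))
      = Complex.sinh (x - y) * (Complex.exp (2 * x) + Complex.exp (2 * y)) := by
  have : Complex.cosh (x - y)
      = (Complex.exp (2 * x) + Complex.exp (2 * y)) * (Complex.exp (-(x + y)) / 2) := by
    rw [Complex.cosh, add_mul, mul_div_assoc', mul_div_assoc', ← Complex.exp_add,
      ← Complex.exp_add]
    ring_nf
  rw [this, sinh_sub_eq]
  ring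

lemma sgn_of_lt {n : ℕ} {i j : Fin n} (h : i < j) : sgn i j = -1 := by
  have : Int.sign ((i : ℤ) - (j : ℤ)) = -1 := Int.sign_eq_neg_one_of_neg (by
    have : (i : ℕ) < j := h
    omega)
  simp [sgn, this]

lemma sgn_of_gt {n : ℕ} {i j : Fin n} (h : j < i) : sgn i j = 1 := by
  have : Int.sign ((i : ℤ) - (j : ℤ)) = 1 := Int.sign_eq_one_of_pos (by
    have : (j : ℕ) < i := h
    omega)
  simp [sgn, this]

/-- The scalar identity equating the entries of `S (w x ⊗ w y)` with divided differences; the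
parameters are `A = cosh γ`, `F = sinh γ`, `h = coth s`, `k = coth (x - y)`. -/
lemma trig_entry_identity {A F h k X Y P Q T : ℂ} (hk : k * (X - Y) = X + Y) (hXY : X - Y ≠ 0)
    (hT : (Y - X) * T = X * P - Y * Q) :
    F * (h + 1) * Q + (A + F) * P + 2 * F * T = (A - F * k) * P + F * (h + k) * Q := by
  apply mul_left_cancel₀ hXY
  linear_combination (P - Q) * F * hk - 2 * F * hT

theorem trigS_intertwine (n : ℕ) (γ u v x y : ℂ) (huv : Complex.sinh (u - v) ≠ 0)
    (hxy : Complex.sinh (x - y) ≠ 0) :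
    trigS n γ (u - v) *ᵥ tensor (trigCurve n u x) (trigCurve n v y)
      = wAlpha Complex.sinh γ (x - y) • tensor (trigCurve n u x) (trigCurve n v y)
        + wBeta Complex.sinh γ (u - v) (x - y) • tensor (trigCurve n u y) (trigCurve n v x) := by
  ext ⟨p, q⟩
  have hα : wAlpha Complex.sinh γ (x - y)
      = Complex.cosh γ - Complex.sinh γ * (Complex.cosh (x - y) / Complex.sinh (x - y)) := by
    rw [wAlpha, Complex.sinh_sub (x - y)]; field_simp
  have hβ : wBeta Complex.sinh γ (u - v) (x - y)
      = Complex.sinh γ * (Complex.cosh (u - v) / Complex.sinh (u - v)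
        + Complex.cosh (x - y) / Complex.sinh (x - y)) := by
    rw [wBeta, Complex.sinh_add]; field_simp; ring
  have hk := coth_sub x y
  have hXY := exp_two_mul_ne hxy
  have hK : Complex.cosh (x - y) / Complex.sinh (x - y)
      * (Complex.exp (2 * x) - Complex.exp (2 * y))
      = Complex.exp (2 * x) + Complex.exp (2 * y) := by
    rw [div_mul_eq_mul_div, hk]; field_simp
  have ht : ∀ a b, tensor (trigCurve n u a) (trigCurve n v b) (p, q)
      = Complex.exp (2 * ((p : ℂ) + 1) * u / n) * Complex.exp (2 * ((q : ℂ) + 1) * v / n)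
        * (Complex.exp (2 * a) ^ ((p : ℕ) + 1) * Complex.exp (2 * b) ^ ((q : ℕ) + 1)) := by
    intro a b
    rw [tensor, trigCurve_eq, trigCurve_eq]; ring
  have hs := trigCurve_mul_exp u v x y p q q p (add_comm _ _)
  have hshift := trigS_shift_part u v x y p q
  rw [trigS_eq, Matrix.add_mulVec, Pi.add_apply, zeroWeight_mulVec]
  rw [Matrix.smul_mulVec, Pi.smul_apply, hshift, smul_eq_mul]
  simp only [Pi.add_apply, Pi.smul_apply, smul_eq_mul, ht, hα, hβ]
  generalize Complex.exp (2 * ((p : ℂ) + 1) * u / n) * Complex.exp (2 * ((q : ℂ) + 1) * v / n) = E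
    at *
  rcases lt_trichotomy p q with h | h | h
  · have e1 : Complex.exp ((u - v) * (2 * ((p : ℂ) - (q : ℂ)) - n * sgn p q) / n)
        = Complex.exp (-2 * (u - v) * ((q : ℂ) - (p : ℂ)) / n) * Complex.exp (u - v) := by
      have hn : (n : ℂ) ≠ 0 := Nat.cast_ne_zero.mpr (Nat.ne_of_gt p.pos)
      rw [sgn_of_lt h, ← Complex.exp_add]
      congr 1
      field_simp
      ring
    have e2 : Complex.exp (-γ * sgn p q) = Complex.cosh γ + Complex.sinh γ := by
      rw [sgn_of_lt h, Complex.cosh_add_sinh]; ring_nf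
    have hT := sub_mul_sum_Ioo (Complex.exp (2 * x)) (Complex.exp (2 * y)) h
    rw [if_neg h.ne, if_neg h.ne, e1, e2, Finset.Ioo_eq_empty (a := (q : ℕ)) (not_lt.mpr h.le),
      Finset.sum_empty, sub_zero, ← Complex.cosh_add_sinh (u - v)]
    have := trig_entry_identity (A := Complex.cosh γ) (F := Complex.sinh γ)
      (h := Complex.cosh (u - v) / Complex.sinh (u - v))
      (P := Complex.exp (2 * x) ^ ((p : ℕ) + 1) * Complex.exp (2 * y) ^ ((q : ℕ) + 1))
      (Q := Complex.exp (2 * x) ^ ((q : ℕ) + 1) * Complex.exp (2 * y) ^ ((p : ℕ) + 1))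
      (T := Complex.exp (2 * x) * Complex.exp (2 * y) * ∑ m ∈ Finset.Ioo (p : ℕ) q,
        Complex.exp (2 * x) ^ m * Complex.exp (2 * y) ^ ((p : ℕ) + q - m)) hK hXY (by
          linear_combination Complex.exp (2 * x) * Complex.exp (2 * y) * hT)
    have e3 : Complex.sinh γ / Complex.sinh (u - v)
        * (Complex.cosh (u - v) + Complex.sinh (u - v))
        = Complex.sinh γ * (Complex.cosh (u - v) / Complex.sinh (u - v) + 1) := by
      field_simp
    linear_combination E * this + Complex.sinh γ / Complex.sinh (u - v)
        * (Complex.cosh (u - v) + Complex.sinh (u - v)) * hs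
        + E * Complex.exp (2 * x) ^ ((q : ℕ) + 1) * Complex.exp (2 * y) ^ ((p : ℕ) + 1) * e3
  · subst h
    simp only [if_true, Finset.Ioo_self, Finset.sum_empty]
    rw [Complex.sinh_add (u - v)]
    field_simp
    ring
  · have e1 : Complex.exp ((u - v) * (2 * ((p : ℂ) - (q : ℂ)) - n * sgn p q) / n)
        = Complex.exp (-2 * (u - v) * ((q : ℂ) - (p : ℂ)) / n) * Complex.exp (-(u - v)) := by
      have hn : (n : ℂ) ≠ 0 := Nat.cast_ne_zero.mpr (Nat.ne_of_gt p.pos)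
      rw [sgn_of_gt h, ← Complex.exp_add]
      congr 1
      field_simp
      ring
    have e2 : Complex.exp (-γ * sgn p q) = Complex.cosh γ - Complex.sinh γ := by
      rw [sgn_of_gt h, Complex.cosh_sub_sinh]; ring_nf
    have hT := sub_mul_sum_Ioo (Complex.exp (2 * x)) (Complex.exp (2 * y)) h
    rw [if_neg h.ne', if_neg h.ne', e1, e2, Finset.Ioo_eq_empty (a := (p : ℕ)) (not_lt.mpr h.le),
      Finset.sum_empty, zero_sub, ← Complex.cosh_sub_sinh (u - v)]
    have := trig_entry_identity (A := -Complex.cosh γ) (F := Complex.sinh γ)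
      (h := -(Complex.cosh (u - v) / Complex.sinh (u - v)))
      (k := -(Complex.cosh (x - y) / Complex.sinh (x - y)))
      (X := Complex.exp (2 * y)) (Y := Complex.exp (2 * x))
      (P := Complex.exp (2 * x) ^ ((p : ℕ) + 1) * Complex.exp (2 * y) ^ ((q : ℕ) + 1))
      (Q := Complex.exp (2 * x) ^ ((q : ℕ) + 1) * Complex.exp (2 * y) ^ ((p : ℕ) + 1))
      (T := Complex.exp (2 * x) * Complex.exp (2 * y) * ∑ m ∈ Finset.Ioo (q : ℕ) p,
        Complex.exp (2 * x) ^ m * Complex.exp (2 * y) ^ ((q : ℕ) + p - m))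
      (by linear_combination hK) (by rw [← neg_sub]; exact neg_ne_zero.mpr hXY) (by
          linear_combination -Complex.exp (2 * x) * Complex.exp (2 * y) * hT)
    have e3 : Complex.sinh γ / Complex.sinh (u - v)
        * (Complex.cosh (u - v) - Complex.sinh (u - v))
        = Complex.sinh γ * (Complex.cosh (u - v) / Complex.sinh (u - v) - 1) := by
      field_simp
    linear_combination -E * this + Complex.sinh γ / Complex.sinh (u - v)
        * (Complex.cosh (u - v) - Complex.sinh (u - v)) * hs
        + E * Complex.exp (2 * x) ^ ((q : ℕ) + 1) * Complex.exp (2 * y) ^ ((p : ℕ) + 1) * e3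

theorem vertexFace_trig (n : ℕ) (γ : ℂ) :
    VertexFace n Complex.sinh Complex.cosh (fun x => Complex.exp ((n + 1) * x)) 1 γ (trigCurve n)
      (trigS n γ) where
  formula := addFormula_sinh
  ne_zero _ := sinh_ne_zero_of_re
  g_add x y := by rw [mul_add, Complex.exp_add]
  g_zero := by rw [mul_zero, Complex.exp_zero]
  isUnit := isUnit_nodeMatrix_trigCurve
  interp := trigCurve_interp
  intertwine := trigS_intertwine n γ

/-! ### The rational case -/

lemma addFormula_id : AddFormula id (fun _ => 1) 0 where
  add x y := by simp
  cadd x y := by simp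
  neg x := rfl
  cneg x := rfl
  sq x := by simp

/-- The moment curve of the rational twist. It does not depend on the spectral parameter; the signs
make the inverse transpose of the matrix of nodes equal to `bhat`. -/
def ratCurve (n : ℕ) (_t z : ℂ) (i : Fin n) : ℂ := (-1) ^ (n + 1 + (i : ℕ)) * z ^ (i : ℕ)

lemma Separated.injective_id {n : ℕ} {l : Fin n → ℂ} (hl : Separated id l) :
    Function.Injective l := by
  intro i j hij
  by_contra h
  exact hl i j h (by simp [hij])

lemma lagrange_id {n : ℕ} (l : Fin n → ℂ) (a : Fin n) (z : ℂ) :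
    lagrange id (fun _ => 1) l a z
      = ∏ k ∈ Finset.univ.erase a, (z - l k) / (l a - l k) := by
  simp [lagrange]

lemma ratCurve_interp {n : ℕ} (t : ℂ) (l : Fin n → ℂ) (hl : Separated id l) (z : ℂ)
    (i : Fin n) :
    ratCurve n t z i = ∑ a, lagrange id (fun _ => 1) l a z * ratCurve n t (l a) i := by
  simp only [ratCurve, lagrange_id]
  rw [pow_eq_sum_lagrange hl.injective_id z i, Finset.mul_sum]
  exact Finset.sum_congr rfl fun a _ => by ring

lemma isUnit_nodeMatrix_ratCurve {n : ℕ} (t : ℂ) (l : Fin n → ℂ)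
    (hl : Separated id l) : IsUnit (nodeMatrix (ratCurve n t) l) := by
  have h : nodeMatrix (ratCurve n t) l
      = Matrix.diagonal (fun j : Fin n => (-1 : ℂ) ^ (n + 1 + (j : ℕ)))
        * (Matrix.vandermonde l)ᵀ := by
    ext j k
    simp [nodeMatrix, ratCurve]
  rw [h, Matrix.isUnit_iff_isUnit_det, Matrix.det_mul, Matrix.det_transpose,
    Matrix.det_diagonal, isUnit_iff_ne_zero]
  exact mul_ne_zero (Finset.prod_ne_zero_iff.mpr fun _ _ => pow_ne_zero _ (by norm_num))
    (Matrix.det_vandermonde_ne_zero_iff.mpr hl.injective_id)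

/-- Vieta's formula for the nodal polynomial of the nodes other than `j`. -/
lemma sum_esymm_erase {n : ℕ} (l : Fin n → ℂ) (j : Fin n) (z : ℂ) :
    ∑ i : Fin n, (-1) ^ (n + 1 + (i : ℕ)) * z ^ (i : ℕ)
        * ∑ α ∈ (Finset.univ.erase j).powersetCard (n - ((i : ℕ) + 1)), ∏ m ∈ α, l m
      = ∏ k ∈ Finset.univ.erase j, (z - l k) := by
  have hn : 0 < n := j.pos
  have hc : (Finset.univ.erase j).card = n - 1 := by simp
  have h1 : ∏ k ∈ Finset.univ.erase j, (z - l k)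
      = ∏ k ∈ Finset.univ.erase j, (-l k + z) := Finset.prod_congr rfl fun k _ => by ring
  rw [h1, Finset.prod_add, Finset.sum_powerset, hc, Nat.sub_add_cancel hn,
    ← Finset.sum_range_reflect,
    Fin.sum_univ_eq_sum_range (fun i => (-1 : ℂ) ^ (n + 1 + i) * z ^ i
        * ∑ α ∈ (Finset.univ.erase j).powersetCard (n - (i + 1)), ∏ m ∈ α, l m) n]
  refine Finset.sum_congr rfl fun i hi => ?_
  have hi := Finset.mem_range.mp hi
  rw [Finset.mul_sum, show n - 1 - i = n - (i + 1) by omega]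
  refine Finset.sum_congr rfl fun α hα => ?_
  obtain ⟨hα1, hα2⟩ := Finset.mem_powersetCard.mp hα
  rw [Finset.prod_const, Finset.card_sdiff_of_subset hα1, hc, hα2, Finset.prod_neg, hα2,
    show n - 1 - (n - (i + 1)) = i by omega,
    show n + 1 + i = (n - (i + 1)) + 2 * (i + 1) by omega, pow_add, pow_mul]
  norm_num
  ring

theorem dualMatrix_ratCurve {n : ℕ} (t : ℂ) {l : Fin n → ℂ} (hl : Function.Injective l) :
    dualMatrix (ratCurve n t) l = bhat n l := by
  have h : (nodeMatrix (ratCurve n t) l)ᵀ * bhat n l = 1 := by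
    ext k j
    rw [Matrix.mul_apply]
    simp only [Matrix.transpose_apply, nodeMatrix, Matrix.of_apply, ratCurve, bhat,
      mul_div_assoc']
    rw [← Finset.sum_div, sum_esymm_erase]
    by_cases hkj : k = j
    · subst hkj
      rw [Matrix.one_apply_eq, div_self]
      exact Finset.prod_ne_zero_iff.mpr fun m hm =>
        sub_ne_zero.mpr fun h => (Finset.ne_of_mem_erase hm) (hl h).symm
    · rw [Matrix.one_apply_ne hkj, Finset.prod_eq_zero (i := k) (by simp [hkj]) (sub_self _),
        zero_div]
  rw [dualMatrix, Matrix.transpose_nonsing_inv]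
  exact Matrix.inv_eq_right_inv h

/-- The coefficient of `γ` in `R^∞`. -/
def cgPart (n : ℕ) : End2 n :=
  ∑ i ∈ Finset.Icc 1 n, ∑ k ∈ Finset.Icc 1 (i - 1), ∑ j ∈ Finset.Icc 1 (i - k),
    (eN n i (i - k) ⊗ₖ eN n j (j + k - 1) - eN n j (j + k - 1) ⊗ₖ eN n i (i - k))

lemma RInf_eq (n : ℕ) (γ : ℂ) : RInf n γ = 1 + γ • cgPart n := by
  rw [RInf, cgPart]
  congr 1
  ext ⟨p1, p2⟩ q
  simp only [Matrix.sum_apply]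
  rw [sum_sum_single p1 p2]
  · rw [kronecker_e_apply, Matrix.one_apply]
    exact if_congr (by simp [eq_comm]) rfl rfl
  · intro i j hij
    rw [kronecker_e_apply, if_neg]
    rintro ⟨h, -⟩
    exact hij h.symm

lemma eN_transpose (n p q : ℕ) : (eN n p q)ᵀ = eN n q p := by
  ext a b; simp [eN, and_comm]

lemma Rhat_eq (n : ℕ) (γ s : ℂ) :
    Rhat n γ s = zeroWeight (fun i j => if i = j then 1 + γ / s else 1)
      (fun i j => if i = j then 0 else γ / s) + γ • (cgPart n)ᵀ := by
  have h : (cgPart n)ᵀ = ∑ i ∈ Finset.Icc 1 n, ∑ k ∈ Finset.Icc 1 (i - 1),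
      ∑ j ∈ Finset.Icc 1 (i - k),
        (eN n (i - k) i ⊗ₖ eN n (j + k - 1) j - eN n (j + k - 1) j ⊗ₖ eN n (i - k) i) := by
    simp only [cgPart, Matrix.transpose_sum, Matrix.transpose_sub, ← Matrix.kroneckerMap_transpose,
      eN_transpose]
  rw [Rhat, h]
  congr 1
  have h1 := sum_offdiag_diag_units (n := n) fun _ _ => 1
  simp only [one_smul] at h1
  simp only [Finset.sum_add_distrib]
  rw [sum_diag_units, h1, sum_offdiag_swap_units fun _ _ => γ / s, zeroWeight_add, zeroWeight_add]
  congr 1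
  · ext i j; by_cases h : i = j <;> simp [h]
  · ext i j; by_cases h : i = j <;> simp [h]

lemma eN_mulVec_ratCurve {n : ℕ} (t x : ℂ) {a b : ℕ} (hb : 1 ≤ b) (hbn : b ≤ n) (p : Fin n) :
    (eN n a b *ᵥ ratCurve n t x) p
      = if (p : ℕ) + 1 = a then (-1) ^ (n + b) * x ^ (b - 1) else 0 := by
  rw [Matrix.mulVec, dotProduct, Finset.sum_eq_single ⟨b - 1, by omega⟩]
  · simp only [eN, Matrix.of_apply, ratCurve, Nat.sub_add_cancel hb, and_true, ite_mul, one_mul,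
      zero_mul]
    rw [show n + 1 + (b - 1) = n + b by omega]
  · intro q _ hq
    have : ¬ ((q : ℕ) + 1 = b) := fun h => hq (Fin.ext (by simp; omega))
    simp [eN, this]
  · simp

lemma kronecker_mulVec_tensor {n : ℕ} (A B : End1 n) (a b : Fin n → ℂ) (p : Fin n × Fin n) :
    ((A ⊗ₖ B) *ᵥ tensor a b) p = (A *ᵥ a) p.1 * (B *ᵥ b) p.2 := by
  simp only [Matrix.mulVec, dotProduct, Fintype.sum_prod_type, Finset.sum_mul_sum, tensor,
    Matrix.kroneckerMap_apply]
  exact Finset.sum_congr rfl fun i _ => Finset.sum_congr rfl fun j _ => by ring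

/-- The entry at `(p, q)`, counted from `0`, of the first half of `cgPart` applied to the product of
two points of the moment curve. It is `0` for `p ≤ q`, where `p - q` truncates. -/
noncomputable def cgSum (n : ℕ) (x y : ℂ) (p q : ℕ) : ℂ :=
  ∑ m ∈ Finset.range (p - q),
    (-1) ^ (n + (p - m)) * x ^ (p - m - 1) * ((-1) ^ (n + (q + m + 1)) * y ^ (q + m))

lemma sum_Icc_collapse {n : ℕ} (p q : Fin n) (F : ℕ → ℕ → ℕ → ℂ) :
    ∑ i ∈ Finset.Icc 1 n, ∑ k ∈ Finset.Icc 1 (i - 1), ∑ j ∈ Finset.Icc 1 (i - k),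
      (if (p : ℕ) + 1 = i then if (q : ℕ) + 1 = j then F i k j else 0 else 0)
    = ∑ m ∈ Finset.range (p - q), F (p + 1) (m + 1) (q + 1) := by
  rw [Finset.sum_eq_single ((p : ℕ) + 1)]
  · have h : ∀ k ∈ Finset.Icc 1 ((p : ℕ) + 1 - 1), ∑ j ∈ Finset.Icc 1 ((p : ℕ) + 1 - k),
        (if (p : ℕ) + 1 = p + 1 then if (q : ℕ) + 1 = j then F (p + 1) k j else 0 else 0)
        = if k ∈ Finset.Icc 1 ((p : ℕ) - q) then F (p + 1) k (q + 1) else 0 := by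
      intro k hk
      rw [Finset.mem_Icc] at hk
      simp only [if_true]
      rw [Finset.sum_ite_eq]
      exact if_congr (by simp only [Finset.mem_Icc]; omega) rfl rfl
    rw [Finset.sum_congr rfl h, ← Finset.sum_filter, Finset.filter_mem_eq_inter,
      Finset.inter_eq_right.mpr (Finset.Icc_subset_Icc_right (by omega)),
      Finset.range_eq_Ico, Finset.sum_Ico_add' (fun k => F (p + 1) k (q + 1)) 0 _ 1]
    exact Finset.sum_congr (by ext; simp only [Finset.mem_Icc, Finset.mem_Ico]; omega)
      fun _ _ => rfl
  · intro i _ hi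
    refine Finset.sum_eq_zero fun k _ => Finset.sum_eq_zero fun j _ => ?_
    rw [if_neg (Ne.symm hi)]
  · intro h
    exact absurd (Finset.mem_Icc.mpr ⟨by omega, p.2⟩) h

lemma cgPart_mulVec {n : ℕ} (u v x y : ℂ) (p q : Fin n) :
    (cgPart n *ᵥ tensor (ratCurve n u x) (ratCurve n v y)) (p, q)
      = cgSum n x y p q - cgSum n y x q p := by
  have h : ∀ i ∈ Finset.Icc 1 n, ∀ k ∈ Finset.Icc 1 (i - 1), ∀ j ∈ Finset.Icc 1 (i - k),
      ((eN n i (i - k) ⊗ₖ eN n j (j + k - 1) - eN n j (j + k - 1) ⊗ₖ eN n i (i - k)) *ᵥ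
        tensor (ratCurve n u x) (ratCurve n v y)) (p, q)
      = (if (p : ℕ) + 1 = i then if (q : ℕ) + 1 = j then
          (-1) ^ (n + (i - k)) * x ^ (i - k - 1)
            * ((-1) ^ (n + (j + k - 1)) * y ^ (j + k - 1 - 1)) else 0 else 0)
        - (if (q : ℕ) + 1 = i then if (p : ℕ) + 1 = j then
          (-1) ^ (n + (i - k)) * y ^ (i - k - 1)
            * ((-1) ^ (n + (j + k - 1)) * x ^ (j + k - 1 - 1)) else 0 else 0) := by
    intro i hi k hk j hj
    rw [Finset.mem_Icc] at hi hk hj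
    rw [Matrix.sub_mulVec, Pi.sub_apply, kronecker_mulVec_tensor, kronecker_mulVec_tensor,
      eN_mulVec_ratCurve u x (by omega) (by omega), eN_mulVec_ratCurve v y (by omega) (by omega),
      eN_mulVec_ratCurve u x (by omega) (by omega), eN_mulVec_ratCurve v y (by omega) (by omega)]
    congr 1
    · split_ifs <;> simp
    · split_ifs <;> simp [mul_comm]
  rw [cgPart]
  simp only [Matrix.sum_mulVec, Finset.sum_apply]
  rw [Finset.sum_congr rfl fun i hi => Finset.sum_congr rfl fun k hk =>
    Finset.sum_congr rfl fun j hj => h i hi k hk j hj]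
  simp only [Finset.sum_sub_distrib]
  rw [sum_Icc_collapse p q fun i k j => (-1) ^ (n + (i - k)) * x ^ (i - k - 1)
            * ((-1) ^ (n + (j + k - 1)) * y ^ (j + k - 1 - 1)),
    sum_Icc_collapse q p fun i k j => (-1) ^ (n + (i - k)) * y ^ (i - k - 1)
            * ((-1) ^ (n + (j + k - 1)) * x ^ (j + k - 1 - 1))]
  congr 1
  · refine Finset.sum_congr rfl fun m _ => ?_
    rw [Nat.add_sub_add_right, show (q : ℕ) + 1 + (m + 1) - 1 = q + m + 1 by omega,
      Nat.add_sub_cancel]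
  · refine Finset.sum_congr rfl fun m _ => ?_
    rw [Nat.add_sub_add_right, show (p : ℕ) + 1 + (m + 1) - 1 = p + m + 1 by omega,
      Nat.add_sub_cancel]

/-- The geometric sum behind the rational intertwining relation. -/
lemma sub_mul_cgSum (n : ℕ) (x y : ℂ) {p q : ℕ} (h : q ≤ p) :
    (x - y) * cgSum n x y p q
      = -((-1) ^ (n + 1 + p) * (-1) ^ (n + 1 + q) * (x ^ p * y ^ q - y ^ p * x ^ q)) := by
  obtain ⟨d, rfl⟩ := Nat.exists_eq_add_of_le h
  have h2 : ∀ m ∈ Finset.range (q + d - q),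
      (-1) ^ (n + (q + d - m)) * x ^ (q + d - m - 1) * ((-1) ^ (n + (q + m + 1)) * y ^ (q + m))
      = -((-1) ^ d * (x * y) ^ q) * (y ^ m * x ^ (d - 1 - m)) := by
    intro m hm
    have hm := Finset.mem_range.mp hm
    obtain ⟨r, rfl⟩ : ∃ r, d = r + m + 1 := ⟨d - m - 1, by omega⟩
    rw [show q + (r + m + 1) - m = q + r + 1 by omega, show r + m + 1 - 1 - m = r by omega,
      Nat.add_sub_cancel]
    have h1 : ((-1 : ℂ) ^ n) * (-1) ^ n = 1 := by rw [← mul_pow]; simp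
    have h3 : ((-1 : ℂ) ^ q) * (-1) ^ q = 1 := by rw [← mul_pow]; simp
    simp only [pow_add, mul_pow, pow_one]
    linear_combination x ^ q * x ^ r * y ^ q * y ^ m * (-1) ^ r * (-1) ^ m
      * ((-1) ^ q * (-1) ^ q * h1 + h3)
  rw [cgSum, Finset.sum_congr rfl h2, ← Finset.mul_sum, Nat.add_sub_cancel_left]
  have h3 := (Commute.all y x).geom_sum₂_mul d
  have h1 : ((-1 : ℂ) ^ n) * (-1) ^ n = 1 := by rw [← mul_pow]; simp
  have h4 : ((-1 : ℂ) ^ q) * (-1) ^ q = 1 := by rw [← mul_pow]; simp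
  simp only [pow_add, mul_pow, pow_one]
  linear_combination ((-1) ^ d * (x ^ q * y ^ q)) * h3
    + (-1) ^ d * x ^ q * y ^ q * (x ^ d - y ^ d) * ((-1) ^ q * (-1) ^ q * h1 + h4)

theorem Rhat_intertwine (n : ℕ) (γ u v x y : ℂ) (huv : id (u - v) ≠ 0) (hxy : id (x - y) ≠ 0) :
    (Rhat n γ (u - v))ᵀ *ᵥ tensor (ratCurve n u x) (ratCurve n v y)
      = wAlpha id γ (x - y) • tensor (ratCurve n u x) (ratCurve n v y)
        + wBeta id γ (u - v) (x - y) • tensor (ratCurve n u y) (ratCurve n v x) := by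
  ext ⟨p, q⟩
  have hT : (zeroWeight (fun i j : Fin n => if i = j then 1 + γ / (u - v) else 1)
      (fun i j => if i = j then 0 else γ / (u - v)))ᵀ
      = zeroWeight (fun i j : Fin n => if i = j then 1 + γ / (u - v) else 1)
      (fun i j => if i = j then 0 else γ / (u - v)) := by
    ext ⟨a, b⟩ ⟨c, d⟩
    simp only [zeroWeight, Matrix.transpose_apply, Matrix.of_apply, Prod.swap_prod_mk,
      Prod.mk.injEq]
    congr 1
    · by_cases h : a = c ∧ b = d
      · obtain ⟨rfl, rfl⟩ := h; simp
      · rw [if_neg h, if_neg fun h' => h ⟨h'.1.symm, h'.2.symm⟩]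
    · by_cases h : a = d ∧ b = c
      · obtain ⟨rfl, rfl⟩ := h; simp [eq_comm]
      · rw [if_neg h, if_neg fun h' => h ⟨h'.2.symm, h'.1.symm⟩]
  rw [Rhat_eq, Matrix.transpose_add, hT, Matrix.transpose_smul, Matrix.transpose_transpose,
    Matrix.add_mulVec, Pi.add_apply, zeroWeight_mulVec, Matrix.smul_mulVec, Pi.smul_apply,
    cgPart_mulVec]
  simp only [id] at huv hxy
  have key : (x - y) * (cgSum n x y p q - cgSum n y x q p)
      = -(tensor (ratCurve n u x) (ratCurve n v y) (p, q)
        - tensor (ratCurve n u y) (ratCurve n v x) (p, q)) := by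
    simp only [tensor, ratCurve]
    rcases lt_or_ge (p : ℕ) q with h | h
    · have h0 : cgSum n x y p q = 0 := by rw [cgSum, Nat.sub_eq_zero_of_le h.le]; simp
      linear_combination (x - y) * h0 + sub_mul_cgSum n y x h.le
    · have h0 : cgSum n y x q p = 0 := by rw [cgSum, Nat.sub_eq_zero_of_le h]; simp
      linear_combination sub_mul_cgSum n x y h - (x - y) * h0
  have key2 : cgSum n x y p q - cgSum n y x q p
      = -(tensor (ratCurve n u x) (ratCurve n v y) (p, q)
        - tensor (ratCurve n u y) (ratCurve n v x) (p, q)) / (x - y) := by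
    rw [eq_div_iff hxy]; linear_combination key
  have hsw : tensor (ratCurve n u x) (ratCurve n v y) (q, p)
      = tensor (ratCurve n u y) (ratCurve n v x) (p, q) := by
    simp only [tensor, ratCurve]; ring
  rw [key2, hsw]
  simp only [wAlpha, wBeta, id, Pi.add_apply, Pi.smul_apply, smul_eq_mul]
  by_cases h : p = q
  · subst h
    rw [← hsw]
    simp only [if_true]
    field_simp
    ring
  · simp only [h, if_false]
    field_simp
    ring

theorem vertexFace_rat (n : ℕ) (γ : ℂ) :
    VertexFace n id (fun _ => 1) (fun _ => 1) 0 γ (ratCurve n) (fun s => (Rhat n γ s)ᵀ) where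
  formula := addFormula_id
  ne_zero x hx := fun h => hx (by simpa using congrArg Complex.re h)
  g_add x y := by simp
  g_zero := rfl
  isUnit := isUnit_nodeMatrix_ratCurve
  interp := ratCurve_interp
  intertwine := Rhat_intertwine n γ

/-! ### The explicit matrices in terms of dynamical weights -/

section Identification

variable {n : ℕ}

/-- On the diagonal only the sum of the two coefficients of `zeroWeight` matters. -/
lemma zeroWeight_congr {α β α' β' : Fin n → Fin n → ℂ} (hα : ∀ i j, i ≠ j → α i j = α' i j)
    (hβ : ∀ i j, i ≠ j → β i j = β' i j) (h : ∀ i, α i i + β i i = α' i i + β' i i) :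
    zeroWeight α β = zeroWeight α' β' := by
  ext ⟨i, j⟩ q
  simp only [zeroWeight, Matrix.of_apply, Prod.swap_prod_mk]
  by_cases hij : i = j
  · subst hij
    split_ifs
    · exact h i
    · rfl
  · rw [hα i j hij, hβ i j hij]

lemma one_eq_zeroWeight : (1 : End2 n) = zeroWeight (fun _ _ => 1) 0 := by
  ext p q
  simp [zeroWeight, Matrix.one_apply, eq_comm]

lemma smul_zeroWeight (c : ℂ) (α β : Fin n → Fin n → ℂ) :
    c • zeroWeight α β = zeroWeight (c • α) (c • β) := by
  ext p q
  simp [zeroWeight, mul_add]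

lemma sum_swap_units :
    ∑ i : Fin n, ∑ j : Fin n, e i j ⊗ₖ e j i = zeroWeight 0 (fun _ _ => 1) := by
  ext ⟨p1, p2⟩ q
  simp only [Matrix.sum_apply]
  rw [sum_sum_single p1 p2]
  · rw [kronecker_e_apply]
    simp [zeroWeight]
  · intro i j hij
    rw [kronecker_e_apply, if_neg]
    rintro ⟨h, -⟩
    exact hij h.symm

theorem DACF_eq_dynD (γ s : ℂ) {l : Fin n → ℂ} (hs : s ≠ 0) (hl : Separated id l) :
    DACF n γ s l = dynD n id γ s l := by
  have h : ∑ i, ∑ j ∈ Finset.univ.erase i, (γ / (l i - l j)) • (e i j ⊗ₖ e j i - e i i ⊗ₖ e j j)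
      = zeroWeight 0 (fun i j => if i = j then 0 else γ / (l i - l j))
        + (-1 : ℂ) • zeroWeight (fun i j => if i = j then 0 else γ / (l i - l j)) 0 := by
    rw [← sum_offdiag_swap_units, ← sum_offdiag_diag_units, neg_one_smul, ← sub_eq_add_neg]
    simp only [smul_sub, Finset.sum_sub_distrib]
  rw [DACF, DInf, h, sum_swap_units, Matrix.one_kronecker_one, one_eq_zeroWeight, smul_zeroWeight,
    smul_zeroWeight, zeroWeight_add, zeroWeight_add, zeroWeight_add, dynD]
  refine zeroWeight_congr (fun i j hij => ?_) (fun i j hij => ?_) (fun i => ?_)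
  · have := hl i j hij
    simp only [id] at this
    simp only [Pi.add_apply, Pi.smul_apply, smul_eq_mul, Pi.zero_apply, dynAlpha, wAlpha, hij,
      if_false, id]
    field_simp
    ring
  · have := hl i j hij
    simp only [id] at this
    simp only [Pi.add_apply, Pi.smul_apply, smul_eq_mul, Pi.zero_apply, dynBeta, wBeta, hij,
      if_false, id]
    field_simp
    ring
  · simp only [Pi.add_apply, Pi.smul_apply, smul_eq_mul, Pi.zero_apply, dynAlpha, dynBeta,
      if_true, id]
    field_simp
    ring

theorem trigD_eq_dynD (γ s : ℂ) (l : Fin n → ℂ) :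
    trigD n γ s l = dynD n Complex.sinh γ s l := by
  rw [trigD, sum_diag_units]
  simp only [Finset.sum_add_distrib]
  rw [sum_offdiag_swap_units, sum_offdiag_diag_units, zeroWeight_add, zeroWeight_add, dynD]
  congr 1
  · ext i j; by_cases h : i = j <;> simp [dynAlpha, wAlpha, h]
  · ext i j; by_cases h : i = j <;> simp [dynBeta, wBeta, h]

lemma sum_offdiag_weight_units (a : Fin n → Fin n → ℂ) :
    ∑ i, ∑ j ∈ Finset.univ.erase i, a i j • (e i i ⊗ₖ e i j - e i j ⊗ₖ e i i)
      = Matrix.of fun p q : Fin n × Fin n =>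
        if p.1 = p.2 then
          (if q.1 = p.1 then a p.1 q.2 else 0) - (if q.2 = p.1 then a p.1 q.1 else 0)
        else 0 := by
  ext ⟨p1, p2⟩ ⟨q1, q2⟩
  rw [sum_offdiag_units_apply]
  simp only [Matrix.sub_apply, kronecker_e_apply, Matrix.of_apply, Prod.mk.injEq]
  rw [Finset.sum_eq_single p1]
  · by_cases h : p1 = p2
    · subst h
      have h1 : ∀ j, (if p1 = j then 0 else a p1 j *
          ((if (True ∧ True) ∧ q1 = p1 ∧ q2 = j then 1 else 0)
            - if (True ∧ True) ∧ q1 = j ∧ q2 = p1 then 1 else 0))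
          = (if q2 = j then if q1 = p1 then a p1 j else 0 else 0)
            - if q1 = j then if q2 = p1 then a p1 j else 0 else 0 := by
        intro j
        simp only [and_self, true_and]
        split_ifs <;> simp_all
      simp only [h1, Finset.sum_sub_distrib, Finset.sum_ite_eq, Finset.mem_univ, if_true]
    · have h' : ¬ p2 = p1 := Ne.symm h
      simp [h, h']
  · intro i _ hi
    simp [Ne.symm hi]
  · simp

theorem Ahat_eq_dynA (γ s : ℂ) {l : Fin n → ℂ} (hs : s ≠ 0) (hl : Separated id l) :
    Ahat n γ s l = dynA n id (fun _ => 1) γ s l := by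
  rw [Ahat, sum_diag_units, sum_offdiag_weight_units, dynA, dynD]
  simp only [Finset.sum_add_distrib]
  rw [sum_offdiag_swap_units, sum_offdiag_diag_units, zeroWeight_add, zeroWeight_add]
  congr 1
  · refine zeroWeight_congr (fun i j hij => ?_) (fun i j hij => ?_) (fun i => ?_)
    · have := hl i j hij
      simp only [id] at this
      simp only [Pi.add_apply, Pi.zero_apply, dynAlpha, wAlpha, hij, if_false, id]
      field_simp
      ring
    · have := hl i j hij
      simp only [id] at this
      simp only [Pi.add_apply, Pi.zero_apply, dynBeta, wBeta, hij, if_false, id]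
      field_simp
      ring
    · simp only [Pi.add_apply, Pi.zero_apply, dynAlpha, dynBeta, if_true, id]
      field_simp
      ring
  · have hc : ∀ i j, i ≠ j → γ * (∏ k ∈ (Finset.univ.erase i).erase j, (l i - l k))
            / ∏ m ∈ Finset.univ.erase j, (l j - l m) = dynCoef id (fun _ => 1) γ l i j := by
      intro i j hij
      rw [dynCoef, Finset.prod_div_distrib, ← Finset.mul_prod_erase (Finset.univ.erase j) _
        (a := i) (by simp [hij]), Finset.erase_right_comm]
      simp only [id, one_mul]
      rw [div_mul_div_comm]
    ext ⟨p1, p2⟩ ⟨q1, q2⟩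
    simp only [Matrix.of_apply]
    by_cases h : p1 = p2
    · rw [if_pos h, if_pos h]
      by_cases h1 : q1 = p1
      · by_cases h2 : q2 = p1
        · simp [h1, h2]
        · rw [if_pos h1, if_pos h1, if_neg h2, if_neg h2, hc _ _ (Ne.symm h2)]
      · by_cases h2 : q2 = p1
        · rw [if_neg h1, if_neg h1, if_pos h2, if_pos h2, hc _ _ (Ne.symm h1)]
        · simp [h1, h2]
    · rw [if_neg h, if_neg h]

lemma pBlock_apply (γ : ℂ) (l : Fin n → ℂ) (i a b : Fin n) :
    pBlock n γ l i a b
      = if a = b then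
          if a = i then ∏ k ∈ Finset.univ.erase i, (l i - l k) / (l i - l k + γ) else 1
        else if a = i then -((γ / (l b - l i - γ))
              * ∏ k ∈ (Finset.univ.erase i).erase b, (l i - l k) / (l b - l k)) else 0 := by
  have h : ∀ c : Fin n → ℂ, (∑ j ∈ Finset.univ.erase i, (e j j - c j • e i j)) a b
      = if a = b then if a = i then 0 else 1 else if a = i then -c b else 0 := by
    intro c
    rw [Matrix.sum_apply]
    simp only [Matrix.sub_apply, Matrix.smul_apply, e, Matrix.single_apply, smul_eq_mul, mul_ite,
      mul_one, mul_zero, Finset.sum_sub_distrib]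
    have h1 : ∑ j ∈ Finset.univ.erase i, (if j = a ∧ j = b then (1 : ℂ) else 0)
        = if a = b then if a = i then 0 else 1 else 0 := by
      by_cases hab : a = b
      · subst hab
        simp [Finset.sum_ite_eq']
      · rw [if_neg hab]
        refine Finset.sum_eq_zero fun j _ => if_neg ?_
        rintro ⟨rfl, h⟩
        exact hab h
    have h2 : ∑ j ∈ Finset.univ.erase i, (if i = a ∧ j = b then c j else 0)
        = if a = i then if b = i then 0 else c b else 0 := by
      by_cases hai : a = i
      · subst hai
        simp [Finset.sum_ite_eq']
      · rw [if_neg hai]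
        refine Finset.sum_eq_zero fun j _ => if_neg ?_
        rintro ⟨rfl, h⟩
        exact hai rfl
    rw [h1, h2]
    by_cases hab : a = b
    · subst hab
      by_cases hai : a = i <;> simp [hai]
    · by_cases hai : a = i
      · subst hai
        simp [hab, Ne.symm hab]
      · simp [hab, hai]
  rw [pBlock, Matrix.add_apply, h]
  simp only [Matrix.smul_apply, e, Matrix.single_apply, smul_eq_mul]
  by_cases hab : a = b
  · subst hab
    by_cases hai : a = i
    · subst hai
      simp
    · simp [hai, Ne.symm hai]
  · by_cases hai : a = i
    · subst hai
      simp [hab]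
    · simp [hab, hai, Ne.symm hai]

lemma Bhat_apply (γ : ℂ) (l : Fin n → ℂ) (p q : Fin n × Fin n) :
    Bhat n γ l p q = if p.1 = q.1 then pBlock n γ l p.1 p.2 q.2 else 0 := by
  rw [Bhat, Matrix.sum_apply, Finset.sum_eq_single p.1]
  · simp [e, Matrix.single_apply]
  · intro b _ hb
    simp [e, hb]
  · simp

theorem Bhat_eq_dynB (γ : ℂ) (l : Fin n → ℂ) : Bhat n γ l = dynB n id (fun _ => 1) γ l := by
  ext ⟨p1, p2⟩ ⟨q1, q2⟩
  rw [Bhat_apply, pBlock_apply, dynB]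
  simp only [Matrix.of_apply, id, one_mul]
  split_ifs <;> ring

end Identification

/-! ### The limit from `sinh` to the identity -/

section Limit

variable {n : ℕ}

lemma tendsto_sinh_mul_div (x : ℂ) :
    Tendsto (fun ε : ℂ => Complex.sinh (ε * x) / ε) (𝓝[≠] 0) (𝓝 x) := by
  have h : HasDerivAt (fun ε : ℂ => Complex.sinh (ε * x)) x 0 := by
    have := ((hasDerivAt_id (0 : ℂ)).mul_const x).csinh
    simpa using this
  refine h.tendsto_slope_zero.congr fun ε => ?_
  simp [div_eq_inv_mul]

lemma tendsto_sinh_ratio (x : ℂ) {y : ℂ} (hy : y ≠ 0) :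
    Tendsto (fun ε : ℂ => Complex.sinh (ε * x) / Complex.sinh (ε * y)) (𝓝[≠] 0)
      (𝓝 (x / y)) := by
  refine ((tendsto_sinh_mul_div x).div (tendsto_sinh_mul_div y) hy).congr' ?_
  filter_upwards [self_mem_nhdsWithin] with ε hε
  exact div_div_div_cancel_right₀ hε _ _

lemma eventually_sinh_ne_zero {y : ℂ} (hy : y ≠ 0) :
    ∀ᶠ ε : ℂ in 𝓝[≠] 0, Complex.sinh (ε * y) ≠ 0 := by
  filter_upwards [(tendsto_sinh_mul_div y).eventually_ne hy] with ε hε h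
  exact hε (by rw [h, zero_div])

lemma tendsto_exp_one (m x : ℂ) :
    Tendsto (fun ε : ℂ => Complex.exp (m * (ε * x))) (𝓝[≠] 0) (𝓝 1) := by
  have h : Continuous fun ε : ℂ => Complex.exp (m * (ε * x)) := by fun_prop
  have := (h.tendsto 0).mono_left (nhdsWithin_le_nhds (s := {0}ᶜ))
  simpa using this

lemma tendsto_matrix {m : Type*} {F : ℂ → Matrix m m ℂ} {L : Filter ℂ} {M : Matrix m m ℂ}
    (h : ∀ p q, Tendsto (fun ε => F ε p q) L (𝓝 (M p q))) : Tendsto F L (𝓝 M) :=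
  tendsto_pi_nhds.mpr fun p => tendsto_pi_nhds.mpr fun q => h p q

lemma tendsto_dynAlpha (γ : ℂ) {s : ℂ} (hs : s ≠ 0) {l : Fin n → ℂ} (hl : Separated id l)
    (i j : Fin n) :
    Tendsto (fun ε : ℂ => dynAlpha Complex.sinh (ε * γ) (ε * s) (ε • l) i j) (𝓝[≠] 0)
      (𝓝 (dynAlpha id γ s l i j)) := by
  by_cases h : i = j
  · simp only [dynAlpha, if_pos h]
    exact (tendsto_sinh_ratio (s + γ) hs).congr fun ε => by rw [mul_add]
  · simp only [dynAlpha, if_neg h, wAlpha]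
    exact (tendsto_sinh_ratio (l i - l j - γ) (hl i j h)).congr fun ε => by
      simp only [Pi.smul_apply, smul_eq_mul, mul_sub, id]

lemma tendsto_dynBeta (γ : ℂ) {s : ℂ} (hs : s ≠ 0) {l : Fin n → ℂ} (hl : Separated id l)
    (i j : Fin n) :
    Tendsto (fun ε : ℂ => dynBeta Complex.sinh (ε * γ) (ε * s) (ε • l) i j) (𝓝[≠] 0)
      (𝓝 (dynBeta id γ s l i j)) := by
  by_cases h : i = j
  · simp only [dynBeta, if_pos h, tendsto_const_nhds]
  · simp only [dynBeta, if_neg h, wBeta, mul_div_mul_comm]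
    exact ((tendsto_sinh_ratio γ hs).mul
      (tendsto_sinh_ratio (s + (l i - l j)) (hl i j h))).congr fun ε => by
      simp only [Pi.smul_apply, smul_eq_mul, mul_sub, mul_add, id]

theorem tendsto_dynD (γ : ℂ) {s : ℂ} (hs : s ≠ 0) {l : Fin n → ℂ} (hl : Separated id l) :
    Tendsto (fun ε : ℂ => dynD n Complex.sinh (ε * γ) (ε * s) (ε • l)) (𝓝[≠] 0)
      (𝓝 (dynD n id γ s l)) := by
  refine tendsto_matrix fun p q => ?_
  simp only [dynD, zeroWeight, Matrix.of_apply]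
  refine Tendsto.add ?_ ?_
  · split_ifs
    · exact tendsto_dynAlpha γ hs hl _ _
    · exact tendsto_const_nhds
  · split_ifs
    · exact tendsto_dynBeta γ hs hl _ _
    · exact tendsto_const_nhds

lemma tendsto_dynCoef (m γ : ℂ) {l : Fin n → ℂ} (hl : Separated id l) {i j : Fin n} (h : i ≠ j) :
    Tendsto (fun ε : ℂ => dynCoef Complex.sinh (fun x => Complex.exp (m * x)) (ε * γ) (ε • l) i j)
      (𝓝[≠] 0) (𝓝 (dynCoef id (fun _ => 1) γ l i j)) := by
  simp only [dynCoef, Pi.smul_apply, smul_eq_mul, ← mul_sub]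
  refine ((tendsto_exp_one m _).mul (tendsto_sinh_ratio γ (hl j i h.symm))).mul
    (tendsto_finsetProd _ fun k hk => ?_)
  exact tendsto_sinh_ratio _ (hl j k (Finset.ne_of_mem_erase hk).symm)

theorem tendsto_dynA (m γ : ℂ) {s : ℂ} (hs : s ≠ 0) {l : Fin n → ℂ} (hl : Separated id l) :
    Tendsto (fun ε : ℂ => dynA n Complex.sinh (fun x => Complex.exp (m * x)) (ε * γ) (ε * s)
      (ε • l)) (𝓝[≠] 0) (𝓝 (dynA n id (fun _ => 1) γ s l)) := by
  refine (tendsto_dynD γ hs hl).add (tendsto_matrix fun p q => ?_)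
  simp only [Matrix.of_apply]
  split_ifs with h h1 h2 h2
  · rw [h1, h2]; simp only [sub_self, tendsto_const_nhds]
  · exact (tendsto_dynCoef m γ hl (Ne.symm h2)).sub tendsto_const_nhds
  · exact tendsto_const_nhds.sub (tendsto_dynCoef m γ hl (Ne.symm h1))
  · exact tendsto_const_nhds
  · exact tendsto_const_nhds

theorem tendsto_dynB (m γ : ℂ) {l : Fin n → ℂ} (hl : Regular γ l) :
    Tendsto (fun ε : ℂ => dynB n Complex.sinh (fun x => Complex.exp (m * x)) (ε * γ) (ε • l))
      (𝓝[≠] 0) (𝓝 (dynB n id (fun _ => 1) γ l)) := by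
  refine tendsto_matrix fun p q => ?_
  simp only [dynB, Matrix.of_apply, Pi.smul_apply, smul_eq_mul, ← mul_sub, ← mul_add, ← mul_neg]
  split_ifs with h h1 h2 h2
  · refine (tendsto_exp_one m _).mul (tendsto_finsetProd _ fun k hk => ?_)
    exact tendsto_sinh_ratio _ (hl _ k (Finset.ne_of_mem_erase hk).symm).2
  · exact tendsto_const_nhds
  · have hne : p.1 ≠ q.2 := fun h3 => h1 (h2.trans h3)
    refine ((tendsto_exp_one m _).mul (tendsto_sinh_ratio (-γ) ?_)).mul
      (tendsto_finsetProd _ fun k hk => ?_)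
    · have := (hl _ _ hne).2
      contrapose! this
      linear_combination -this
    · exact tendsto_sinh_ratio _ (hl _ k (Finset.ne_of_mem_erase hk).symm).1
  · exact tendsto_const_nhds
  · exact tendsto_const_nhds

lemma eventually_trigRegular {γ : ℂ} {l : Fin n → ℂ} (hl : Regular γ l) :
    ∀ᶠ ε : ℂ in 𝓝[≠] 0, TrigRegular (ε * γ) (ε • l) := by
  simp only [TrigRegular, Pi.smul_apply, smul_eq_mul, ← mul_sub, ← mul_add, eventually_all]
  intro i j hij
  exact (eventually_sinh_ne_zero (hl i j hij).1).and (eventually_sinh_ne_zero (hl i j hij).2)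

end Limit

/-! ### Leg notation -/

section Legs

variable {n : ℕ}

lemma leg1h2_mul (γ : ℂ) (F G : (Fin n → ℂ) → End1 n) (l : Fin n → ℂ) :
    leg1h2 γ F l * leg1h2 γ G l = leg1h2 γ (fun m => F m * G m) l := by
  ext ⟨p1, p2⟩ ⟨q1, q2⟩
  by_cases h : p2 = q2
  · subst h
    simp [Matrix.mul_apply, leg1h2_apply, Fintype.sum_prod_type]
  · simp [Matrix.mul_apply, leg1h2_apply, Fintype.sum_prod_type, h]

lemma leg2h1_mul (γ : ℂ) (F G : (Fin n → ℂ) → End1 n) (l : Fin n → ℂ) :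
    leg2h1 γ F l * leg2h1 γ G l = leg2h1 γ (fun m => F m * G m) l := by
  ext ⟨p1, p2⟩ ⟨q1, q2⟩
  by_cases h : p1 = q1
  · subst h
    simp [Matrix.mul_apply, leg2h1_apply, Fintype.sum_prod_type]
  · simp [Matrix.mul_apply, leg2h1_apply, Fintype.sum_prod_type, h]

lemma leg1h2_congr {γ : ℂ} {F G : (Fin n → ℂ) → End1 n} {l : Fin n → ℂ}
    (h : ∀ k, F (shift γ k l) = G (shift γ k l)) : leg1h2 γ F l = leg1h2 γ G l :=
  Finset.sum_congr rfl fun k _ => by rw [h]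

lemma leg2h1_congr {γ : ℂ} {F G : (Fin n → ℂ) → End1 n} {l : Fin n → ℂ}
    (h : ∀ k, F (shift γ k l) = G (shift γ k l)) : leg2h1 γ F l = leg2h1 γ G l :=
  Finset.sum_congr rfl fun k _ => by rw [h]

lemma leg1h2_one (γ : ℂ) (l : Fin n → ℂ) : leg1h2 γ (fun _ => (1 : End1 n)) l = 1 := by
  ext p q
  rw [leg1h2_apply]
  simp only [Matrix.one_apply, ← ite_and, Prod.ext_iff]
  exact if_congr and_comm rfl rfl

lemma leg2h1_one (γ : ℂ) (l : Fin n → ℂ) : leg2h1 γ (fun _ => (1 : End1 n)) l = 1 := by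
  ext p q
  rw [leg2h1_apply]
  simp only [Matrix.one_apply, ← ite_and, Prod.ext_iff]

lemma isUnit_leg1h2 {γ : ℂ} {F : (Fin n → ℂ) → End1 n} {l : Fin n → ℂ}
    (h : ∀ k, IsUnit (F (shift γ k l))) : IsUnit (leg1h2 γ F l) := by
  refine IsUnit.of_mul_eq_one (leg1h2 γ (fun m => (F m)⁻¹) l) ?_
  rw [leg1h2_mul, ← leg1h2_one γ l]
  exact leg1h2_congr fun k => Matrix.mul_nonsing_inv _ ((Matrix.isUnit_iff_isUnit_det _).mp (h k))

lemma isUnit_leg2h1 {γ : ℂ} {F : (Fin n → ℂ) → End1 n} {l : Fin n → ℂ}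
    (h : ∀ k, IsUnit (F (shift γ k l))) : IsUnit (leg2h1 γ F l) := by
  refine IsUnit.of_mul_eq_one (leg2h1 γ (fun m => (F m)⁻¹) l) ?_
  rw [leg2h1_mul, ← leg2h1_one γ l]
  exact leg2h1_congr fun k => Matrix.mul_nonsing_inv _ ((Matrix.isUnit_iff_isUnit_det _).mp (h k))

lemma isUnit_leg1 {M : End1 n} (h : IsUnit M) : IsUnit (leg1 M) := isUnit_kronecker h isUnit_one

lemma isUnit_leg2 {M : End1 n} (h : IsUnit M) : IsUnit (leg2 M) := isUnit_kronecker isUnit_one h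

lemma isUnit_inv {m : Type*} [Fintype m] [DecidableEq m] {M : Matrix m m ℂ} (h : IsUnit M) :
    IsUnit M⁻¹ := Matrix.isUnit_nonsing_inv_iff.mpr h

/-- An operator on three legs that is block diagonal with respect to the third. -/
def block3 (F : Fin n → End2 n) : End3 n :=
  Matrix.of fun p q => if p.2.2 = q.2.2 then F p.2.2 (p.1, p.2.1) (q.1, q.2.1) else 0

lemma block3_mul (F G : Fin n → End2 n) :
    block3 F * block3 G = block3 fun k => F k * G k := by
  ext ⟨p1, p2, p3⟩ ⟨q1, q2, q3⟩
  by_cases h : p3 = q3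
  · subst h
    simp [Matrix.mul_apply, block3, Fintype.sum_prod_type]
  · simp [Matrix.mul_apply, block3, Fintype.sum_prod_type, h]

/-- An operator on three legs that is diagonal in the first two and acts in the third. -/
def diag12 (T : Fin n → Fin n → End1 n) : End3 n :=
  Matrix.of fun p q => if p.1 = q.1 ∧ p.2.1 = q.2.1 then T p.1 p.2.1 p.2.2 q.2.2 else 0

lemma diag12_mul (T U : Fin n → Fin n → End1 n) :
    diag12 T * diag12 U = diag12 fun i j => T i j * U i j := by
  ext ⟨p1, p2, p3⟩ ⟨q1, q2, q3⟩
  by_cases h : p1 = q1 ∧ p2 = q2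
  · obtain ⟨rfl, rfl⟩ := h
    simp [Matrix.mul_apply, diag12, Fintype.sum_prod_type, ite_and]
  · simp only [Matrix.mul_apply, diag12, Matrix.of_apply, h, if_false]
    refine Finset.sum_eq_zero fun x _ => ?_
    by_cases h1 : p1 = x.1 ∧ p2 = x.2.1
    · rw [if_neg (fun h2 : x.1 = q1 ∧ x.2.1 = q2 => h ⟨h1.1.trans h2.1, h1.2.trans h2.2⟩),
        mul_zero]
    · rw [if_neg h1, zero_mul]

/-- A zero-weight operator commutes with one depending only on the total weight. -/
lemma leg12_mul_diag12 (α β : Fin n → Fin n → ℂ) {T : Fin n → Fin n → End1 n}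
    (hT : ∀ i j, T i j = T j i) :
    leg12 (zeroWeight α β) * diag12 T = diag12 T * leg12 (zeroWeight α β) := by
  ext ⟨p1, p2, p3⟩ ⟨q1, q2, q3⟩
  have hL : (leg12 (zeroWeight α β) * diag12 T) (p1, p2, p3) (q1, q2, q3)
      = zeroWeight α β (p1, p2) (q1, q2) * T q1 q2 p3 q3 := by
    simp [Matrix.mul_apply, leg12, diag12, Fintype.sum_prod_type, ite_and]
  have hR : (diag12 T * leg12 (zeroWeight α β)) (p1, p2, p3) (q1, q2, q3)
      = T p1 p2 p3 q3 * zeroWeight α β (p1, p2) (q1, q2) := by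
    simp [Matrix.mul_apply, leg12, diag12, Fintype.sum_prod_type, ite_and]
  rw [hL, hR, mul_comm]
  by_cases h1 : (q1, q2) = (p1, p2)
  · obtain ⟨rfl, rfl⟩ := Prod.mk.inj h1
    rfl
  by_cases h2 : (q1, q2) = (p2, p1)
  · obtain ⟨rfl, rfl⟩ := Prod.mk.inj h2
    rw [hT]
  · simp [zeroWeight, h1, h2]

lemma leg12_mul_cube (M : End2 n) (b : End1 n) (p q : Fin n × Fin n × Fin n) :
    (leg12 M * (b ⊗ₖ (b ⊗ₖ b))) p q
      = (M * (b ⊗ₖ b)) (p.1, p.2.1) (q.1, q.2.1) * b p.2.2 q.2.2 :=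
  leg12_mulVec_tensor3 M (fun i => b i q.1) (fun i => b i q.2.1) (fun i => b i q.2.2) p

lemma leg13_mul_cube (M : End2 n) (b : End1 n) (p q : Fin n × Fin n × Fin n) :
    (leg13 M * (b ⊗ₖ (b ⊗ₖ b))) p q
      = (M * (b ⊗ₖ b)) (p.1, p.2.2) (q.1, q.2.2) * b p.2.1 q.2.1 :=
  leg13_mulVec_tensor3 M (fun i => b i q.1) (fun i => b i q.2.1) (fun i => b i q.2.2) p

lemma leg23_mul_cube (M : End2 n) (b : End1 n) (p q : Fin n × Fin n × Fin n) :
    (leg23 M * (b ⊗ₖ (b ⊗ₖ b))) p q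
      = (M * (b ⊗ₖ b)) (p.2.1, p.2.2) (q.2.1, q.2.2) * b p.1 q.1 :=
  leg23_mulVec_tensor3 M (fun i => b i q.1) (fun i => b i q.2.1) (fun i => b i q.2.2) p

lemma cube_transpose (b : End1 n) : (b ⊗ₖ (b ⊗ₖ b))ᵀ = bᵀ ⊗ₖ (bᵀ ⊗ₖ bᵀ) := by
  ext p q; rfl

lemma square_transpose (b : End1 n) : (b ⊗ₖ b)ᵀ = bᵀ ⊗ₖ bᵀ := by
  ext p q; rfl

section Conj

variable {R A : End2 n} {b : End1 n}

lemma leg12_conj (h : R * (b ⊗ₖ b) = (b ⊗ₖ b) * A) :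
    leg12 R * (b ⊗ₖ (b ⊗ₖ b)) = (b ⊗ₖ (b ⊗ₖ b)) * leg12 A := by
  ext p q
  rw [leg12_mul_cube, h, ← Matrix.transpose_apply (_ * leg12 A), Matrix.transpose_mul,
    ← leg12_transpose, cube_transpose, leg12_mul_cube, ← square_transpose, ← Matrix.transpose_mul]
  rfl

lemma leg13_conj (h : R * (b ⊗ₖ b) = (b ⊗ₖ b) * A) :
    leg13 R * (b ⊗ₖ (b ⊗ₖ b)) = (b ⊗ₖ (b ⊗ₖ b)) * leg13 A := by
  ext p q
  rw [leg13_mul_cube, h, ← Matrix.transpose_apply (_ * leg13 A), Matrix.transpose_mul,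
    ← leg13_transpose, cube_transpose, leg13_mul_cube, ← square_transpose, ← Matrix.transpose_mul]
  rfl

lemma leg23_conj (h : R * (b ⊗ₖ b) = (b ⊗ₖ b) * A) :
    leg23 R * (b ⊗ₖ (b ⊗ₖ b)) = (b ⊗ₖ (b ⊗ₖ b)) * leg23 A := by
  ext p q
  rw [leg23_mul_cube, h, ← Matrix.transpose_apply (_ * leg23 A), Matrix.transpose_mul,
    ← leg23_transpose, cube_transpose, leg23_mul_cube, ← square_transpose, ← Matrix.transpose_mul]
  rfl

end Conj

/-- The Yang–Baxter equation is invariant under a constant change of basis. -/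
lemma yang_baxter_conj {R A : ℂ → End2 n} {b : End1 n} {u₁ u₂ u₃ : ℂ} (hb : IsUnit b)
    (h₁₂ : R (u₁ - u₂) * (b ⊗ₖ b) = (b ⊗ₖ b) * A (u₁ - u₂))
    (h₁₃ : R (u₁ - u₃) * (b ⊗ₖ b) = (b ⊗ₖ b) * A (u₁ - u₃))
    (h₂₃ : R (u₂ - u₃) * (b ⊗ₖ b) = (b ⊗ₖ b) * A (u₂ - u₃)) (h : YBE R u₁ u₂ u₃) :
    YBE A u₁ u₂ u₃ := by
  have hB := isUnit_kronecker hb (isUnit_kronecker hb hb)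
  have e₁₂ := leg12_conj h₁₂
  have e₁₃ := leg13_conj h₁₃
  have e₂₃ := leg23_conj h₂₃
  rw [YBE] at h ⊢
  apply hB.mul_left_cancel
  have h' := congrArg (· * (b ⊗ₖ (b ⊗ₖ b))) h
  simp only [Matrix.mul_assoc, e₂₃, e₁₂] at h'
  rw [← Matrix.mul_assoc (leg13 _) (_ ⊗ₖ _), ← Matrix.mul_assoc (leg13 _) (_ ⊗ₖ _), e₁₃] at h'
  simp only [Matrix.mul_assoc] at h'
  rw [← Matrix.mul_assoc (leg12 _) (_ ⊗ₖ _), ← Matrix.mul_assoc (leg23 _) (_ ⊗ₖ _), e₁₂, e₂₃] at h'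
  simpa only [Matrix.mul_assoc] using h'

lemma leg1_e (i : Fin n) :
    leg1 (e i i) = Matrix.diagonal fun p : Fin n × Fin n => if p.1 = i then (1 : ℂ) else 0 := by
  ext ⟨p1, p2⟩ ⟨q1, q2⟩
  simp only [leg1, e, Matrix.kroneckerMap_apply, Matrix.single_apply, Matrix.one_apply,
    Matrix.diagonal_apply, Prod.mk.injEq]
  by_cases h1 : p1 = i <;> by_cases h2 : p1 = q1 <;> by_cases h3 : p2 = q2 <;>
    simp_all [eq_comm]

lemma leg2_e (i : Fin n) :
    leg2 (e i i) = Matrix.diagonal fun p : Fin n × Fin n => if p.2 = i then (1 : ℂ) else 0 := by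
  ext ⟨p1, p2⟩ ⟨q1, q2⟩
  simp only [leg2, e, Matrix.kroneckerMap_apply, Matrix.single_apply, Matrix.one_apply,
    Matrix.diagonal_apply, Prod.mk.injEq]
  by_cases h1 : p2 = i <;> by_cases h2 : p1 = q1 <;> by_cases h3 : p2 = q2 <;>
    simp_all [eq_comm]

lemma commute_diagonal {m : Type*} [Fintype m] [DecidableEq m] {d : m → ℂ} {M : Matrix m m ℂ}
    (h : ∀ p q, d p ≠ d q → M p q = 0) : Commute (Matrix.diagonal d) M := by
  rw [commute_iff_eq]
  ext p q
  rw [Matrix.diagonal_mul, Matrix.mul_diagonal]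
  by_cases hd : d p = d q
  · rw [hd, mul_comm]
  · rw [h p q hd]; simp

end Legs

/-! ### Parametrization, invertibility and consistency of the rational matrices -/

section Rational

variable {n : ℕ}

lemma Regular.separated {γ : ℂ} {l : Fin n → ℂ} (h : Regular γ l) : Separated id l :=
  fun i j hij => (h i j hij).1

lemma Regular.separated_shift {γ : ℂ} {l : Fin n → ℂ} (h : Regular γ l) (k : Fin n) :
    Separated id (shift γ k l) :=
  h.separated.shift addFormula_id.neg (fun i j hij => (h i j hij).2) k

lemma isUnit_bhat {l : Fin n → ℂ} (hl : Function.Injective l) : IsUnit (bhat n l) := by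
  have hs : Separated id l := fun i j hij => sub_ne_zero.mpr fun h => hij (hl h)
  rw [← dualMatrix_ratCurve 0 hl]
  exact ((vertexFace_rat n 0).dualMatrix_eq_inv 0 hs).1

lemma Regular.isUnit_bhat {γ : ℂ} {l : Fin n → ℂ} (h : Regular γ l) : IsUnit (bhat n l) :=
  SDRE.isUnit_bhat h.separated.injective_id

lemma Regular.isUnit_bhat_shift {γ : ℂ} {l : Fin n → ℂ} (h : Regular γ l) (k : Fin n) :
    IsUnit (bhat n (shift γ k l)) :=
  SDRE.isUnit_bhat (h.separated_shift k).injective_id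

theorem Bhat_eq {γ : ℂ} {l : Fin n → ℂ} (hl : Regular γ l) :
    Bhat n γ l = (leg2 (bhat n l))⁻¹ * leg2h1 γ (bhat n) l := by
  rw [Bhat_eq_dynB, ← (vertexFace_rat n γ).dynB_eq 0 hl.separated fun i j hij => (hl i j hij).2,
    dualMatrix_ratCurve 0 hl.separated.injective_id]
  congr 1
  exact leg2h1_congr fun k => dualMatrix_ratCurve 0 (hl.separated_shift k).injective_id

theorem Ahat_eq {γ s : ℂ} {l : Fin n → ℂ} (hs : s ≠ 0) (hl : Separated id l) :
    Ahat n γ s l = (leg1 (bhat n l))⁻¹ * (leg2 (bhat n l))⁻¹ * Rhat n γ s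
      * leg1 (bhat n l) * leg2 (bhat n l) := by
  have h := (vertexFace_rat n γ).dynA_eq (u := s) (v := 0) (by simpa using hs) hl
  rw [sub_zero, dualMatrix_ratCurve _ hl.injective_id, dualMatrix_ratCurve _ hl.injective_id,
    Matrix.transpose_transpose] at h
  rw [Ahat_eq_dynA γ s hs hl, h]

theorem Rhat_mul_bhat {γ s : ℂ} {l : Fin n → ℂ} (hs : s ≠ 0) (hl : Regular γ l) :
    Rhat n γ s * leg1 (bhat n l) * leg2h1 γ (bhat n) l
      = leg2 (bhat n l) * leg1h2 γ (bhat n) l * DACF n γ s l := by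
  have h := (vertexFace_rat n γ).covector_decomposition (u := s) (v := 0) (by simpa using hs)
    hl.separated fun i j hij => (hl i j hij).2
  rw [sub_zero, dualMatrix_ratCurve _ hl.separated.injective_id,
    dualMatrix_ratCurve _ hl.separated.injective_id, Matrix.transpose_transpose,
    leg2h1_congr (G := bhat n) fun k => dualMatrix_ratCurve 0 (hl.separated_shift k).injective_id,
    leg1h2_congr (G := bhat n) fun k => dualMatrix_ratCurve s (hl.separated_shift k).injective_id]
    at h
  rw [DACF_eq_dynD γ s hs hl.separated, h]

theorem DACF_eq {γ s : ℂ} {l : Fin n → ℂ} (hs : s ≠ 0) (hl : Regular γ l) :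
    DACF n γ s l = (leg1h2 γ (bhat n) l)⁻¹ * (leg2 (bhat n l))⁻¹ * Rhat n γ s
      * leg1 (bhat n l) * leg2h1 γ (bhat n) l := by
  have h1 := (Matrix.isUnit_iff_isUnit_det _).mp (isUnit_leg2 hl.isUnit_bhat)
  have h2 := (Matrix.isUnit_iff_isUnit_det _).mp (isUnit_leg1h2 hl.isUnit_bhat_shift)
  have h := Rhat_mul_bhat hs hl
  rw [Matrix.mul_assoc] at h
  rw [Matrix.mul_assoc _ (leg1 _), Matrix.mul_assoc _ (Rhat n γ s), h, Matrix.mul_assoc (leg2 _),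
    Matrix.mul_assoc, Matrix.nonsing_inv_mul_cancel_left _ _ h1,
    Matrix.nonsing_inv_mul_cancel_left _ _ h2]

theorem isUnit_Bhat {γ : ℂ} {l : Fin n → ℂ} (hl : Regular γ l) : IsUnit (Bhat n γ l) := by
  rw [Bhat_eq hl]
  exact (isUnit_inv (isUnit_leg2 hl.isUnit_bhat)).mul (isUnit_leg2h1 hl.isUnit_bhat_shift)

theorem isUnit_Chat {γ : ℂ} {l : Fin n → ℂ} (hl : Regular γ l) : IsUnit (Chat n γ l) :=
  (Matrix.isUnit_submatrix_equiv (Equiv.prodComm (Fin n) (Fin n))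
    (Equiv.prodComm (Fin n) (Fin n))).mpr (isUnit_Bhat hl)

/-- By unitarity: `D₁₂(s) D₂₁(-s) = 1 - γ² / s²`. -/
theorem isUnit_DACF {γ s : ℂ} {l : Fin n → ℂ} (hs : s ≠ 0) (h1 : s ≠ γ) (h2 : s ≠ -γ)
    (hl : Separated id l) : IsUnit (DACF n γ s l) := by
  rw [DACF_eq_dynD γ s hs hl, dynD]
  have h : zeroWeight (dynAlpha id γ s l) (dynBeta id γ s l)
      * zeroWeight (fun i j => dynAlpha id γ (-s) l j i) (fun i j => dynBeta id γ (-s) l j i)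
      = (1 - γ ^ 2 / s ^ 2) • 1 := by
    ext ⟨i, j⟩ ⟨a, b⟩
    rw [mul_zeroWeight_apply]
    simp only [zeroWeight, Matrix.of_apply, Prod.swap_prod_mk, Matrix.smul_apply,
      Matrix.one_apply, smul_eq_mul]
    by_cases hij : i = j
    · subst hij
      by_cases e1 : (a, b) = (i, i)
      · obtain ⟨rfl, rfl⟩ := Prod.mk.inj e1
        simp only [if_true, dynAlpha, dynBeta, id]
        field_simp
        ring
      · have e2 : ¬ ((b, a) = (i, i)) := fun h => e1 (by
          obtain ⟨rfl, rfl⟩ := Prod.mk.inj h; rfl)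
        simp only [e1, e2, Ne.symm e1, if_false]
        ring
    · have hne := hl i j hij
      have hne' := hl j i (Ne.symm hij)
      have hsub : l j - l i = -(l i - l j) := by ring
      simp only [id] at hne hne'
      by_cases e1 : (a, b) = (i, j)
      · obtain ⟨rfl, rfl⟩ := Prod.mk.inj e1
        simp only [Prod.mk.injEq, hij, Ne.symm hij, if_true, if_false, and_self, dynAlpha,
          dynBeta, wAlpha, wBeta, id, hsub]
        field_simp
        ring
      by_cases e2 : (a, b) = (j, i)
      · obtain ⟨rfl, rfl⟩ := Prod.mk.inj e2
        simp only [Prod.mk.injEq, hij, Ne.symm hij, if_true, if_false, and_self, dynAlpha,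
          dynBeta, wAlpha, wBeta, id, hsub]
        field_simp
        ring
      · have e3 : ¬ ((b, a) = (i, j)) := fun h => e2 (by
          obtain ⟨rfl, rfl⟩ := Prod.mk.inj h; rfl)
        have e4 : ¬ ((b, a) = (j, i)) := fun h => e1 (by
          obtain ⟨rfl, rfl⟩ := Prod.mk.inj h; rfl)
        simp only [e1, e2, e3, e4, Ne.symm e1, if_false]
        ring
  have hc : (1 - γ ^ 2 / s ^ 2) ≠ 0 := by
    intro hc
    have : (s - γ) * (s + γ) = 0 := by
      field_simp at hc
      linear_combination hc
    rcases mul_eq_zero.mp this with h | h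
    · exact h1 (sub_eq_zero.mp h)
    · exact h2 (eq_neg_of_add_eq_zero_left h)
  refine IsUnit.of_mul_eq_one ((1 - γ ^ 2 / s ^ 2)⁻¹ •
    zeroWeight (fun i j => dynAlpha id γ (-s) l j i) (fun i j => dynBeta id γ (-s) l j i)) ?_
  rw [Matrix.mul_smul, h, smul_smul, inv_mul_cancel₀ hc, one_smul]

/-- Witness: integer multiples of a number of modulus larger than that of `γ`. -/
lemma exists_regular (n : ℕ) (γ : ℂ) : ∃ l : Fin n → ℂ, Regular γ l := by
  refine ⟨fun i => ((i : ℕ) : ℂ) * ((‖γ‖ + 1 : ℝ) : ℂ), fun i j hij => ?_⟩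
  have h : ‖((i : ℕ) : ℂ) * ((‖γ‖ + 1 : ℝ) : ℂ) - ((j : ℕ) : ℂ) * ((‖γ‖ + 1 : ℝ) : ℂ)‖
      ≥ ‖γ‖ + 1 := by
    rw [← sub_mul, norm_mul, Complex.norm_real, Real.norm_of_nonneg (by positivity)]
    have hz : ((i : ℕ) : ℤ) - ((j : ℕ) : ℤ) ≠ 0 := by
      rw [sub_ne_zero]; exact_mod_cast fun h => hij (Fin.ext h)
    have h1 : (1 : ℝ) ≤ ‖((i : ℕ) : ℂ) - ((j : ℕ) : ℂ)‖ := by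
      have := Int.one_le_abs hz
      rw [show ((i : ℕ) : ℂ) - ((j : ℕ) : ℂ) = ((((i : ℕ) : ℤ) - ((j : ℕ) : ℤ) : ℤ) : ℂ) by
        push_cast; ring, Complex.norm_intCast]
      exact_mod_cast this
    nlinarith [norm_nonneg γ]
  constructor
  · intro h0
    rw [h0, norm_zero] at h
    linarith [norm_nonneg γ]
  · intro h0
    rw [eq_neg_of_add_eq_zero_left h0, norm_neg] at h
    linarith

theorem isUnit_Rhat {γ s : ℂ} (hs : s ≠ 0) (h1 : s ≠ γ) (h2 : s ≠ -γ) :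
    IsUnit (Rhat n γ s) := by
  obtain ⟨l, hl⟩ := exists_regular n γ
  have h : IsUnit (Rhat n γ s * (leg1 (bhat n l) * leg2h1 γ (bhat n) l)) := by
    rw [← Matrix.mul_assoc, Rhat_mul_bhat hs hl]
    exact ((isUnit_leg2 hl.isUnit_bhat).mul (isUnit_leg1h2 hl.isUnit_bhat_shift)).mul
      (isUnit_DACF hs h1 h2 hl.separated)
  rw [Matrix.isUnit_iff_isUnit_det, Matrix.det_mul] at h
  exact (Matrix.isUnit_iff_isUnit_det _).mpr (isUnit_of_mul_isUnit_left h)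

theorem isUnit_Ahat {γ s : ℂ} {l : Fin n → ℂ} (hs : s ≠ 0) (h1 : s ≠ γ) (h2 : s ≠ -γ)
    (hl : Regular γ l) : IsUnit (Ahat n γ s l) := by
  rw [Ahat_eq hs hl.separated]
  have h1' := isUnit_leg1 hl.isUnit_bhat
  have h2' := isUnit_leg2 hl.isUnit_bhat
  exact ((((isUnit_inv h1').mul (isUnit_inv h2')).mul (isUnit_Rhat hs h1 h2)).mul h1').mul h2'

theorem yang_baxter_Rhat (γ : ℂ) {u₁ u₂ u₃ : ℂ} (h₁₂ : u₁ ≠ u₂) (h₁₃ : u₁ ≠ u₃) (h₂₃ : u₂ ≠ u₃) :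
    YBE (Rhat n γ) u₁ u₂ u₃ := by
  have := (vertexFace_rat n γ).yang_baxter_transpose (u₁ := u₁) (u₂ := u₂) (u₃ := u₃)
    (sub_ne_zero.mpr h₁₂) (sub_ne_zero.mpr h₁₃) (sub_ne_zero.mpr h₂₃)
  simpa only [Matrix.transpose_transpose] using this

lemma Rhat_mul_square {γ s : ℂ} {l : Fin n → ℂ} (hs : s ≠ 0) (hl : Separated id l) :
    Rhat n γ s * (bhat n l ⊗ₖ bhat n l) = (bhat n l ⊗ₖ bhat n l) * Ahat n γ s l := by
  have hb := isUnit_bhat hl.injective_id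
  have h1 := (Matrix.isUnit_iff_isUnit_det _).mp (isUnit_leg1 hb)
  have h2 := (Matrix.isUnit_iff_isUnit_det _).mp (isUnit_leg2 hb)
  rw [Ahat_eq hs hl, Matrix.mul_assoc _ (leg1 _) (leg2 _), leg1_mul_leg2,
    Matrix.mul_assoc _ (Rhat n γ s), Matrix.mul_assoc _⁻¹, ← leg2_mul_leg1 (bhat n l) (bhat n l),
    Matrix.mul_assoc (leg2 _) (leg1 _) (_⁻¹ * _), Matrix.mul_nonsing_inv_cancel_left _ _ h1,
    Matrix.mul_nonsing_inv_cancel_left _ _ h2]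

theorem yang_baxter_Ahat {γ : ℂ} {l : Fin n → ℂ} (hl : Separated id l) {u₁ u₂ u₃ : ℂ}
    (h₁₂ : u₁ ≠ u₂) (h₁₃ : u₁ ≠ u₃) (h₂₃ : u₂ ≠ u₃) :
    YBE (fun s => Ahat n γ s l) u₁ u₂ u₃ :=
  yang_baxter_conj (isUnit_bhat hl.injective_id) (Rhat_mul_square (sub_ne_zero.mpr h₁₂) hl)
    (Rhat_mul_square (sub_ne_zero.mpr h₁₃) hl) (Rhat_mul_square (sub_ne_zero.mpr h₂₃) hl)
    (yang_baxter_Rhat γ h₁₂ h₁₃ h₂₃)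

/-- The block form of `Bhat_eq`. -/
lemma bhat_mul_pBlock {γ : ℂ} {l : Fin n → ℂ} (hl : Regular γ l) (k : Fin n) :
    bhat n l * pBlock n γ l k = bhat n (shift γ k l) := by
  have h : leg2 (bhat n l) * Bhat n γ l = leg2 (bhat n l) * _ := congrArg _ (Bhat_eq hl)
  rw [Matrix.mul_nonsing_inv_cancel_left _ _
    ((Matrix.isUnit_iff_isUnit_det _).mp (isUnit_leg2 hl.isUnit_bhat))] at h
  ext i j
  have h' := congrFun (congrFun h (k, i)) (k, j)
  rw [leg2h1_apply] at h'
  simpa [Matrix.mul_apply, leg2, Fintype.sum_prod_type, Bhat_apply, Matrix.kroneckerMap_apply,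
    Matrix.one_apply] using h'

/-- All operators are block diagonal with respect to the third leg. The `k`-th block of the equation
states that `pBlock l k ⊗ pBlock l k` conjugates `Ahat` at `l` into `Ahat` at `shift γ k l`. -/
theorem consistency_AC {γ s : ℂ} {l : Fin n → ℂ} (hs : s ≠ 0) (hl : Regular γ l) :
    leg12 (Ahat n γ s l) * leg13 (Chat n γ l) * leg23 (Chat n γ l)
      = leg23 (Chat n γ l) * leg13 (Chat n γ l) * leg12h3 γ (Ahat n γ s) l := by
  have h13 : leg13 (Chat n γ l) = block3 fun k => pBlock n γ l k ⊗ₖ 1 := by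
    ext ⟨p1, p2, p3⟩ ⟨q1, q2, q3⟩
    simp only [leg13, Chat, swap12, block3, Matrix.of_apply, Matrix.submatrix_apply,
      Prod.swap_prod_mk, Bhat_apply, Matrix.kroneckerMap_apply, Matrix.one_apply]
    split_ifs <;> simp
  have h23 : leg23 (Chat n γ l) = block3 fun k => 1 ⊗ₖ pBlock n γ l k := by
    ext ⟨p1, p2, p3⟩ ⟨q1, q2, q3⟩
    simp only [leg23, Chat, swap12, block3, Matrix.of_apply, Matrix.submatrix_apply,
      Prod.swap_prod_mk, Bhat_apply, Matrix.kroneckerMap_apply, Matrix.one_apply]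
    split_ifs <;> simp
  have h12 : leg12 (Ahat n γ s l) = block3 fun _ => Ahat n γ s l := rfl
  have h123 : leg12h3 γ (Ahat n γ s) l = block3 fun k => Ahat n γ s (shift γ k l) := rfl
  rw [h12, h123, h13, h23]
  simp only [block3_mul]
  congr 1
  ext1 k
  have hA := Rhat_mul_square (γ := γ) hs hl.separated
  have hAk := Rhat_mul_square (γ := γ) hs (hl.separated_shift k)
  have hQ := bhat_mul_pBlock hl k
  apply (isUnit_kronecker hl.isUnit_bhat hl.isUnit_bhat).mul_left_cancel
  rw [Matrix.mul_assoc (Ahat n γ s l), ← Matrix.mul_kronecker_mul, ← Matrix.mul_kronecker_mul,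
    ← Matrix.mul_assoc, ← Matrix.mul_assoc, ← hA, Matrix.mul_assoc, ← Matrix.mul_kronecker_mul,
    ← Matrix.mul_kronecker_mul]
  simp only [Matrix.one_mul, Matrix.mul_one, hQ]
  exact hAk

/-- The products of `B`-matrices depend only on the total weight of the first two legs, which
`DACF` preserves. -/
theorem consistency_DB {γ s : ℂ} {l : Fin n → ℂ} (hs : s ≠ 0) (hl : Regular γ l)
    (hl' : ∀ k, Regular γ (shift γ k l)) :
    leg12 (DACF n γ s l) * leg13 (Bhat n γ l) * leg23h1 γ (Bhat n γ) l
      = leg23 (Bhat n γ l) * leg13h2 γ (Bhat n γ) l * leg12 (DACF n γ s l) := by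
  have h13 : leg13 (Bhat n γ l) = diag12 fun i _ => pBlock n γ l i := by
    ext p q
    simp only [leg13, diag12, Matrix.of_apply, Bhat_apply]
    rw [← ite_and]
    exact if_congr and_comm rfl rfl
  have h23 : leg23 (Bhat n γ l) = diag12 fun _ j => pBlock n γ l j := by
    ext p q
    simp only [leg23, diag12, Matrix.of_apply, Bhat_apply]
    rw [← ite_and]
  have h231 : leg23h1 γ (Bhat n γ) l = diag12 fun i j => pBlock n γ (shift γ i l) j := by
    ext p q
    simp only [leg23h1, diag12, Matrix.of_apply, Bhat_apply]
    rw [← ite_and]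
  have h132 : leg13h2 γ (Bhat n γ) l = diag12 fun i j => pBlock n γ (shift γ j l) i := by
    ext p q
    simp only [leg13h2, diag12, Matrix.of_apply, Bhat_apply]
    rw [← ite_and]
    exact if_congr and_comm rfl rfl
  have hT : ∀ i j, bhat n l * (pBlock n γ l i * pBlock n γ (shift γ i l) j)
      = bhat n (shift γ j (shift γ i l)) := by
    intro i j
    rw [← Matrix.mul_assoc, bhat_mul_pBlock hl, bhat_mul_pBlock (hl' i)]
  have hsymm : ∀ i j, pBlock n γ l i * pBlock n γ (shift γ i l) j
      = pBlock n γ l j * pBlock n γ (shift γ j l) i := by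
    intro i j
    apply hl.isUnit_bhat.mul_left_cancel
    rw [hT, hT, shift, shift, shift, shift, add_right_comm]
  rw [Matrix.mul_assoc, h13, h231, h23, h132, diag12_mul, diag12_mul,
    DACF_eq_dynD γ s hs hl.separated, dynD, leg12_mul_diag12 _ _ hsymm]
  congr 2
  ext1 i
  ext1 j
  exact hsymm i j

theorem tendsto_Rhat (γ : ℂ) :
    Tendsto (fun s : ℂ => Rhat n γ s) (Bornology.cobounded ℂ) (𝓝 (RInf n γ)ᵀ) := by
  have h0 : Tendsto (fun s : ℂ => γ / s) (Bornology.cobounded ℂ) (𝓝 0) := by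
    simpa [div_eq_mul_inv] using (tendsto_inv₀_cobounded (α := ℂ)).const_mul γ
  have h1 : Tendsto (fun s : ℂ => 1 + γ / s) (Bornology.cobounded ℂ) (𝓝 1) := by
    simpa using h0.const_add 1
  simp only [Rhat_eq, RInf_eq, Matrix.transpose_add, Matrix.transpose_smul, Matrix.transpose_one]
  refine Tendsto.add (tendsto_pi_nhds.mpr fun p => tendsto_pi_nhds.mpr fun q => ?_)
    tendsto_const_nhds
  rw [one_eq_zeroWeight]
  simp only [zeroWeight, Matrix.of_apply]
  refine Tendsto.add ?_ ?_
  · split_ifs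
    exacts [h1, tendsto_const_nhds, tendsto_const_nhds]
  · split_ifs
    exacts [tendsto_const_nhds, h0, tendsto_const_nhds]

theorem zero_weight {γ s : ℂ} {l : Fin n → ℂ} (i : Fin n) (hs : s ≠ 0) (hl : Separated id l) :
    Commute (leg1 (e i i)) (Bhat n γ l) ∧ Commute (leg2 (e i i)) (Chat n γ l) ∧
      Commute (leg1 (e i i) + leg2 (e i i)) (DACF n γ s l) := by
  refine ⟨?_, ?_, ?_⟩
  · rw [leg1_e]
    refine commute_diagonal fun p q h => ?_
    rw [Bhat_apply, if_neg]
    rintro h'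
    exact h (by rw [h'])
  · rw [leg2_e]
    refine commute_diagonal fun p q h => ?_
    rw [Chat, swap12, Matrix.submatrix_apply, Bhat_apply, if_neg]
    rintro h'
    exact h (by rw [show p.2 = q.2 from h'])
  · rw [leg1_e, leg2_e, Matrix.diagonal_add, DACF_eq_dynD γ s hs hl, dynD]
    refine commute_diagonal fun p q h => ?_
    rw [zeroWeight, Matrix.of_apply, if_neg, if_neg, add_zero]
    · rintro rfl
      exact h (add_comm _ _)
    · rintro rfl
      exact h rfl

end Rational

/-! ### The dynamical Yang–Baxter equation -/

section DynamicalYangBaxter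

variable {n : ℕ}

lemma leg12_zeroWeight_mulVec (α β : (Fin n → ℂ) → Fin n → Fin n → ℂ) (γ : ℂ) (l : Fin n → ℂ)
    (F : Fin n × Fin n × Fin n → ℂ) (a b c : Fin n) :
    (leg12h3 γ (fun m => zeroWeight (α m) (β m)) l *ᵥ F) (a, b, c)
      = α (shift γ c l) a b * F (a, b, c) + β (shift γ c l) a b * F (b, a, c) := by
  have := zeroWeight_mulVec (α (shift γ c l)) (β (shift γ c l)) (fun p => F (p.1, p.2, c)) a b
  rw [← this]
  simp [Matrix.mulVec, dotProduct, leg12h3, Fintype.sum_prod_type]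

lemma leg13_zeroWeight_mulVec (α β : (Fin n → ℂ) → Fin n → Fin n → ℂ) (γ : ℂ) (l : Fin n → ℂ)
    (F : Fin n × Fin n × Fin n → ℂ) (a b c : Fin n) :
    (leg13h2 γ (fun m => zeroWeight (α m) (β m)) l *ᵥ F) (a, b, c)
      = α (shift γ b l) a c * F (a, b, c) + β (shift γ b l) a c * F (c, b, a) := by
  have := zeroWeight_mulVec (α (shift γ b l)) (β (shift γ b l)) (fun p => F (p.1, b, p.2)) a c
  rw [← this]
  simp only [Matrix.mulVec, dotProduct, leg13h2, Fintype.sum_prod_type, Matrix.of_apply]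
  refine Finset.sum_congr rfl fun i _ => ?_
  rw [Finset.sum_comm]
  simp

lemma leg23_zeroWeight_mulVec (α β : (Fin n → ℂ) → Fin n → Fin n → ℂ) (γ : ℂ) (l : Fin n → ℂ)
    (F : Fin n × Fin n × Fin n → ℂ) (a b c : Fin n) :
    (leg23h1 γ (fun m => zeroWeight (α m) (β m)) l *ᵥ F) (a, b, c)
      = α (shift γ a l) b c * F (a, b, c) + β (shift γ a l) b c * F (a, c, b) := by
  have := zeroWeight_mulVec (α (shift γ a l)) (β (shift γ a l)) (fun p => F (a, p.1, p.2)) b c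
  rw [← this]
  simp [Matrix.mulVec, dotProduct, leg23h1, Fintype.sum_prod_type]

lemma wAlpha_id {γ t : ℂ} (ht : t ≠ 0) : wAlpha id γ t = 1 - γ * t⁻¹ := by
  simp only [wAlpha, id]; field_simp

lemma wBeta_id {γ s t : ℂ} (hs : s ≠ 0) (ht : t ≠ 0) : wBeta id γ s t = γ * (t⁻¹ + s⁻¹) := by
  simp only [wBeta, id]; field_simp

lemma inv_add_mul_inv_add_inv {x y : ℂ} (hx : x ≠ 0) (hy : y ≠ 0) (hxy : x + y ≠ 0) :
    (x + y)⁻¹ * (x⁻¹ + y⁻¹) = x⁻¹ * y⁻¹ := by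
  field_simp
  ring

/-- The dynamical Yang–Baxter equation applied to a tensor `F`, at the entry `(a, b, c)`. In the
inverses of the spectral parameters and of the differences of the `λ`, the weights are affine. The
only relations needed are `inv_add_mul_inv_add_inv` and, when two of the indices agree, the one
between the inverses of a difference and of its shift. -/
theorem dynamical_yang_baxter_apply {γ s t : ℂ} {l : Fin n → ℂ} (hs : s ≠ 0) (ht : t ≠ 0)
    (hst : s + t ≠ 0) (hl : Regular γ l) (F : Fin n → Fin n → Fin n → ℂ) (a b c : Fin n) :
    dynAlpha id γ s (shift γ c l) a b * (dynAlpha id γ (s + t) l a c *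
          (dynAlpha id γ t (shift γ a l) b c * F a b c + dynBeta id γ t (shift γ a l) b c * F a c b)
        + dynBeta id γ (s + t) l a c *
          (dynAlpha id γ t (shift γ c l) b a * F c b a
            + dynBeta id γ t (shift γ c l) b a * F c a b))
      + dynBeta id γ s (shift γ c l) a b * (dynAlpha id γ (s + t) l b c *
          (dynAlpha id γ t (shift γ b l) a c * F b a c + dynBeta id γ t (shift γ b l) a c * F b c a)
        + dynBeta id γ (s + t) l b c *
          (dynAlpha id γ t (shift γ c l) a b * F c a b
            + dynBeta id γ t (shift γ c l) a b * F c b a))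
    = dynAlpha id γ t l b c * (dynAlpha id γ (s + t) (shift γ b l) a c *
          (dynAlpha id γ s l a b * F a b c + dynBeta id γ s l a b * F b a c)
        + dynBeta id γ (s + t) (shift γ b l) a c *
          (dynAlpha id γ s l c b * F c b a + dynBeta id γ s l c b * F b c a))
      + dynBeta id γ t l b c * (dynAlpha id γ (s + t) (shift γ c l) a b *
          (dynAlpha id γ s l a c * F a c b + dynBeta id γ s l a c * F c a b)
        + dynBeta id γ (s + t) (shift γ c l) a b *
          (dynAlpha id γ s l b c * F b c a + dynBeta id γ s l b c * F c b a)) := by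
  have hST := inv_add_mul_inv_add_inv hs ht hst
  have hα : ∀ {x : ℂ}, x ≠ 0 → (id (x + γ) : ℂ) / id x = 1 + γ * x⁻¹ := by
    intro x hx
    simp only [id]; field_simp
  -- the relation between the inverses of `λ` and of a shifted `λ`
  have hres : ∀ {x : ℂ}, x ≠ 0 → x + γ ≠ 0 → x⁻¹ - (x + γ)⁻¹ = γ * x⁻¹ * (x + γ)⁻¹ := by
    intro x hx hxγ
    field_simp
    ring
  rcases eq_or_ne a b with rfl | hab
  · rcases eq_or_ne a c with rfl | hac
    · simp only [dynAlpha, dynBeta, if_true]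
      ring
    · obtain ⟨hx, hxγ⟩ := hl a c hac
      have hP := hres hx hxγ
      have e1 : l c - l a = -(l a - l c) := by ring
      have e2 : l a + γ - l c = l a - l c + γ := by ring
      simp only [dynAlpha, dynBeta, if_true, hac, hac.symm, if_false, shift_apply_self,
        shift_apply_of_ne γ hac.symm, hα hs, hα ht, hα hst, e1, e2,
        wAlpha_id hx, wAlpha_id hxγ, wAlpha_id (neg_ne_zero.mpr hx), wBeta_id hs hx,
        wBeta_id ht hx, wBeta_id hst hx, wBeta_id ht hxγ, wBeta_id hst hxγ,
        wBeta_id hs (neg_ne_zero.mpr hx), inv_neg]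
      generalize (l a - l c + γ)⁻¹ = P at *
      generalize (l a - l c)⁻¹ = p at *
      generalize s⁻¹ = S at *
      generalize t⁻¹ = T at *
      generalize (s + t)⁻¹ = U at *
      clear hα hres hl e1 e2
      grind
  rcases eq_or_ne a c with rfl | hac
  · obtain ⟨hx, hxγ⟩ := hl a b hab
    have hP := hres hx hxγ
    have e1 : l b - l a = -(l a - l b) := by ring
    have e2 : l a + γ - l b = l a - l b + γ := by ring
    have e3 : l b - (l a + γ) = -(l a - l b + γ) := by ring
    simp only [dynAlpha, dynBeta, if_true, hab, hab.symm, if_false, shift_apply_self,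
      shift_apply_of_ne γ hab.symm, hα hs, hα ht, hα hst, e1, e2, e3,
      wAlpha_id hx, wAlpha_id hxγ, wAlpha_id (neg_ne_zero.mpr hx),
      wAlpha_id (neg_ne_zero.mpr hxγ), wBeta_id hs hx,
      wBeta_id hs hxγ, wBeta_id ht hxγ, wBeta_id hst hxγ,
      wBeta_id hs (neg_ne_zero.mpr hx), wBeta_id ht (neg_ne_zero.mpr hx),
      wBeta_id hst (neg_ne_zero.mpr hx), wBeta_id ht (neg_ne_zero.mpr hxγ), inv_neg]
    generalize (l a - l b + γ)⁻¹ = P at *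
    generalize (l a - l b)⁻¹ = p at *
    generalize s⁻¹ = S at *
    generalize t⁻¹ = T at *
    generalize (s + t)⁻¹ = U at *
    clear hα hres hl e1 e2 e3
    grind
  rcases eq_or_ne b c with rfl | hbc
  · obtain ⟨hx, hxγ⟩ := hl b a hab.symm
    have hP := hres hx hxγ
    have e1 : l a - l b = -(l b - l a) := by ring
    have e2 : l b + γ - l a = l b - l a + γ := by ring
    have e3 : l a - (l b + γ) = -(l b - l a + γ) := by ring
    simp only [dynAlpha, dynBeta, if_true, hab, hab.symm, if_false, shift_apply_self,
      shift_apply_of_ne γ hab, hα hs, hα ht, hα hst, e1, e2, e3, wAlpha_id hxγ,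
      wBeta_id ht hxγ, wAlpha_id (neg_ne_zero.mpr hx), wAlpha_id (neg_ne_zero.mpr hxγ),
      wBeta_id hs (neg_ne_zero.mpr hx), wBeta_id hst (neg_ne_zero.mpr hx),
      wBeta_id hs (neg_ne_zero.mpr hxγ), wBeta_id ht (neg_ne_zero.mpr hxγ),
      wBeta_id hst (neg_ne_zero.mpr hxγ), inv_neg]
    generalize (l b - l a + γ)⁻¹ = P at *
    generalize (l b - l a)⁻¹ = p at *
    generalize s⁻¹ = S at *
    generalize t⁻¹ = T at *
    generalize (s + t)⁻¹ = U at *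
    clear hα hres hl e1 e2 e3
    grind
  · have hx := (hl a b hab).1
    have hy := (hl b c hbc).1
    have hz := (hl a c hac).1
    have e1 : l b - l a = -(l a - l b) := by ring
    have e2 : l c - l b = -(l b - l c) := by ring
    have hr : (l a - l c)⁻¹ * ((l a - l b)⁻¹ + (l b - l c)⁻¹) = (l a - l b)⁻¹ * (l b - l c)⁻¹ := by
      have := inv_add_mul_inv_add_inv hx hy (by rwa [sub_add_sub_cancel])
      rwa [sub_add_sub_cancel] at this
    simp only [dynAlpha, dynBeta, hab, hab.symm, hac, hbc, hbc.symm, if_false,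
      shift_apply_of_ne γ hab, shift_apply_of_ne γ hab.symm, shift_apply_of_ne γ hac,
      shift_apply_of_ne γ hac.symm, shift_apply_of_ne γ hbc, shift_apply_of_ne γ hbc.symm,
      e1, e2, wAlpha_id hx, wAlpha_id hy, wAlpha_id hz, wBeta_id hs hx, wBeta_id hs hy,
      wBeta_id hs hz, wBeta_id ht hx, wBeta_id ht hy, wBeta_id ht hz, wBeta_id hst hx,
      wBeta_id hst hy, wBeta_id hst hz, wAlpha_id (neg_ne_zero.mpr hx),
      wAlpha_id (neg_ne_zero.mpr hy), wBeta_id hs (neg_ne_zero.mpr hy),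
      wBeta_id ht (neg_ne_zero.mpr hx), inv_neg]
    generalize (l a - l b)⁻¹ = p at *
    generalize (l b - l c)⁻¹ = q at *
    generalize (l a - l c)⁻¹ = r at *
    generalize s⁻¹ = S at *
    generalize t⁻¹ = T at *
    generalize (s + t)⁻¹ = U at *
    clear hα hres hl e1 e2
    grind

theorem dynamical_yang_baxter {γ s t : ℂ} {l : Fin n → ℂ} (hs : s ≠ 0) (ht : t ≠ 0)
    (hst : s + t ≠ 0) (hl : Regular γ l) :
    leg12h3 γ (DACF n γ s) l * leg13 (DACF n γ (s + t) l) * leg23h1 γ (DACF n γ t) l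
      = leg23 (DACF n γ t l) * leg13h2 γ (DACF n γ (s + t)) l * leg12 (DACF n γ s l) := by
  have h12 : leg12h3 γ (DACF n γ s) l = leg12h3 γ (fun m =>
      zeroWeight (dynAlpha id γ s m) (dynBeta id γ s m)) l := by
    simp only [leg12h3, DACF_eq_dynD γ s hs (hl.separated_shift _), dynD]
  have h23 : leg23h1 γ (DACF n γ t) l = leg23h1 γ (fun m =>
      zeroWeight (dynAlpha id γ t m) (dynBeta id γ t m)) l := by
    simp only [leg23h1, DACF_eq_dynD γ t ht (hl.separated_shift _), dynD]
  have h13 : leg13h2 γ (DACF n γ (s + t)) l = leg13h2 γ (fun m =>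
      zeroWeight (dynAlpha id γ (s + t) m) (dynBeta id γ (s + t) m)) l := by
    simp only [leg13h2, DACF_eq_dynD γ _ hst (hl.separated_shift _), dynD]
  -- an undressed leg is a dressed leg of a function of `λ` that is constant
  have k12 : leg12 (DACF n γ s l) = leg12h3 γ (fun _ =>
      zeroWeight (dynAlpha id γ s l) (dynBeta id γ s l)) l := by
    rw [DACF_eq_dynD γ s hs hl.separated]; rfl
  have k23 : leg23 (DACF n γ t l) = leg23h1 γ (fun _ =>
      zeroWeight (dynAlpha id γ t l) (dynBeta id γ t l)) l := by
    rw [DACF_eq_dynD γ t ht hl.separated]; rfl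
  have k13 : leg13 (DACF n γ (s + t) l) = leg13h2 γ (fun _ =>
      zeroWeight (dynAlpha id γ (s + t) l) (dynBeta id γ (s + t) l)) l := by
    rw [DACF_eq_dynD γ _ hst hl.separated]; rfl
  rw [h12, h23, h13, k12, k23, k13]
  apply Matrix.mulVec_injective
  funext F
  ext ⟨a, b, c⟩
  simp only [← Matrix.mulVec_mulVec, leg12_zeroWeight_mulVec, leg13_zeroWeight_mulVec,
    leg23_zeroWeight_mulVec]
  exact dynamical_yang_baxter_apply hs ht hst hl (fun a b c => F (a, b, c)) a b c

end DynamicalYangBaxter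

/-! ### The rational limit of the twisted matrices -/

section RationalLimit

variable {n : ℕ}

lemma TrigRegular.separated {γ : ℂ} {l : Fin n → ℂ} (h : TrigRegular γ l) :
    Separated Complex.sinh l :=
  fun i j hij => (h i j hij).1

theorem tendsto_trigB (γ v : ℂ) {l : Fin n → ℂ} (hl : Regular γ l) :
    Tendsto (fun ε : ℂ => trigB n (ε * γ) (ε * v) (ε • l)) (𝓝[≠] 0) (𝓝 (Bhat n γ l)) := by
  rw [Bhat_eq_dynB]
  refine (tendsto_dynB (n + 1) γ hl).congr' ?_
  filter_upwards [eventually_trigRegular hl] with ε hε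
  exact ((vertexFace_trig n (ε * γ)).dynB_eq (ε * v) hε.separated fun i j h => (hε i j h).2).symm

theorem tendsto_trigA (γ : ℂ) {u v : ℂ} (huv : u ≠ v) {l : Fin n → ℂ} (hl : Regular γ l) :
    Tendsto (fun ε : ℂ => trigA n (ε * γ) (ε * u) (ε * v) (ε • l)) (𝓝[≠] 0)
      (𝓝 (Ahat n γ (u - v) l)) := by
  rw [Ahat_eq_dynA γ _ (sub_ne_zero.mpr huv) hl.separated]
  refine (tendsto_dynA (n + 1) γ (sub_ne_zero.mpr huv) hl.separated).congr' ?_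
  filter_upwards [eventually_trigRegular hl, eventually_sinh_ne_zero (sub_ne_zero.mpr huv)]
    with ε hε hs
  rw [mul_sub] at hs ⊢
  exact ((vertexFace_trig n (ε * γ)).dynA_eq hs hε.separated).symm

theorem tendsto_trigD (γ : ℂ) {s : ℂ} (hs : s ≠ 0) {l : Fin n → ℂ} (hl : Separated id l) :
    Tendsto (fun ε : ℂ => trigD n (ε * γ) (ε * s) (ε • l)) (𝓝[≠] 0) (𝓝 (DACF n γ s l)) := by
  simp only [trigD_eq_dynD, DACF_eq_dynD γ s hs hl]
  exact tendsto_dynD γ hs hl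

end RationalLimit

end SDRE

theorem mainTheorem2 (n : ℕ) (γ : ℂ) :
    -- alternative decompositions of the trigonometric `D`-matrix, and the twist is invertible
    (∀ (u v : ℂ) (l : Fin n → ℂ), Complex.sinh (u - v) ≠ 0 → SDRE.TrigRegular γ l →
      IsUnit (SDRE.cTilde n u l) ∧
      SDRE.trigS n γ (u - v) * SDRE.leg1 (SDRE.cTilde n u l)
          * SDRE.leg2h1 (-γ) (SDRE.cTilde n v) l
        = SDRE.leg2 (SDRE.cTilde n v l) * SDRE.leg1h2 (-γ) (SDRE.cTilde n u) l
          * (SDRE.trigD n γ (u - v) l)ᵀ ∧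
      (SDRE.trigS n γ (u - v))ᵀ * SDRE.leg1 (SDRE.cMat n u l)
          * SDRE.leg2h1 γ (SDRE.cMat n v) l
        = SDRE.leg2 (SDRE.cMat n v l) * SDRE.leg1h2 γ (SDRE.cMat n u) l
          * SDRE.trigD n γ (u - v) l) ∧
    -- `Sᵀ` solves the ordinary Yang–Baxter equation
    (∀ u₁ u₂ u₃ : ℂ, Complex.sinh (u₁ - u₂) ≠ 0 → Complex.sinh (u₁ - u₃) ≠ 0 →
      Complex.sinh (u₂ - u₃) ≠ 0 →
      SDRE.YBE (fun s => (SDRE.trigS n γ s)ᵀ) u₁ u₂ u₃) ∧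
    -- `B̂`, `Â` and `D` are the rational limits
    (∀ (u v : ℂ) (l : Fin n → ℂ), u ≠ v → SDRE.Regular γ l →
      Tendsto (fun ε : ℂ => SDRE.trigB n (ε * γ) (ε * v) (ε • l)) (𝓝[≠] 0)
        (𝓝 (SDRE.Bhat n γ l)) ∧
      Tendsto (fun ε : ℂ => SDRE.trigA n (ε * γ) (ε * u) (ε * v) (ε • l)) (𝓝[≠] 0)
        (𝓝 (SDRE.Ahat n γ (u - v) l)) ∧
      Tendsto (fun ε : ℂ => SDRE.trigD n (ε * γ) (ε * (u - v)) (ε • l)) (𝓝[≠] 0)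
        (𝓝 (SDRE.DACF n γ (u - v) l))) ∧
    -- zero-weight conditions
    (∀ (s : ℂ) (l : Fin n → ℂ) (i : Fin n), s ≠ 0 → SDRE.Regular γ l →
      Commute (SDRE.leg1 (SDRE.e i i)) (SDRE.Bhat n γ l) ∧
      Commute (SDRE.leg2 (SDRE.e i i)) (SDRE.Chat n γ l) ∧
      Commute (SDRE.leg1 (SDRE.e i i) + SDRE.leg2 (SDRE.e i i)) (SDRE.DACF n γ s l)) ∧
    -- invertibility
    (∀ l : Fin n → ℂ, Function.Injective l → IsUnit (SDRE.bhat n l)) ∧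
    (∀ l : Fin n → ℂ, SDRE.Regular γ l →
      IsUnit (SDRE.Bhat n γ l) ∧ IsUnit (SDRE.Chat n γ l)) ∧
    (∀ (s : ℂ) (l : Fin n → ℂ), s ≠ 0 → s ≠ γ → s ≠ -γ → SDRE.Regular γ l →
      IsUnit (SDRE.Ahat n γ s l) ∧ IsUnit (SDRE.DACF n γ s l) ∧ IsUnit (SDRE.Rhat n γ s)) ∧
    -- the consistency equations a, b, d, c with `g = 1`
    (∀ (u₁ u₂ u₃ : ℂ) (l : Fin n → ℂ), u₁ ≠ u₂ → u₁ ≠ u₃ → u₂ ≠ u₃ → SDRE.Regular γ l →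
      (SDRE.leg12 (SDRE.Ahat n γ (u₁ - u₂) l) * SDRE.leg13 (SDRE.Ahat n γ (u₁ - u₃) l)
          * SDRE.leg23 (SDRE.Ahat n γ (u₂ - u₃) l)
        = SDRE.leg23 (SDRE.Ahat n γ (u₂ - u₃) l) * SDRE.leg13 (SDRE.Ahat n γ (u₁ - u₃) l)
          * SDRE.leg12 (SDRE.Ahat n γ (u₁ - u₂) l)) ∧
      (SDRE.leg12 (SDRE.Ahat n γ (u₁ - u₂) l) * SDRE.leg13 (SDRE.Chat n γ l)
          * SDRE.leg23 (SDRE.Chat n γ l)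
        = SDRE.leg23 (SDRE.Chat n γ l) * SDRE.leg13 (SDRE.Chat n γ l)
          * SDRE.leg12h3 γ (SDRE.Ahat n γ (u₁ - u₂)) l) ∧
      (SDRE.leg12h3 γ (SDRE.DACF n γ (u₁ - u₂)) l * SDRE.leg13 (SDRE.DACF n γ (u₁ - u₃) l)
          * SDRE.leg23h1 γ (SDRE.DACF n γ (u₂ - u₃)) l
        = SDRE.leg23 (SDRE.DACF n γ (u₂ - u₃) l) * SDRE.leg13h2 γ (SDRE.DACF n γ (u₁ - u₃)) l
          * SDRE.leg12 (SDRE.DACF n γ (u₁ - u₂) l)) ∧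
      ((∀ k, SDRE.Regular γ (SDRE.shift γ k l)) →
        SDRE.leg12 (SDRE.DACF n γ (u₁ - u₂) l) * SDRE.leg13 (SDRE.Bhat n γ l)
            * SDRE.leg23h1 γ (SDRE.Bhat n γ) l
          = SDRE.leg23 (SDRE.Bhat n γ l) * SDRE.leg13h2 γ (SDRE.Bhat n γ) l
            * SDRE.leg12 (SDRE.DACF n γ (u₁ - u₂) l))) ∧
    -- parametrization by the twist `b̂` and the non-dynamical `R̂`
    (∀ (s : ℂ) (l : Fin n → ℂ), s ≠ 0 → SDRE.Regular γ l →
      SDRE.Bhat n γ l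
        = (SDRE.leg2 (SDRE.bhat n l))⁻¹ * SDRE.leg2h1 γ (SDRE.bhat n) l ∧
      SDRE.Ahat n γ s l
        = (SDRE.leg1 (SDRE.bhat n l))⁻¹ * (SDRE.leg2 (SDRE.bhat n l))⁻¹ * SDRE.Rhat n γ s
          * SDRE.leg1 (SDRE.bhat n l) * SDRE.leg2 (SDRE.bhat n l) ∧
      SDRE.DACF n γ s l
        = (SDRE.leg1h2 γ (SDRE.bhat n) l)⁻¹ * (SDRE.leg2 (SDRE.bhat n l))⁻¹ * SDRE.Rhat n γ s
          * SDRE.leg1 (SDRE.bhat n l) * SDRE.leg2h1 γ (SDRE.bhat n) l) ∧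
    -- `R̂` solves the ordinary Yang–Baxter equation
    (∀ u₁ u₂ u₃ : ℂ, u₁ ≠ u₂ → u₁ ≠ u₃ → u₂ ≠ u₃ →
      SDRE.YBE (SDRE.Rhat n γ) u₁ u₂ u₃) ∧
    -- without spectral parameter `R̂` becomes the transposed Cremmer–Gervais-type matrix
    Tendsto (fun s : ℂ => SDRE.Rhat n γ s) (Bornology.cobounded ℂ) (𝓝 (SDRE.RInf n γ)ᵀ) := by
  have sub_ne {x y : ℂ} (h : x ≠ y) : x - y ≠ 0 := sub_ne_zero.mpr h
  refine ⟨fun u v l huv hl => ⟨?_, ?_, ?_⟩, fun u₁ u₂ u₃ h₁₂ h₁₃ h₂₃ => ?_,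
    fun u v l huv hl => ⟨SDRE.tendsto_trigB γ v hl, SDRE.tendsto_trigA γ huv hl,
      SDRE.tendsto_trigD γ (sub_ne huv) hl.separated⟩,
    fun s l i hs hl => SDRE.zero_weight i hs hl.separated, fun l hl => SDRE.isUnit_bhat hl,
    fun l hl => ⟨SDRE.isUnit_Bhat hl, SDRE.isUnit_Chat hl⟩,
    fun s l hs h₁ h₂ hl => ⟨SDRE.isUnit_Ahat hs h₁ h₂ hl, SDRE.isUnit_DACF hs h₁ h₂ hl.separated,
      SDRE.isUnit_Rhat hs h₁ h₂⟩,
    fun u₁ u₂ u₃ l h₁₂ h₁₃ h₂₃ hl => ⟨SDRE.yang_baxter_Ahat hl.separated h₁₂ h₁₃ h₂₃,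
      SDRE.consistency_AC (sub_ne h₁₂) hl, ?_, SDRE.consistency_DB (sub_ne h₁₂) hl⟩,
    fun s l hs hl => ⟨SDRE.Bhat_eq hl, SDRE.Ahat_eq hs hl.separated, SDRE.DACF_eq hs hl⟩,
    fun u₁ u₂ u₃ h₁₂ h₁₃ h₂₃ => SDRE.yang_baxter_Rhat γ h₁₂ h₁₃ h₂₃, SDRE.tendsto_Rhat γ⟩
  · exact (SDRE.vertexFace_trig n γ).isUnit u l hl.separated
  · rw [SDRE.trigD_eq_dynD]
    exact (SDRE.vertexFace_trig n γ).vector_decomposition huv hl.separated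
  · rw [SDRE.trigD_eq_dynD]
    exact (SDRE.vertexFace_trig n γ).covector_decomposition huv hl.separated
      fun i j hij => (hl i j hij).2
  · exact (SDRE.vertexFace_trig n γ).yang_baxter_transpose h₁₂ h₁₃ h₂₃
  · have h : u₁ - u₂ + (u₂ - u₃) = u₁ - u₃ := sub_add_sub_cancel _ _ _
    rw [← h]
    exact SDRE.dynamical_yang_baxter (sub_ne h₁₂) (sub_ne h₂₃) (h ▸ sub_ne h₁₃) hl
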